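/- **Setting.** Work in the Euclidean plane or in the hyperbolic plane (curvature $-1$), with polar coordinates $(\phi,r)$. Let $R>0$ and let $j(\phi,r)=j(r)$ be a rotationally invariant probability density with respect to $d\phi\,dr$ on the disk $\mathbb{D}_R$ of radius $R$ that is continuous on the open disk, integrable, positive for $0<r<R$ and zero for $r\ge R$; let $J(r)$ be the probability mass within radius $r$. Let $P$ consist of $n$ independent points with density $j$. *Quadtree.* A cell is a set $[\min_\phi,\max_\phi)\times[\min_r,\max_r)$. The root is $[0,2\pi)\times[0,R)$. A cell is split into four children exactly if it holds more than $\mathrm{cap}$ points of $P$, where the capacity $\mathrm{cap}\ge 1$ is a fixed integer; the split is at $\mathrm{mid}_\phi=(\min_\phi+\max_\phi)/2$ and $\mathrm{mid}_r=(J|_{[0,R]})^{-1}\bigl((J(\min_r)+J(\max_r))/2\bigr)$. Every node $c$ stores the number $|c|$ of points in its subtree. *Query.* A query pair $(q,f)$ consists of a point $q$ of the plane and a decreasing function $f:[0,\infty)\to[0,1]$ (not necessarily continuous). The query with subtree aggregation starts at the root. At a node $c$ it sets $\overline b=f(\mathrm{dist}(q,c))$, where $\mathrm{dist}(q,c)$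 is the infimum of the distances from $q$ to points of $c$. If $c$ is an inner node and $|c|\cdot\overline b\ge 1$, it calls itself on the four children and merges the results. Otherwise it runs through the points of the subtree of $c$, numbered $0,\dots,|c|-1$, skipping before each selected point $\lfloor \ln(1-\mathit{rand})/\ln(1-\overline b)\rfloor$ points (none if $\overline b=1$, all if $\overline b=0$), with independent $\mathit{rand}$ uniform on $[0,1)$; each selected point $p$ (a *candidate*) is found by descending from $c$ to the leaf that contains it, and is added to the result with probability $f(\mathrm{dist}(q,p))/\overline b$. Let $N(q,f)\subseteq P$ be the result, $\mathrm{Candidates}(q,f)$ the set of candidates, and $\mathrm{Cells}(q,f)$ the set of nodes on which the query is called. The running time counts one step for each call of the query, each iteration of the candidate loop, each call and each inspected child in a descent to a candidate, and one step for merging the result of a call plus one for each point merged. **Theorem.** For every capacity $\mathrm{cap}\ge1$ there are $C>0$ and $n_0$, depending only on $\mathrm{cap}$, such that for either geometry, all $R$ and $j$ as above, every query pair $(q,f)$ and every $n\ge n_0$, the running time of the query $(q,f)$ with subtree aggregation is at most $C\,(|N(q,f)|+\sqrt n)\log n$ with probability at least $1-1/n$, the probability being over the points and the random choices of the query. Moreover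 $|\mathrm{Candidates}(q,f)|\le C\,(|N(q,f)|+\sqrt n)$ with probability at least $1-1/n$, and $|\mathrm{Cells}(q,f)|\le C\,(|N(q,f)|+\sqrt n)\log n$ with probability at least $1-1/n$. -/

import Mathlib

open MeasureTheory
open scoped ENNReal

noncomputable section

namespace PNQ

/-! ### Geometry in polar coordinates -/

/-- The two planes: Euclidean, and hyperbolic of curvature `-1`. -/
inductive Geometry where
  | euclidean
  | hyperbolic

/-- A point of the plane in polar coordinates: `(angle, radius)`. -/
abbrev PolarPoint := ℝ × ℝ

/-- The distance of two points given in polar coordinates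
(Euclidean, respectively hyperbolic, law of cosines). -/
def Geometry.dist : Geometry → PolarPoint → PolarPoint → ℝ
  | .euclidean, p, q =>
      Real.sqrt (p.2 ^ 2 + q.2 ^ 2 - 2 * p.2 * q.2 * Real.cos (p.1 - q.1))
  | .hyperbolic, p, q =>
      Real.arcosh (Real.cosh p.2 * Real.cosh q.2
        - Real.sinh p.2 * Real.sinh q.2 * Real.cos (p.1 - q.1))

/-! ### Point distributions -/

/-- A rotationally invariant probability density `j(φ, r)` on the disk of radius `R`, with respect
to `dφ dr`. It is continuous on the open disk and integrable, and positive exactly for radii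
below `R`. Positivity is not required at the single radius `0`, so that a density
with respect to the Euclidean (or hyperbolic) area, which acquires the factor `r` (or `sinh r`)
in polar coordinates, is covered. -/
structure PolarDensity (R : ℝ) where
  j : ℝ → ℝ → ℝ
  radius_pos : 0 < R
  rotation_invariant : ∀ φ₁ φ₂ r, j φ₁ r = j φ₂ r
  continuousOn : ContinuousOn (Function.uncurry j) (Set.univ ×ˢ Set.Ico 0 R)
  integrableOn : IntegrableOn (Function.uncurry j) (Set.Ico 0 (2 * Real.pi) ×ˢ Set.Ico 0 R)
  pos_iff : ∀ φ r, 0 < r → (0 < j φ r ↔ r < R)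
  zero_outside : ∀ φ r, R ≤ r → j φ r = 0
  total_mass : (∫ r in (0 : ℝ)..R, ∫ φ in (0 : ℝ)..(2 * Real.pi), j φ r) = 1

/-- `J r` is the probability mass inside radius `r`. -/
def PolarDensity.J {R : ℝ} (D : PolarDensity R) (r : ℝ) : ℝ :=
  ∫ s in (0 : ℝ)..r, ∫ φ in (0 : ℝ)..(2 * Real.pi), D.j φ s

/-- The law of one random point, in polar coordinates with angle in `[0, 2π)`. -/
def PolarDensity.law {R : ℝ} (D : PolarDensity R) : Measure PolarPoint :=
  (volume.restrict (Set.Ico 0 (2 * Real.pi) ×ˢ Set.Ico 0 R)).withDensity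
    fun p => ENNReal.ofReal (D.j p.1 p.2)

/-! ### The polar quadtree -/

/-- A quadtree cell, delimited in the angular and in the radial direction. -/
structure Cell where
  minφ : ℝ
  maxφ : ℝ
  minr : ℝ
  maxr : ℝ

/-- The points that a cell is responsible for. -/
def Cell.region (c : Cell) : Set PolarPoint :=
  Set.Ico c.minφ c.maxφ ×ˢ Set.Ico c.minr c.maxr

/-- Distance of a point to a cell: the infimum of the distances to the points of the cell. -/
def cellDist (G : Geometry) (q : PolarPoint) (c : Cell) : ℝ :=
  sInf (G.dist q '' c.region)

/-- The root cell is the whole disk. -/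
def rootCell (R : ℝ) : Cell := ⟨0, 2 * Real.pi, 0, R⟩

/-- The angular splitting coordinate. -/
def Cell.midφ (c : Cell) : ℝ := (c.maxφ + c.minφ) / 2

/-- The radial splitting coordinate, which halves the probability mass: the inverse of `J` on
`[0, R]`, at the mean of the values of `J` at the two radial boundaries. -/
def PolarDensity.midr {R : ℝ} (D : PolarDensity R) (c : Cell) : ℝ :=
  Function.invFunOn D.J (Set.Icc 0 R) ((D.J c.maxr + D.J c.minr) / 2)

/-- The four children of a cell. -/
def PolarDensity.child {R : ℝ} (D : PolarDensity R) (c : Cell) : Fin 4 → Cell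
  | 0 => ⟨c.minφ, c.midφ, c.minr, D.midr c⟩
  | 1 => ⟨c.midφ, c.maxφ, c.minr, D.midr c⟩
  | 2 => ⟨c.minφ, c.midφ, D.midr c, c.maxr⟩
  | 3 => ⟨c.midφ, c.maxφ, D.midr c, c.maxr⟩

/-- Quadtrees over the points with indices in `Fin n`. A leaf stores its cell and its points,
an inner node its cell, the number of points in its subtree, and its four children. -/
inductive QuadTree (n : ℕ) where
  | leaf (c : Cell) (points : List (Fin n)) : QuadTree n
  | node (c : Cell) (size : ℕ) (children : Fin 4 → QuadTree n) : QuadTree n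

/-- The cell of the root of a (sub)tree. -/
def QuadTree.cell {n : ℕ} : QuadTree n → Cell
  | .leaf c _ => c
  | .node c _ _ => c

/-- The number of points in a (sub)tree, as recorded at its root. -/
def QuadTree.size {n : ℕ} : QuadTree n → ℕ
  | .leaf _ points => points.length
  | .node _ s _ => s

open Classical in
/-- Those of the listed points that lie in a cell, in the same order. -/
def pointsIn {n : ℕ} (pos : Fin n → PolarPoint) (c : Cell) (l : List (Fin n)) : List (Fin n) :=
  l.filter fun i => decide (pos i ∈ c.region)

/-- `Resolved D cap pos d c l`: when cells with more than `cap` points are split repeatedly,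
starting from the cell `c` with points `l`, the process ends within `d` levels. -/
def Resolved {R : ℝ} (D : PolarDensity R) (cap : ℕ) {n : ℕ} (pos : Fin n → PolarPoint) :
    ℕ → Cell → List (Fin n) → Prop
  | 0, _, l => l.length ≤ cap
  | d + 1, c, l => l.length ≤ cap ∨
      ∀ k, Resolved D cap pos d (D.child c k) (pointsIn pos (D.child c k) l)

/-- The quadtree below the cell `c` with points `l`: a cell is split exactly if it
holds more points than the capacity `cap`. The recursion is cut off after `d` levels. -/
def build {R : ℝ} (D : PolarDensity R) (cap : ℕ) {n : ℕ} (pos : Fin n → PolarPoint) :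
    ℕ → Cell → List (Fin n) → QuadTree n
  | 0, c, l => .leaf c l
  | d + 1, c, l =>
      if l.length ≤ cap then .leaf c l
      else .node c l.length fun k =>
        build D cap pos d (D.child c k) (pointsIn pos (D.child c k) l)

/-- The polar quadtree with leaf capacity `cap` on the given points. The number of levels is the
one at which the splitting process ends. (The process ends unless more than `cap` points
coincide, an event of probability zero for `1 ≤ cap`.) -/
def quadtree {R : ℝ} (D : PolarDensity R) (cap : ℕ) {n : ℕ} (pos : Fin n → PolarPoint) :
    QuadTree n :=
  build D cap pos (sInf {d | Resolved D cap pos d (rootCell R) (List.finRange n)})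
    (rootCell R) (List.finRange n)

/-! ### Random numbers -/

/-- The law of `rand`: uniform on `[0, 1)`. -/
def randLaw : Measure ℝ := volume.restrict (Set.Ico 0 1)

instance : IsProbabilityMeasure randLaw := ⟨by simp [randLaw]⟩

/-- The jumping width `⌊ln(1 - rand) / ln(1 - b)⌋` for `0 < b`; for `b = 1`
the denominator is `-∞` and the width is `0`. -/
def jumpWidth (b rand : ℝ) : ℕ :=
  if b = 1 then 0 else ⌊Real.log (1 - rand) / Real.log (1 - b)⌋₊

theorem measurable_jumpWidth (b : ℝ) : Measurable (jumpWidth b) := by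
  unfold jumpWidth
  split_ifs
  · exact measurable_const
  · exact Nat.measurable_floor.comp (by fun_prop)

instance (b : ℝ) : IsProbabilityMeasure (randLaw.map (jumpWidth b)) :=
  Measure.isProbabilityMeasure_map (measurable_jumpWidth b).aemeasurable

/-- The distribution of the jumping width. -/
def jump (b : ℝ) : PMF ℕ := (randLaw.map (jumpWidth b)).toPMF

/-- The outcome of the test `1 - rand < a`. -/
def acceptTest (a rand : ℝ) : Bool := decide (1 - rand < a)

theorem measurable_acceptTest (a : ℝ) : Measurable (acceptTest a) := by
  unfold acceptTest
  exact measurable_to_bool (by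
    simpa [Set.preimage, sub_lt_comm] using measurableSet_lt measurable_const measurable_id)

instance (a : ℝ) : IsProbabilityMeasure (randLaw.map (acceptTest a)) :=
  Measure.isProbabilityMeasure_map (measurable_acceptTest a).aemeasurable

/-- The distribution of the outcome of the test `1 - rand < a`. -/
def accept (a : ℝ) : PMF Bool := (randLaw.map (acceptTest a)).toPMF

/-! ### The query algorithm -/

/-- A query pair: a query point `(φ, r)` with `0 ≤ r` and a decreasing function from nonnegative
reals to `[0, 1]`. -/
structure Query where
  q : PolarPoint
  f : ℝ → ℝ
  radius_nonneg : 0 ≤ q.2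
  f_mem : ∀ d, 0 ≤ d → f d ∈ Set.Icc (0 : ℝ) 1
  f_antitone : AntitoneOn f (Set.Ici 0)

/-- What an execution of (a part of) the algorithm produces: the neighbors found, the candidates
examined, the number of quadtree cells examined, i.e. of recursive calls of the query,
and the number of elementary steps. -/
structure Outcome (n : ℕ) where
  neighbors : List (Fin n)
  candidates : List (Fin n)
  cells : ℕ
  time : ℕ

/-- Descend to the `k`-th point of a subtree and accept it with probability `f(dist) / b`.
Returns the point, the point again if it is accepted, and the number of steps:
one for each call and one for each child that is inspected. -/
def maybeGetKthElement (G : Geometry) (Q : Query) {n : ℕ} (pos : Fin n → PolarPoint) (b : ℝ) :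
    QuadTree n → ℕ → PMF (Option (Fin n) × Option (Fin n) × ℕ)
  | .leaf _ points, k =>
      match points[k]? with
      | none => PMF.pure (none, none, 1)
      | some p => (accept (Q.f (G.dist Q.q (pos p)) / b)).map fun a =>
          (some p, if a then some p else none, 1)
  | .node _ _ ch, k =>
      let s₀ := (ch 0).size
      let s₁ := s₀ + (ch 1).size
      let s₂ := s₁ + (ch 2).size
      let descend (i : Fin 4) (offset inspected : ℕ) :=
        (maybeGetKthElement G Q pos b (ch i) (k - offset)).map
          fun r => (r.1, r.2.1, 1 + inspected + r.2.2)
      if k < s₀ then descend 0 0 1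
      else if k < s₁ then descend 1 s₀ 2
      else if k < s₂ then descend 2 s₁ 3
      else descend 3 s₂ 4

/-- The candidate loop `for (i = start; i < s; i++)` on a leaf or virtual leaf `T` with `s` points
and probability bound `b`. If `b = 0`, the jump is infinite and the loop ends at once.
Every iteration costs one step, in addition to the steps of `maybeGetKthElement`. -/
def candidateLoop (G : Geometry) (Q : Query) {n : ℕ} (pos : Fin n → PolarPoint) (b : ℝ)
    (T : QuadTree n) (i : ℕ) : PMF (Outcome n) :=
  if T.size ≤ i then PMF.pure ⟨[], [], 0, 0⟩
  else if b = 0 then PMF.pure ⟨[], [], 0, 1⟩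
  else (jump b).bind fun δ =>
    if h : T.size ≤ i + δ then PMF.pure ⟨[], [], 0, 1⟩
    else (maybeGetKthElement G Q pos b T (i + δ)).bind fun r =>
      (candidateLoop G Q pos b T (i + δ + 1)).map fun o =>
        ⟨r.2.1.toList ++ o.neighbors, r.1.toList ++ o.candidates, o.cells, 1 + r.2.2 + o.time⟩
termination_by T.size - i
decreasing_by omega

/-- Merge the result of a recursive call into the current state. This costs one step, and one
more for each neighbor that is added. -/
def Outcome.merge {n : ℕ} (o o' : Outcome n) : Outcome n :=
  ⟨o.neighbors ++ o'.neighbors, o.candidates ++ o'.candidates, o.cells + o'.cells,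
    o.time + o'.time + 1 + o'.neighbors.length⟩

/-- A call of the query with subtree aggregation. With `b = f(dist(q, c))`, an inner node `c` is
descended if `|c| * b ≥ 1` and treated as a virtual leaf otherwise. Each call examines one cell
and costs one step, in addition to the steps of its parts. Points of distinct
(virtual) leaves are distinct and the loop visits each index at most once, so the lists of neighbors
and candidates have no repetitions. -/
def runQuery (G : Geometry) (Q : Query) {n : ℕ} (pos : Fin n → PolarPoint) :
    QuadTree n → PMF (Outcome n)
  | .leaf c points =>
      (candidateLoop G Q pos (Q.f (cellDist G Q.q c)) (.leaf c points) 0).map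
        fun o => ⟨o.neighbors, o.candidates, o.cells + 1, o.time + 1⟩
  | .node c s ch =>
      if 1 ≤ (s : ℝ) * Q.f (cellDist G Q.q c) then
        (runQuery G Q pos (ch 0)).bind fun o₀ =>
        (runQuery G Q pos (ch 1)).bind fun o₁ =>
        (runQuery G Q pos (ch 2)).bind fun o₂ =>
        (runQuery G Q pos (ch 3)).map fun o₃ =>
          ((((⟨[], [], 1, 1⟩ : Outcome n).merge o₀).merge o₁).merge o₂).merge o₃
      else
        (candidateLoop G Q pos (Q.f (cellDist G Q.q c)) (.node c s ch) 0).map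
          fun o => ⟨o.neighbors, o.candidates, o.cells + 1, o.time + 1⟩

/-- The probability, over `n` independent points with law `D.law` and over the random choices of the
query on the quadtree of these points, that the outcome of the query satisfies `E`. -/
def queryProb (G : Geometry) {R : ℝ} (D : PolarDensity R) (cap n : ℕ) (Q : Query)
    (E : Outcome n → Prop) : ℝ≥0∞ :=
  ∫⁻ pos : Fin n → PolarPoint,
    (runQuery G Q pos (quadtree D cap pos)).toOuterMeasure {o | E o}
    ∂(Measure.pi fun _ => D.law)

end PNQ

end

/-! Fix the points first. Geometric jumps amount to tossing an independent coin at every point: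
inside a leaf or virtual leaf with bound `b`, a point with neighbor probability `f` becomes a
candidate with probability `b` and a neighbor with probability `f`. Hence the joint generating
function of candidates and neighbors is bounded by a product over the points
(`Valid.expect_runQuery_le`). Markov's inequality then gives, up to probability `exp (-√n)` each, at
most `∑ 2 (b - f) + √n` rejected candidates and at least `∑ f / 2 - √n` neighbors. The number of
calls is determined by the tree, and the time is at most a multiple of calls plus depth times
candidates (`Valid.support_runQuery`). It remains to bound `∑ (b - f)` and the calls for typical
points.

The geometric input is `Geometry.sum_oscillation_le`. Along a ray the distance to `q` falls and then
rises; on a circle it is monotone in the cosine of the angle to `q`. So for every decreasing `h`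
with values in `[0, H]`, continuous or not, the oscillations of `h (dist q ·)` over the `4 ^ i`
cells of level `i` add up to only `7 * 2 ^ i * H`. Each of these cells has mass `4 ^ (-i)`, whatever
the density.

Choose `m` with `n ≤ 4 ^ m ≤ 4 n`, and on level `i < m` let `τ = 4 ^ (-(m - i))`, about the inverse
of the expected number of points in a cell. A node `c` where the query stops satisfies `|c| * b ≤
cap`. Split `b - f` at `τ`. The part below `τ` (`excess`) has mean at most `7 * 2 ^ (-i) * τ` per
point; over all levels this is `O(2 ^ (-m))`, and a Chernoff bound makes the sum over the points
`O(√n)`. The part above `τ`, times `|c|`, is at most `cap` times the oscillation of `log (max f τ)`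
(`local_cost_le`), whose range is only `O(m - i)`; and `∑ 2 ^ i * (m - i) = O(2 ^ m) = O(√n)`. The
truncation and the logarithm are what keep a logarithmic factor out of the bound on candidates.
Everything below level `m` is charged to level `m` with `τ = 1`.

For the calls, a node is descended only if `|c| * b ≥ 1`, so either `b ≥ τ` or `|c| * min b τ ≥ 1`.
Oscillation of an indicator and Markov bound the number of cells of the first kind, excess plus `∑
f` that of the second; each of the `O(log n)` levels contributes `O(√n + ∑ f)`. Finally, no two
points share a cell of level `4 m` except with probability `1 / n ^ 2`, which bounds the depth. -/

noncomputable section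
namespace PNQ

/-! ### Monotonicity of the distance in polar coordinates -/

/-- The squared distance, respectively the hyperbolic cosine of the distance, of two points with
radii `s` and `r`, as a function of the cosine `x` of the angle between them. -/
def Geometry.kernel : Geometry → ℝ → ℝ → ℝ → ℝ
  | .euclidean, s, x, r => s ^ 2 + r ^ 2 - 2 * s * r * x
  | .hyperbolic, s, x, r => Real.cosh s * Real.cosh r - Real.sinh s * Real.sinh r * x

/-- The kernel is at least `cosh (s - r)`. This keeps the argument of `arcosh` in the range where it
is monotone and continuous. -/
theorem Geometry.one_le_kernel {s x r : ℝ} (hs : 0 ≤ s) (hr : 0 ≤ r) (hx : x ≤ 1) :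
    1 ≤ Geometry.kernel .hyperbolic s x r := by
  have h1 : 0 ≤ Real.sinh s * Real.sinh r :=
    mul_nonneg (Real.sinh_nonneg_iff.2 hs) (Real.sinh_nonneg_iff.2 hr)
  have h2 := Real.one_le_cosh (s - r)
  rw [Real.cosh_sub] at h2
  simp only [Geometry.kernel]
  nlinarith

theorem Geometry.kernel_antitone (G : Geometry) {s r x y : ℝ} (hs : 0 ≤ s) (hr : 0 ≤ r)
    (hxy : x ≤ y) : G.kernel s y r ≤ G.kernel s x r := by
  cases G
  · have := mul_le_mul_of_nonneg_left hxy (by positivity : 0 ≤ 2 * s * r)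
    simp only [Geometry.kernel]; linarith
  · have := mul_le_mul_of_nonneg_left hxy
      (mul_nonneg (Real.sinh_nonneg_iff.2 hs) (Real.sinh_nonneg_iff.2 hr))
    simp only [Geometry.kernel]; linarith

/-- The Euclidean kernel is `r ^ 2` plus an affine function; the hyperbolic one combines `exp r` and
`exp (-r)` with coefficients that are nonnegative because `|x| ≤ 1` and `sinh s ≤ cosh s`. -/
theorem Geometry.kernel_convex (G : Geometry) {s x : ℝ} (hs : 0 ≤ s) (hx : |x| ≤ 1) :
    ConvexOn ℝ Set.univ (G.kernel s x) := by
  cases G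
  · have h1 : ConvexOn ℝ Set.univ fun r : ℝ => r ^ 2 := even_two.convexOn_pow
    have h2 : ConvexOn ℝ Set.univ fun r : ℝ => s ^ 2 - (2 * s * x) * r := by
      refine ⟨convex_univ, fun a _ b _ u v _ _ huv => le_of_eq ?_⟩
      simp only [smul_eq_mul]
      linear_combination (-(s ^ 2)) * huv
    refine (h1.add h2).congr fun r _ => ?_
    simp [Geometry.kernel]; ring
  · obtain ⟨hx1, hx2⟩ := abs_le.1 hx
    have hs' : Real.sinh s ≤ Real.cosh s := Real.sinh_lt_cosh s |>.le
    have hs0 : 0 ≤ Real.sinh s := Real.sinh_nonneg_iff.2 hs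
    have e1 : ConvexOn ℝ Set.univ fun x : ℝ => Real.exp (-x) := by
      have := convexOn_exp.comp_linearMap (-LinearMap.id : ℝ →ₗ[ℝ] ℝ)
      simpa [Function.comp_def] using this
    have h1 := convexOn_exp.smul (c := (Real.cosh s - Real.sinh s * x) / 2) (by nlinarith)
    have h2 := e1.smul (c := (Real.cosh s + Real.sinh s * x) / 2) (by nlinarith)
    refine (h1.add h2).congr fun r _ => ?_
    simp [Geometry.kernel, Real.cosh_eq r, Real.sinh_eq r]; ring

theorem Geometry.continuous_kernel (G : Geometry) (s : ℝ) :
    Continuous fun p : ℝ × ℝ => G.kernel s p.1 p.2 := by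
  cases G
  · simp only [Geometry.kernel]; fun_prop
  · simp only [Geometry.kernel]; fun_prop

theorem Geometry.dist_nonneg (G : Geometry) {q p : PolarPoint} (hq : 0 ≤ q.2) (hp : 0 ≤ p.2) :
    0 ≤ G.dist q p := by
  cases G
  · exact Real.sqrt_nonneg _
  · exact Real.arcosh_nonneg (Geometry.one_le_kernel hq hp (Real.cos_le_one _))

theorem Geometry.dist_le_dist (G : Geometry) {q p p' : PolarPoint} (hq : 0 ≤ q.2) (hp : 0 ≤ p.2)
    (hp' : 0 ≤ p'.2)
    (h : G.kernel q.2 (Real.cos (q.1 - p.1)) p.2 ≤ G.kernel q.2 (Real.cos (q.1 - p'.1)) p'.2) :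
    G.dist q p ≤ G.dist q p' := by
  cases G
  · exact Real.sqrt_le_sqrt h
  · have h1 := Geometry.one_le_kernel hq hp (Real.cos_le_one (q.1 - p.1))
    have h2 := Geometry.one_le_kernel hq hp' (Real.cos_le_one (q.1 - p'.1))
    exact (Real.arcosh_le_arcosh (lt_of_lt_of_le one_pos h1) (lt_of_lt_of_le one_pos h2)).2 h

theorem Geometry.continuousOn_dist (G : Geometry) {q : PolarPoint} (hq : 0 ≤ q.2) :
    ContinuousOn (G.dist q) {p | 0 ≤ p.2} := by
  have hc : Continuous fun p : PolarPoint => G.kernel q.2 (Real.cos (q.1 - p.1)) p.2 :=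
    (G.continuous_kernel q.2).comp
      (f := fun p : PolarPoint => (Real.cos (q.1 - p.1), p.2)) (by fun_prop)
  cases G
  · exact (Real.continuous_sqrt.comp hc).continuousOn
  · exact Real.continuousOn_arcosh.comp hc.continuousOn
      fun p hp => Geometry.one_le_kernel hq hp (Real.cos_le_one _)

/-- Along every ray the distance first decreases and then increases. -/
theorem Geometry.dist_unimodal (G : Geometry) {q : PolarPoint} (hq : 0 ≤ q.2) (φ : ℝ) {R : ℝ}
    (hR : 0 ≤ R) : ∃ u ∈ Set.Icc 0 R, AntitoneOn (fun r => G.dist q (φ, r)) (Set.Icc 0 u) ∧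
      MonotoneOn (fun r => G.dist q (φ, r)) (Set.Icc u R) := by
  have hc : Continuous (G.kernel q.2 (Real.cos (q.1 - φ))) :=
    (G.continuous_kernel q.2).comp (f := fun r : ℝ => (Real.cos (q.1 - φ), r)) (by fun_prop)
  have hconv := G.kernel_convex hq (Real.abs_cos_le_one (q.1 - φ))
  -- `u` minimizes the kernel. For a point between `u` and another one, convexity bounds the kernel
  -- by its maximum at the two ends, and the end `u` is the smaller of them.
  obtain ⟨u, hu, hmin⟩ := isCompact_Icc.exists_isMinOn (Set.nonempty_Icc.2 hR) hc.continuousOn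
  refine ⟨u, hu, fun a ha b hb hab => ?_, fun a ha b hb hab => ?_⟩
  · refine G.dist_le_dist hq hb.1 ha.1 ?_
    have h1 := hconv.le_max_of_mem_Icc (Set.mem_univ a) (Set.mem_univ u) (z := b) ⟨hab, hb.2⟩
    have h2 := hmin ⟨ha.1, ha.2.trans hu.2⟩
    exact h1.trans (max_le le_rfl h2)
  · refine G.dist_le_dist hq (hu.1.trans ha.1) (hu.1.trans hb.1) ?_
    have h1 := hconv.le_max_of_mem_Icc (Set.mem_univ u) (Set.mem_univ b) (z := a) ⟨ha.1, hab⟩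
    have h2 := hmin ⟨hu.1.trans hb.1, hb.2⟩
    exact h1.trans (max_le h2 le_rfl)

/-! ### Oscillation sums -/

/-- The oscillation of `ψ` on `[a, b]` is dominated by the increments of a monotone function with
total increment at most `M`. -/
def VariationBound (ψ : ℝ → ℝ) (a b M : ℝ) : Prop :=
  ∃ V : ℝ → ℝ, (∀ x ∈ Set.Icc a b, ∀ y ∈ Set.Icc a b, x ≤ y → |ψ y - ψ x| ≤ V y - V x) ∧
    V b - V a ≤ M

theorem VariationBound.of_monotoneOn {ψ : ℝ → ℝ} {a b M : ℝ} (h : MonotoneOn ψ (Set.Icc a b))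
    (hM : ψ b - ψ a ≤ M) : VariationBound ψ a b M :=
  ⟨ψ, fun x hx y hy hxy => by rw [abs_of_nonneg (sub_nonneg.2 (h hx hy hxy))], hM⟩

theorem VariationBound.of_antitoneOn {ψ : ℝ → ℝ} {a b M : ℝ} (h : AntitoneOn ψ (Set.Icc a b))
    (hM : ψ a - ψ b ≤ M) : VariationBound ψ a b M :=
  ⟨fun x => -ψ x, fun x hx y hy hxy => by
    rw [abs_of_nonpos (sub_nonpos.2 (h hx hy hxy))]; linarith, by linarith⟩

theorem VariationBound.glue {ψ : ℝ → ℝ} {a b c M M' : ℝ} (hab : a ≤ b) (hbc : b ≤ c)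
    (h : VariationBound ψ a b M) (h' : VariationBound ψ b c M') :
    VariationBound ψ a c (M + M') := by
  obtain ⟨V, hV, hM⟩ := h
  obtain ⟨W, hW, hM'⟩ := h'
  -- `W` is shifted to agree with `V` at `b`, so increments across `b` add up.
  refine ⟨fun x => if x ≤ b then V x else V b + (W x - W b), fun x hx y hy hxy => ?_, ?_⟩
  · by_cases hyb : y ≤ b
    · simp only [hyb, hxy.trans hyb, if_true]
      exact hV x ⟨hx.1, hxy.trans hyb⟩ y ⟨hy.1, hyb⟩ hxy
    · push Not at hyb
      by_cases hxb : x ≤ b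
      · simp only [hxb, hyb.not_ge, if_true, if_false]
        have h1 := hV x ⟨hx.1, hxb⟩ b ⟨hab, le_rfl⟩ hxb
        have h2 := hW b ⟨le_rfl, hbc⟩ y ⟨hyb.le, hy.2⟩ hyb.le
        have h3 := abs_sub_le (ψ y) (ψ b) (ψ x)
        linarith
      · push Not at hxb
        simp only [hxb.not_ge, hyb.not_ge, if_false]
        have h2 := hW x ⟨hxb.le, hx.2⟩ y ⟨hyb.le, hy.2⟩ hxy
        linarith
  · by_cases hcb : c ≤ b
    · obtain rfl : b = c := le_antisymm hbc hcb
      have h2 := hW b ⟨le_rfl, le_rfl⟩ b ⟨le_rfl, le_rfl⟩ le_rfl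
      simp only [le_rfl, hab, if_true]
      linarith
    · simp only [hcb, hab, if_true, if_false]
      linarith

/-- Each difference is at most the increment of the dominating function over its interval, and these
increments telescope. -/
theorem VariationBound.sum_le {ψ : ℝ → ℝ} {M : ℝ} {t : ℕ → ℝ} (ht : Monotone t) {N : ℕ}
    (h : VariationBound ψ (t 0) (t N) M) {y z : ℕ → ℝ}
    (hy : ∀ k, y k ∈ Set.Icc (t k) (t (k + 1))) (hz : ∀ k, z k ∈ Set.Icc (t k) (t (k + 1))) :
    ∑ k ∈ Finset.range N, (ψ (y k) - ψ (z k)) ≤ M := by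
  obtain ⟨V, hV, hM⟩ := h
  refine le_trans ?_ hM
  rw [← Finset.sum_range_sub fun k => V (t k)]
  refine Finset.sum_le_sum fun k hk => ?_
  have hk' : k + 1 ≤ N := Finset.mem_range.1 hk
  have hsub : ∀ x ∈ Set.Icc (t k) (t (k + 1)), x ∈ Set.Icc (t 0) (t N) := fun x hx =>
    ⟨(ht (Nat.zero_le k)).trans hx.1, hx.2.trans (ht hk')⟩
  have hl := hsub (t k) ⟨le_rfl, ht (Nat.le_succ k)⟩
  have hr := hsub (t (k + 1)) ⟨ht (Nat.le_succ k), le_rfl⟩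
  have mono : ∀ a ∈ Set.Icc (t 0) (t N), ∀ b ∈ Set.Icc (t 0) (t N), a ≤ b → V a ≤ V b :=
    fun a ha b hb hab => by linarith [hV a ha b hb hab, abs_nonneg (ψ b - ψ a)]
  have hy' := hsub _ (hy k)
  have hz' := hsub _ (hz k)
  have y1 := mono _ hl _ hy' (hy k).1
  have y2 := mono _ hy' _ hr (hy k).2
  have z1 := mono _ hl _ hz' (hz k).1
  have z2 := mono _ hz' _ hr (hz k).2
  rcases le_total (y k) (z k) with hle | hle
  · have := hV _ hy' _ hz' hle
    linarith [neg_abs_le (ψ (z k) - ψ (y k))]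
  · have := hV _ hz' _ hy' hle
    linarith [le_abs_self (ψ (y k) - ψ (z k))]

/-- A bounded increasing function of `cos (q - ·)` has three monotone pieces on `[0, 2π]`. -/
theorem variationBound_of_cos {ψ : ℝ → ℝ} {q M : ℝ}
    (h : ∀ x y, Real.cos (q - x) ≤ Real.cos (q - y) → ψ x ≤ ψ y)
    (h0 : ∀ x, 0 ≤ ψ x) (hM : ∀ x, ψ x ≤ M) : VariationBound ψ 0 (2 * Real.pi) (3 * M) := by
  have hpi := Real.pi_pos
  wlog hq : 0 ≤ q ∧ q < 2 * Real.pi generalizing q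
  · have hp : (0 : ℝ) < 2 * Real.pi := by positivity
    have hf := Int.fract_nonneg (q / (2 * Real.pi))
    have hf' := Int.fract_lt_one (q / (2 * Real.pi))
    refine this (q := q - ⌊q / (2 * Real.pi)⌋ * (2 * Real.pi)) (fun x y hxy => h x y ?_) ?_
    · have e : ∀ x, Real.cos (q - ⌊q / (2 * Real.pi)⌋ * (2 * Real.pi) - x) = Real.cos (q - x) := by
        intro x
        rw [← Real.cos_sub_int_mul_two_pi (q - x) ⌊q / (2 * Real.pi)⌋]
        congr 1; ring
      rwa [e, e] at hxy
    · have e : q - ⌊q / (2 * Real.pi)⌋ * (2 * Real.pi)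
          = Int.fract (q / (2 * Real.pi)) * (2 * Real.pi) := by
        rw [Int.fract]; field_simp
      rw [e]
      exact ⟨by positivity, by nlinarith⟩
  have cosle : ∀ {a b : ℝ}, 0 ≤ a → a ≤ b → b ≤ Real.pi → Real.cos b ≤ Real.cos a :=
    fun ha hab hb => Real.cos_le_cos_of_nonneg_of_le_pi ha hb hab
  have inc : ∀ {a b : ℝ}, q - Real.pi ≤ a → b ≤ q → MonotoneOn ψ (Set.Icc a b) := by
    intro a b ha hb x hx y hy hxy
    exact h _ _ (cosle (by linarith [hy.2]) (by linarith) (by linarith [hx.1]))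
  have dec : ∀ {a b : ℝ}, q ≤ a → b ≤ q + Real.pi → AntitoneOn ψ (Set.Icc a b) := by
    intro a b ha hb x hx y hy hxy
    refine h _ _ ?_
    rw [← Real.cos_neg (q - y), ← Real.cos_neg (q - x)]
    exact cosle (by linarith [hx.1]) (by linarith) (by linarith [hy.2])
  -- The monotone pieces end at `q` and at the antipode of `q`, which is `q + π` or `q - π`
  -- depending on the half in which `q` lies; each piece contributes at most `M`.
  have hb : ∀ x y, ψ x - ψ y ≤ M := fun x y => by linarith [h0 y, hM x]
  rcases le_or_gt q Real.pi with hq' | hq'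
  · have inc' : MonotoneOn ψ (Set.Icc (q + Real.pi) (2 * Real.pi)) := by
      intro x hx y hy hxy
      refine h _ _ ?_
      rw [← Real.cos_add_two_pi (q - y), ← Real.cos_add_two_pi (q - x)]
      exact cosle (by linarith [hy.2]) (by linarith) (by linarith [hx.1])
    have := (VariationBound.of_monotoneOn (inc (a := 0) (by linarith) le_rfl) (hb _ _)).glue hq.1
      (by linarith) ((VariationBound.of_antitoneOn (dec le_rfl le_rfl) (hb _ _)).glue (by linarith)
        (by linarith) (VariationBound.of_monotoneOn inc' (hb _ _)))
    convert this using 1; ring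
  · have dec' : AntitoneOn ψ (Set.Icc 0 (q - Real.pi)) := by
      intro x hx y hy hxy
      refine h _ _ ?_
      rw [← Real.cos_neg (q - y), ← Real.cos_neg (q - x), ← Real.cos_add_two_pi (-(q - y)),
        ← Real.cos_add_two_pi (-(q - x))]
      exact cosle (by linarith [hx.1]) (by linarith) (by linarith [hy.2])
    have := (VariationBound.of_antitoneOn dec' (hb _ _)).glue (by linarith) (by linarith)
      ((VariationBound.of_monotoneOn (inc le_rfl le_rfl) (hb _ _)).glue (by linarith) hq.2.le
        (VariationBound.of_antitoneOn (dec le_rfl (by linarith)) (hb _ _)))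
    convert this using 1; ring

/-- In an `N × N` grid in polar coordinates, the oscillations of a bounded decreasing function of
the distance to `q` on the grid cells add up to `O(N)`. -/
theorem Geometry.sum_oscillation_le (G : Geometry) {q : PolarPoint} (hq : 0 ≤ q.2) {R H : ℝ}
    (hR : 0 ≤ R) {h : ℝ → ℝ} (hanti : AntitoneOn h (Set.Ici 0)) (h0 : ∀ d, 0 ≤ d → 0 ≤ h d)
    (hH : ∀ d, 0 ≤ d → h d ≤ H) {N : ℕ} {θ t : ℕ → ℝ} (hθ : Monotone θ) (ht : Monotone t)
    (θ0 : θ 0 = 0) (θN : θ N = 2 * Real.pi) (t0 : t 0 = 0) (tN : t N = R)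
    {y z : ℕ → ℕ → PolarPoint}
    (hy : ∀ a b, y a b ∈ Set.Icc (θ a) (θ (a + 1)) ×ˢ Set.Icc (t b) (t (b + 1)))
    (hz : ∀ a b, z a b ∈ Set.Icc (θ a) (θ (a + 1)) ×ˢ Set.Icc (t b) (t (b + 1))) :
    ∑ a ∈ Finset.range N, ∑ b ∈ Finset.range N, (h (G.dist q (y a b)) - h (G.dist q (z a b)))
      ≤ 7 * (N * H) := by
  set F : ℝ → ℝ → ℝ := fun φ r => h (G.dist q (φ, r)) with hF
  have tnn : ∀ b, 0 ≤ t b := fun b => t0 ▸ ht (Nat.zero_le b)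
  have dnn : ∀ φ r, 0 ≤ r → 0 ≤ G.dist q (φ, r) := fun φ r hr => G.dist_nonneg hq hr
  have F0 : ∀ φ r, 0 ≤ r → 0 ≤ F φ r := fun φ r hr => h0 _ (dnn φ r hr)
  have FH : ∀ φ r, 0 ≤ r → F φ r ≤ H := fun φ r hr => hH _ (dnn φ r hr)
  have Fcos : ∀ {φ φ' r}, 0 ≤ r → Real.cos (q.1 - φ) ≤ Real.cos (q.1 - φ') → F φ r ≤ F φ' r := by
    intro φ φ' r hr hc
    exact hanti (dnn φ' r hr) (dnn φ r hr)
      (G.dist_le_dist hq hr hr (G.kernel_antitone hq hr hc))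
  -- On a ray the function rises by at most `H` and then falls by at most `H`.
  have row : ∀ φ, VariationBound (F φ) (t 0) (t N) (H + H) := by
    intro φ
    rw [t0, tN]
    obtain ⟨u, hu, h1, h2⟩ := G.dist_unimodal hq φ hR
    have hb : ∀ r r', 0 ≤ r → 0 ≤ r' → F φ r - F φ r' ≤ H := fun r r' hr hr' => by
      linarith [F0 φ r' hr', FH φ r hr]
    have m1 : MonotoneOn (F φ) (Set.Icc 0 u) := fun a ha b hb hab =>
      hanti (dnn φ b hb.1) (dnn φ a ha.1) (h1 ha hb hab)
    have m2 : AntitoneOn (F φ) (Set.Icc u R) := fun a ha b hb hab =>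
      hanti (dnn φ a (hu.1.trans ha.1)) (dnn φ b (hu.1.trans hb.1)) (h2 ha hb hab)
    exact (VariationBound.of_monotoneOn m1 (hb _ _ hu.1 le_rfl)).glue hu.1 hu.2
      (VariationBound.of_antitoneOn m2 (hb _ _ hu.1 hR))
  -- Summing over the radial grid lines gives one function of the angle, monotone in the cosine and
  -- bounded by `N * H`. Its three monotone pieces handle the angular oscillation of all rows at
  -- once.
  set U : ℝ → ℝ := fun φ => ∑ b ∈ Finset.range N, F φ (t b) with hU
  have hUb : VariationBound U (θ 0) (θ N) (3 * (N * H)) := by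
    rw [θ0, θN]
    refine variationBound_of_cos (q := q.1)
      (fun x y hxy => Finset.sum_le_sum fun b _ => Fcos (tnn b) hxy)
      (fun x => Finset.sum_nonneg fun b _ => F0 _ _ (tnn b)) fun x => ?_
    simpa using Finset.sum_le_card_nsmul (Finset.range N) _ H fun b _ => FH x _ (tnn b)
  have hcos : Continuous fun φ => Real.cos (q.1 - φ) := by fun_prop
  have hne : ∀ a, (Set.Icc (θ a) (θ (a + 1))).Nonempty :=
    fun a => Set.nonempty_Icc.2 (hθ (Nat.le_succ a))
  -- `α a` and `β a` are the angles of column `a` closest to and farthest from that of `q`. Moving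
  -- `y` to `α a` and `z` to `β a` only increases the difference.
  choose α hα hαmax using fun a =>
    isCompact_Icc.exists_isMaxOn (hne a) hcos.continuousOn
  choose β hβ hβmin using fun a =>
    isCompact_Icc.exists_isMinOn (hne a) hcos.continuousOn
  have hcol := hUb.sum_le hθ hα hβ
  have htt : ∀ b, t b ∈ Set.Icc (t b) (t (b + 1)) := fun b => ⟨le_rfl, ht (Nat.le_succ b)⟩
  -- Sliding the radii of `y` and of `z` to the grid lines costs `2 * H` each per column. In total
  -- `3 * N * H + N * 4 * H = 7 * N * H`.
  have hterm : ∀ a ∈ Finset.range N, ∑ b ∈ Finset.range N,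
      (h (G.dist q (y a b)) - h (G.dist q (z a b))) ≤ (U (α a) - U (β a)) + 4 * H := by
    intro a _
    have s1 := (row (α a)).sum_le ht (fun b => (hy a b).2) htt
    have s2 := (row (β a)).sum_le ht htt (fun b => (hz a b).2)
    have s3 : ∑ b ∈ Finset.range N, (h (G.dist q (y a b)) - h (G.dist q (z a b)))
        ≤ ∑ b ∈ Finset.range N, (F (α a) (y a b).2 - F (β a) (z a b).2) := by
      refine Finset.sum_le_sum fun b _ => sub_le_sub ?_ ?_
      · exact Fcos (φ := (y a b).1) ((tnn b).trans (hy a b).2.1) (hαmax a (hy a b).1)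
      · exact Fcos (φ' := (z a b).1) ((tnn b).trans (hz a b).2.1) (hβmin a (hz a b).1)
    simp only [Finset.sum_sub_distrib, hU] at s1 s2 s3 ⊢
    linarith
  refine (Finset.sum_le_sum hterm).trans ?_
  rw [Finset.sum_add_distrib]
  simp only [Finset.sum_const, Finset.card_range, nsmul_eq_mul]
  nlinarith

end PNQ
end

/-! ### The dyadic grid of cells of equal mass, and oscillation over a level. -/

noncomputable section
namespace PNQ

/-! ### The radial distribution function -/

variable {R : ℝ} (D : PolarDensity R)

/-- By Fubini almost every angular section is integrable, hence some section is, and rotation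
invariance identifies it with the section at angle `0`. -/
theorem PolarDensity.integrableOn_radial : IntegrableOn (D.j 0) (Set.Ico 0 R) := by
  have h := D.integrableOn
  rw [IntegrableOn, Measure.volume_eq_prod, ← Measure.prod_restrict] at h
  have h1 := h.prod_right_ae
  have hne : (volume.restrict (Set.Ico (0 : ℝ) (2 * Real.pi))) ≠ 0 := by
    rw [Ne, Measure.restrict_eq_zero, Real.volume_Ico]
    simp [Real.pi_pos]
  have : (ae (volume.restrict (Set.Ico (0 : ℝ) (2 * Real.pi)))).NeBot := ae_neBot.2 hne
  obtain ⟨φ, hφ⟩ := h1.exists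
  refine hφ.congr (Filter.Eventually.of_forall fun r => ?_)
  exact D.rotation_invariant _ _ _

theorem PolarDensity.intervalIntegrable_radial {a b : ℝ} (ha : 0 ≤ a) (hab : a ≤ b) (hb : b ≤ R) :
    IntervalIntegrable (D.j 0) volume a b := by
  rw [intervalIntegrable_iff_integrableOn_Ico_of_le hab]
  exact D.integrableOn_radial.mono_set (Set.Ico_subset_Ico ha hb)

theorem PolarDensity.J_eq (r : ℝ) : D.J r = 2 * Real.pi * ∫ s in (0 : ℝ)..r, D.j 0 s := by
  rw [PolarDensity.J, ← intervalIntegral.integral_const_mul]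
  refine intervalIntegral.integral_congr fun s _ => ?_
  have : ∀ φ, D.j φ s = D.j 0 s := fun φ => D.rotation_invariant _ _ _
  simp [this]

theorem PolarDensity.J_zero : D.J 0 = 0 := by simp [PolarDensity.J]

theorem PolarDensity.J_radius : D.J R = 1 := D.total_mass

theorem PolarDensity.J_sub {a b : ℝ} (ha : 0 ≤ a) (hab : a ≤ b) (hb : b ≤ R) :
    D.J b - D.J a = 2 * Real.pi * ∫ s in a..b, D.j 0 s := by
  rw [D.J_eq, D.J_eq, ← mul_sub, intervalIntegral.integral_interval_sub_left]
  · exact D.intervalIntegrable_radial le_rfl (ha.trans hab) hb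
  · exact D.intervalIntegrable_radial le_rfl ha (hab.trans hb)

theorem PolarDensity.J_strictMonoOn : StrictMonoOn D.J (Set.Icc 0 R) := by
  intro a ha b hb hab
  have h := D.J_sub ha.1 hab.le hb.2
  have hpos : 0 < ∫ s in a..b, D.j 0 s := by
    refine intervalIntegral.intervalIntegral_pos_of_pos_on
      (D.intervalIntegrable_radial ha.1 hab.le hb.2) (fun s hs => ?_) hab
    exact (D.pos_iff 0 s (ha.1.trans_lt hs.1)).2 (hs.2.trans_le hb.2)
  have := mul_pos Real.two_pi_pos hpos
  linarith

theorem PolarDensity.J_continuousOn : ContinuousOn D.J (Set.Icc 0 R) := by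
  have h : IntegrableOn (D.j 0) (Set.uIcc 0 R) := by
    rw [Set.uIcc_of_le D.radius_pos.le]
    exact (integrableOn_Icc_iff_integrableOn_Ico (by simp)).2 D.integrableOn_radial
  have := intervalIntegral.continuousOn_primitive_interval h
  rw [Set.uIcc_of_le D.radius_pos.le] at this
  exact (this.const_smul (2 * Real.pi)).congr fun r _ => D.J_eq r

/-- The radius within which the mass is `min x 1`. -/
def PolarDensity.quantile (x : ℝ) : ℝ := Function.invFunOn D.J (Set.Icc 0 R) (min x 1)

theorem PolarDensity.exists_quantile {x : ℝ} (hx : 0 ≤ x) :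
    ∃ r ∈ Set.Icc 0 R, D.J r = min x 1 := by
  have h := intermediate_value_Icc D.radius_pos.le D.J_continuousOn
  rw [D.J_zero, D.J_radius] at h
  exact h ⟨le_min hx zero_le_one, min_le_right _ _⟩

theorem PolarDensity.quantile_mem {x : ℝ} (hx : 0 ≤ x) : D.quantile x ∈ Set.Icc 0 R :=
  Function.invFunOn_mem (D.exists_quantile hx)

theorem PolarDensity.J_quantile {x : ℝ} (hx : 0 ≤ x) : D.J (D.quantile x) = min x 1 :=
  Function.invFunOn_eq (D.exists_quantile hx)

theorem PolarDensity.quantile_eq {x r : ℝ} (hx : 0 ≤ x) (hr : r ∈ Set.Icc 0 R)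
    (h : D.J r = min x 1) : D.quantile x = r :=
  D.J_strictMonoOn.injOn (D.quantile_mem hx) hr ((D.J_quantile hx).trans h.symm)

theorem PolarDensity.quantile_mono {x y : ℝ} (hx : 0 ≤ x) (hxy : x ≤ y) :
    D.quantile x ≤ D.quantile y := by
  rw [← D.J_strictMonoOn.le_iff_le (D.quantile_mem hx) (D.quantile_mem (hx.trans hxy)),
    D.J_quantile hx, D.J_quantile (hx.trans hxy)]
  exact min_le_min_right _ hxy

theorem PolarDensity.quantile_strictMono {x y : ℝ} (hx : 0 ≤ x) (hxy : x < y) (hy : y ≤ 1) :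
    D.quantile x < D.quantile y := by
  rw [← D.J_strictMonoOn.lt_iff_lt (D.quantile_mem hx) (D.quantile_mem (hx.trans hxy.le)),
    D.J_quantile hx, D.J_quantile (hx.trans hxy.le), min_eq_left hy, min_eq_left (hxy.le.trans hy)]
  exact hxy

/-! ### The law of a point -/

theorem PolarDensity.law_rectangle {φ₁ φ₂ r₁ r₂ : ℝ} (h1 : 0 ≤ φ₁) (h12 : φ₁ ≤ φ₂)
    (h2 : φ₂ ≤ 2 * Real.pi) (k1 : 0 ≤ r₁) (k12 : r₁ ≤ r₂) (k2 : r₂ ≤ R) :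
    D.law (Set.Ico φ₁ φ₂ ×ˢ Set.Ico r₁ r₂)
      = ENNReal.ofReal ((φ₂ - φ₁) / (2 * Real.pi) * (D.J r₂ - D.J r₁)) := by
  have hms : MeasurableSet (Set.Ico φ₁ φ₂ ×ˢ Set.Ico r₁ r₂) :=
    measurableSet_Ico.prod measurableSet_Ico
  have hsub : Set.Ico φ₁ φ₂ ×ˢ Set.Ico r₁ r₂ ⊆ Set.Ico 0 (2 * Real.pi) ×ˢ Set.Ico 0 R :=
    Set.prod_mono (Set.Ico_subset_Ico h1 h2) (Set.Ico_subset_Ico k1 k2)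
  have hj : IntegrableOn (D.j 0) (Set.Ico r₁ r₂) :=
    D.integrableOn_radial.mono_set (Set.Ico_subset_Ico k1 k2)
  have hjm : AEMeasurable (fun r => ENNReal.ofReal (D.j 0 r)) (volume.restrict (Set.Ico r₁ r₂)) :=
    hj.aestronglyMeasurable.aemeasurable.ennreal_ofReal
  have hnn : 0 ≤ᵐ[volume.restrict (Set.Ico r₁ r₂)] D.j 0 := by
    rw [← restrict_Ioo_eq_restrict_Ico]
    refine (ae_restrict_iff' measurableSet_Ioo).2 (Filter.Eventually.of_forall fun r hr => ?_)
    exact ((D.pos_iff 0 r (k1.trans_lt hr.1)).2 (hr.2.trans_le k2)).le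
  rw [PolarDensity.law, withDensity_apply _ hms, Measure.restrict_restrict hms,
    Set.inter_eq_left.2 hsub, Measure.volume_eq_prod, ← Measure.prod_restrict]
  have e : ∀ p : PolarPoint, ENNReal.ofReal (D.j p.1 p.2)
      = (fun _ => (1 : ℝ≥0∞)) p.1 * (fun r => ENNReal.ofReal (D.j 0 r)) p.2 := fun p => by
    simp [D.rotation_invariant p.1 0]
  simp_rw [e]
  rw [lintegral_prod_mul aemeasurable_const hjm, lintegral_one, Measure.restrict_apply_univ,
    Real.volume_Ico, ← ofReal_integral_eq_lintegral_ofReal hj hnn,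
    ← ENNReal.ofReal_mul (sub_nonneg.2 h12), D.J_sub k1 k12 k2,
    intervalIntegral.integral_of_le k12, integral_Ico_eq_integral_Ioc]
  congr 1
  have := Real.pi_pos
  field_simp

theorem PolarDensity.law_root : D.law (rootCell R).region = 1 := by
  have := D.law_rectangle le_rfl Real.two_pi_pos.le le_rfl le_rfl D.radius_pos.le le_rfl
  rw [Cell.region, rootCell, this, D.J_radius, D.J_zero]
  have := Real.pi_pos
  rw [sub_zero, sub_zero, div_self (by positivity), one_mul, ENNReal.ofReal_one]

theorem measurableSet_region (c : Cell) : MeasurableSet c.region :=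
  measurableSet_Ico.prod measurableSet_Ico

theorem PolarDensity.law_compl_root : D.law (rootCell R).regionᶜ = 0 := by
  rw [PolarDensity.law, withDensity_apply _ (measurableSet_region _).compl,
    Measure.restrict_restrict (measurableSet_region _).compl]
  have : (rootCell R).regionᶜ ∩ Set.Ico 0 (2 * Real.pi) ×ˢ Set.Ico 0 R = ∅ := by
    simp [Cell.region, rootCell]
  rw [this]; simp

instance : IsProbabilityMeasure D.law := ⟨by
  rw [← Set.union_compl_self (rootCell R).region,
    measure_union disjoint_compl_right (measurableSet_region _).compl, D.law_root,
    D.law_compl_root, add_zero]⟩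

/-! ### The grid of cells on one level of the quadtree -/

/-- The angle at a grid line. -/
def gridAngle (i a : ℕ) : ℝ := 2 * Real.pi * (a / 2 ^ i)

/-- The radius at a grid line. -/
def PolarDensity.gridRadius (i b : ℕ) : ℝ := D.quantile (b / 2 ^ i)

/-- The cells of level `i` of the quadtree. -/
def PolarDensity.gridCell (i a b : ℕ) : Cell :=
  ⟨gridAngle i a, gridAngle i (a + 1), D.gridRadius i b, D.gridRadius i (b + 1)⟩

theorem gridAngle_strictMono (i : ℕ) : StrictMono (gridAngle i) := by
  intro a b hab
  have h : (a : ℝ) < b := by exact_mod_cast hab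
  have := Real.pi_pos
  unfold gridAngle
  gcongr

/-- No bound on the indices is needed, because the quantile stays at `R` beyond mass `1`. Strictness
holds only up to index `2 ^ i`. -/
theorem PolarDensity.gridRadius_mono (i : ℕ) : Monotone (D.gridRadius i) := by
  intro a b hab
  have h : (a : ℝ) ≤ b := by exact_mod_cast hab
  exact D.quantile_mono (by positivity) (by gcongr)

theorem PolarDensity.gridRadius_lt (i : ℕ) {a b : ℕ} (hab : a < b) (hb : b ≤ 2 ^ i) :
    D.gridRadius i a < D.gridRadius i b := by
  have h : (a : ℝ) < b := by exact_mod_cast hab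
  have h' : (b : ℝ) ≤ 2 ^ i := by exact_mod_cast hb
  exact D.quantile_strictMono (by positivity) (by gcongr) (by rw [div_le_one (by positivity)]; exact h')

theorem gridAngle_zero (i : ℕ) : gridAngle i 0 = 0 := by simp [gridAngle]

theorem gridAngle_last (i : ℕ) : gridAngle i (2 ^ i) = 2 * Real.pi := by simp [gridAngle]

theorem PolarDensity.gridRadius_zero (i : ℕ) : D.gridRadius i 0 = 0 :=
  D.quantile_eq (by positivity) ⟨le_rfl, D.radius_pos.le⟩ (by simp [D.J_zero])

theorem PolarDensity.gridRadius_last (i : ℕ) : D.gridRadius i (2 ^ i) = R :=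
  D.quantile_eq (by positivity) ⟨D.radius_pos.le, le_rfl⟩ (by simp [D.J_radius])

theorem PolarDensity.gridRadius_mem (i b : ℕ) : D.gridRadius i b ∈ Set.Icc 0 R :=
  D.quantile_mem (by positivity)

theorem PolarDensity.J_gridRadius {i b : ℕ} (hb : b ≤ 2 ^ i) :
    D.J (D.gridRadius i b) = b / 2 ^ i := by
  have h' : (b : ℝ) ≤ 2 ^ i := by exact_mod_cast hb
  rw [PolarDensity.gridRadius, D.J_quantile (by positivity), min_eq_left]
  rw [div_le_one (by positivity)]; exact h'

theorem PolarDensity.gridCell_zero : D.gridCell 0 0 0 = rootCell R := by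
  have h1 := gridAngle_last 0
  have h2 := D.gridRadius_last 0
  rw [pow_zero] at h1 h2
  simp [PolarDensity.gridCell, rootCell, gridAngle_zero, D.gridRadius_zero, h1, h2]

theorem gridAngle_double (i a : ℕ) : gridAngle (i + 1) (2 * a) = gridAngle i a := by
  unfold gridAngle; push_cast; rw [pow_succ]; field_simp

theorem PolarDensity.gridRadius_double (i b : ℕ) :
    D.gridRadius (i + 1) (2 * b) = D.gridRadius i b := by
  unfold PolarDensity.gridRadius; congr 1; push_cast; rw [pow_succ]; field_simp

theorem PolarDensity.midφ_gridCell (i a b : ℕ) :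
    (D.gridCell i a b).midφ = gridAngle (i + 1) (2 * a + 1) := by
  simp only [Cell.midφ, PolarDensity.gridCell, gridAngle]; push_cast; rw [pow_succ]; field_simp; ring

theorem PolarDensity.midr_gridCell {i b : ℕ} (a : ℕ) (hb : b < 2 ^ i) :
    D.midr (D.gridCell i a b) = D.gridRadius (i + 1) (2 * b + 1) := by
  have h' : (b : ℝ) + 1 ≤ 2 ^ i := by exact_mod_cast hb
  simp only [PolarDensity.midr, PolarDensity.gridCell]
  rw [D.J_gridRadius hb.le, D.J_gridRadius hb, PolarDensity.gridRadius, PolarDensity.quantile,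
    min_eq_left]
  · congr 1; push_cast; rw [pow_succ]; field_simp; ring
  · rw [div_le_one (by positivity), pow_succ]; push_cast; linarith

/-- Angular midpoints and radial medians are again dyadic, so quadtree nodes are grid cells. The low
bit of `k` selects the angular half, the high bit the radial half. -/
theorem PolarDensity.child_gridCell {i b : ℕ} (a : ℕ) (hb : b < 2 ^ i) (k : Fin 4) :
    D.child (D.gridCell i a b) k
      = D.gridCell (i + 1) (2 * a + k.val % 2) (2 * b + k.val / 2) := by
  have h1 := D.midφ_gridCell i a b
  have h2 := D.midr_gridCell a hb
  simp only [PolarDensity.gridCell] at h1 h2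
  have e1 := gridAngle_double i (a + 1)
  have e2 := D.gridRadius_double i (b + 1)
  rw [mul_add, mul_one] at e1 e2
  fin_cases k <;>
    simp [PolarDensity.child, h1, h2, PolarDensity.gridCell, gridAngle_double,
      D.gridRadius_double, add_assoc, e1, e2]

/-- Angle and radial mass are halved separately, `2 ^ (-i)` for each. This is why no constant
depends on the density. -/
theorem PolarDensity.law_gridCell {i a b : ℕ} (ha : a < 2 ^ i) (hb : b < 2 ^ i) :
    D.law (D.gridCell i a b).region = ENNReal.ofReal ((1 / 4) ^ i) := by
  have h1 := gridAngle_zero i ▸ (gridAngle_strictMono i).monotone (Nat.zero_le a)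
  have h2 := gridAngle_last i ▸ (gridAngle_strictMono i).monotone (Nat.succ_le_of_lt ha)
  have h12 := (gridAngle_strictMono i).monotone (Nat.le_succ a)
  refine (D.law_rectangle h1 h12 h2 (D.gridRadius_mem i b).1 (D.gridRadius_mono i (Nat.le_succ b))
    (D.gridRadius_mem i _).2).trans ?_
  rw [D.J_gridRadius hb.le, D.J_gridRadius (Nat.succ_le_of_lt hb)]
  congr 1
  have := Real.pi_pos
  have e : (4 : ℝ) ^ i = 2 ^ i * 2 ^ i := by rw [← mul_pow]; norm_num
  rw [one_div, inv_pow, e]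
  unfold gridAngle; push_cast; field_simp; ring

theorem PolarDensity.gridCell_nonempty {i b : ℕ} (a : ℕ) (hb : b < 2 ^ i) :
    (D.gridCell i a b).region.Nonempty :=
  Set.Nonempty.prod (Set.nonempty_Ico.2 (gridAngle_strictMono i (Nat.lt_succ_self a)))
    (Set.nonempty_Ico.2 (D.gridRadius_lt i (Nat.lt_succ_self b) hb))

theorem PolarDensity.radius_nonneg_of_mem {i a b : ℕ} {p : PolarPoint}
    (hp : p ∈ (D.gridCell i a b).region) : 0 ≤ p.2 :=
  (D.gridRadius_mem i b).1.trans hp.2.1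

theorem PolarDensity.gridCell_unique {i a b a' b' : ℕ} {p : PolarPoint}
    (hp : p ∈ (D.gridCell i a b).region) (hp' : p ∈ (D.gridCell i a' b').region) :
    a = a' ∧ b = b' := by
  have key : ∀ {t : ℕ → ℝ} (_ : Monotone t) {x : ℝ} {k l : ℕ}, x ∈ Set.Ico (t k) (t (k + 1)) →
      x ∈ Set.Ico (t l) (t (l + 1)) → k = l := by
    intro t ht x k l hk hl
    by_contra hne
    rcases Nat.lt_or_gt_of_ne hne with h | h
    · exact absurd (hk.2.trans_le (ht h)) (not_lt.2 hl.1)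
    · exact absurd (hl.2.trans_le (ht h)) (not_lt.2 hk.1)
  exact ⟨key (gridAngle_strictMono i).monotone hp.1 hp'.1, key (D.gridRadius_mono i) hp.2 hp'.2⟩

open Classical in
/-- A point of a cell lies in exactly one child of the cell. -/
theorem PolarDensity.sum_child {i a b : ℕ} {p : PolarPoint}
    (hp : p ∈ (D.gridCell i a b).region) {M : Type*} [AddCommMonoid M] (x : M) :
    ∑ k, (if p ∈ (D.child (D.gridCell i a b) k).region then x else 0) = x := by
  obtain ⟨⟨h1, h2⟩, h3, h4⟩ := hp
  rw [Fin.sum_univ_four]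
  by_cases hφ : p.1 < (D.gridCell i a b).midφ <;> by_cases hr : p.2 < D.midr (D.gridCell i a b) <;>
    simp [PolarDensity.child, Cell.region, hφ, hr, h1, h2, h3, h4, not_lt.1, not_le.2]

theorem PolarDensity.child_subset {i a b : ℕ} (hb : b < 2 ^ i) (k : Fin 4) :
    (D.child (D.gridCell i a b) k).region ⊆ (D.gridCell i a b).region := by
  rw [D.child_gridCell a hb]
  have hk : k.val % 2 ≤ 1 := by omega
  have hk' : k.val / 2 ≤ 1 := by omega
  refine Set.prod_mono (Set.Ico_subset_Ico ?_ ?_) (Set.Ico_subset_Ico ?_ ?_) <;>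
    simp only [PolarDensity.gridCell]
  · rw [← gridAngle_double i a]
    exact (gridAngle_strictMono _).monotone (by omega)
  · rw [← gridAngle_double i (a + 1)]
    exact (gridAngle_strictMono _).monotone (by omega)
  · rw [← D.gridRadius_double i b]
    exact D.gridRadius_mono _ (by omega)
  · rw [← D.gridRadius_double i (b + 1)]
    exact D.gridRadius_mono _ (by omega)

/-! ### Distances to cells -/

/-- The supremum of the distances to the points of a cell. -/
def cellFar (G : Geometry) (q : PolarPoint) (c : Cell) : ℝ := sSup (G.dist q '' c.region)

variable (G : Geometry) {q : PolarPoint}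

/-- The infimum over a half-open cell need not be attained, so the point is taken in the closed
rectangle, which `Geometry.sum_oscillation_le` allows. -/
theorem PolarDensity.exists_nearest (hq : 0 ≤ q.2) (i a b : ℕ) :
    ∃ y ∈ Set.Icc (gridAngle i a) (gridAngle i (a + 1)) ×ˢ
        Set.Icc (D.gridRadius i b) (D.gridRadius i (b + 1)),
      ∀ p ∈ (D.gridCell i a b).region, G.dist q y ≤ G.dist q p := by
  have hc : IsCompact (Set.Icc (gridAngle i a) (gridAngle i (a + 1)) ×ˢ
        Set.Icc (D.gridRadius i b) (D.gridRadius i (b + 1))) := isCompact_Icc.prod isCompact_Icc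
  have hne : (Set.Icc (gridAngle i a) (gridAngle i (a + 1)) ×ˢ
        Set.Icc (D.gridRadius i b) (D.gridRadius i (b + 1))).Nonempty :=
    (Set.nonempty_Icc.2 ((gridAngle_strictMono i).monotone (Nat.le_succ a))).prod
      (Set.nonempty_Icc.2 (D.gridRadius_mono i (Nat.le_succ b)))
  obtain ⟨y, hy, h⟩ := hc.exists_isMinOn hne ((G.continuousOn_dist hq).mono fun p hp =>
    (D.gridRadius_mem i b).1.trans hp.2.1)
  exact ⟨y, hy, fun p hp => h ⟨Set.Ico_subset_Icc_self hp.1, Set.Ico_subset_Icc_self hp.2⟩⟩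

theorem PolarDensity.exists_farthest (hq : 0 ≤ q.2) (i a b : ℕ) :
    ∃ y ∈ Set.Icc (gridAngle i a) (gridAngle i (a + 1)) ×ˢ
        Set.Icc (D.gridRadius i b) (D.gridRadius i (b + 1)),
      ∀ p ∈ (D.gridCell i a b).region, G.dist q p ≤ G.dist q y := by
  have hc : IsCompact (Set.Icc (gridAngle i a) (gridAngle i (a + 1)) ×ˢ
        Set.Icc (D.gridRadius i b) (D.gridRadius i (b + 1))) := isCompact_Icc.prod isCompact_Icc
  have hne : (Set.Icc (gridAngle i a) (gridAngle i (a + 1)) ×ˢ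
        Set.Icc (D.gridRadius i b) (D.gridRadius i (b + 1))).Nonempty :=
    (Set.nonempty_Icc.2 ((gridAngle_strictMono i).monotone (Nat.le_succ a))).prod
      (Set.nonempty_Icc.2 (D.gridRadius_mono i (Nat.le_succ b)))
  obtain ⟨y, hy, h⟩ := hc.exists_isMaxOn hne ((G.continuousOn_dist hq).mono fun p hp =>
    (D.gridRadius_mem i b).1.trans hp.2.1)
  exact ⟨y, hy, fun p hp => h ⟨Set.Ico_subset_Icc_self hp.1, Set.Ico_subset_Icc_self hp.2⟩⟩

theorem PolarDensity.cellDist_nonneg (hq : 0 ≤ q.2) (i a b : ℕ) :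
    0 ≤ cellDist G q (D.gridCell i a b) := by
  refine Real.sInf_nonneg ?_
  rintro _ ⟨p, hp, rfl⟩
  exact G.dist_nonneg hq (D.radius_nonneg_of_mem hp)

theorem PolarDensity.cellDist_le (hq : 0 ≤ q.2) {i a b : ℕ} {p : PolarPoint}
    (hp : p ∈ (D.gridCell i a b).region) : cellDist G q (D.gridCell i a b) ≤ G.dist q p := by
  refine csInf_le ⟨0, ?_⟩ ⟨p, hp, rfl⟩
  rintro _ ⟨p, hp, rfl⟩
  exact G.dist_nonneg hq (D.radius_nonneg_of_mem hp)

theorem PolarDensity.le_cellFar (hq : 0 ≤ q.2) {i a b : ℕ} {p : PolarPoint}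
    (hp : p ∈ (D.gridCell i a b).region) : G.dist q p ≤ cellFar G q (D.gridCell i a b) := by
  obtain ⟨z, _, hz⟩ := D.exists_farthest G hq i a b
  refine le_csSup ⟨G.dist q z, ?_⟩ ⟨p, hp, rfl⟩
  rintro _ ⟨p, hp, rfl⟩
  exact hz p hp

theorem PolarDensity.cellFar_nonneg (hq : 0 ≤ q.2) (i a b : ℕ) :
    0 ≤ cellFar G q (D.gridCell i a b) := by
  refine Real.sSup_nonneg ?_
  rintro _ ⟨p, hp, rfl⟩
  exact G.dist_nonneg hq (D.radius_nonneg_of_mem hp)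

theorem PolarDensity.cellDist_le_child (hq : 0 ≤ q.2) {i a b : ℕ} (hb : b < 2 ^ i) (k : Fin 4) :
    cellDist G q (D.gridCell i a b) ≤ cellDist G q (D.child (D.gridCell i a b) k) := by
  have hne : (D.child (D.gridCell i a b) k).region.Nonempty := by
    rw [D.child_gridCell a hb]
    exact D.gridCell_nonempty _ (by rw [pow_succ]; omega)
  refine le_csInf (hne.image _) ?_
  rintro _ ⟨p, hp, rfl⟩
  exact D.cellDist_le G hq (D.child_subset hb k hp)

/-- On each level, the oscillations over the cells of a bounded decreasing function of the distance
add up to a multiple of the number of columns of the grid. -/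
theorem PolarDensity.sum_cell_oscillation_le (hq : 0 ≤ q.2) {H : ℝ} {h : ℝ → ℝ}
    (hanti : AntitoneOn h (Set.Ici 0)) (h0 : ∀ d, 0 ≤ d → 0 ≤ h d) (hH : ∀ d, 0 ≤ d → h d ≤ H)
    (i : ℕ) :
    ∑ a ∈ Finset.range (2 ^ i), ∑ b ∈ Finset.range (2 ^ i),
      (h (cellDist G q (D.gridCell i a b)) - h (cellFar G q (D.gridCell i a b)))
      ≤ 7 * (2 ^ i * H) := by
  choose y hy hy' using D.exists_nearest G hq i
  choose z hz hz' using D.exists_farthest G hq i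
  have hy0 : ∀ a b, 0 ≤ (y a b).2 := fun a b => (D.gridRadius_mem i b).1.trans (hy a b).2.1
  have hz0 : ∀ a b, 0 ≤ (z a b).2 := fun a b => (D.gridRadius_mem i b).1.trans (hz a b).2.1
  have main := G.sum_oscillation_le hq D.radius_pos.le hanti h0 hH
    (gridAngle_strictMono i).monotone (D.gridRadius_mono i) (gridAngle_zero i) (gridAngle_last i)
    (D.gridRadius_zero i) (D.gridRadius_last i) hy hz
  push_cast at main
  refine le_trans (Finset.sum_le_sum fun a _ => Finset.sum_le_sum fun b hb => ?_) main
  have hne := (D.gridCell_nonempty a (Finset.mem_range.1 hb)).image (G.dist q)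
  refine sub_le_sub (hanti ?_ ?_ ?_) (hanti ?_ ?_ ?_)
  · exact G.dist_nonneg hq (hy0 a b)
  · exact D.cellDist_nonneg G hq i a b
  · refine le_csInf hne ?_
    rintro _ ⟨p, hp, rfl⟩
    exact hy' a b p hp
  · exact D.cellFar_nonneg G hq i a b
  · exact G.dist_nonneg hq (hz0 a b)
  · refine csSup_le hne ?_
    rintro _ ⟨p, hp, rfl⟩
    exact hz' a b p hp

end PNQ
end

/-! ### The random choices of the query, and trees whose bounds are correct. -/

noncomputable section
namespace PNQ

/-! ### The random numbers of the query -/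

/-- Since `log (1 - b) < 0`, the width is at least `m` exactly if `1 - rand ≤ (1 - b) ^ m`. So it is
geometric: the number of failures before the first success of a `b`-coin. -/
theorem jump_apply {b : ℝ} (h0 : 0 < b) (h1 : b ≤ 1) (k : ℕ) :
    jump b k = ENNReal.ofReal b * ENNReal.ofReal (1 - b) ^ k := by
  rw [jump, Measure.toPMF_apply, Measure.map_apply (measurable_jumpWidth b) (measurableSet_singleton k),
    randLaw, Measure.restrict_apply (measurable_jumpWidth b (measurableSet_singleton k)),
    ← ENNReal.ofReal_pow (by linarith), ← ENNReal.ofReal_mul h0.le]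
  rcases h1.eq_or_lt with rfl | h1
  · rcases Nat.eq_zero_or_pos k with rfl | hk
    · have : (jumpWidth 1 ⁻¹' {0} ∩ Set.Ico (0 : ℝ) 1) = Set.Ico (0 : ℝ) 1 := by
        ext u; simp [jumpWidth]
      rw [this]; simp
    · have : (jumpWidth 1 ⁻¹' {k} ∩ Set.Ico (0 : ℝ) 1) = ∅ := by
        ext u; simp [jumpWidth, hk.ne]
      rw [this]; simp [hk.ne']
  · have hb : 0 < 1 - b := by linarith
    have hlog : Real.log (1 - b) < 0 := Real.log_neg hb (by linarith)
    have hle : (1 - b) ^ (k + 1) ≤ (1 - b) ^ k := pow_le_pow_of_le_one hb.le (by linarith) (by omega)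
    have hpos : 0 < (1 - b) ^ (k + 1) := by positivity
    have hle1 : (1 - b) ^ k ≤ 1 := pow_le_one₀ hb.le (by linarith)
    have key : ∀ (u : ℝ) (m : ℕ), u < 1 →
        ((m : ℝ) ≤ Real.log (1 - u) / Real.log (1 - b) ↔ 1 - u ≤ (1 - b) ^ m) := by
      intro u m hu
      rw [le_div_iff_of_neg hlog, ← Real.log_pow, Real.log_le_log_iff (by linarith) (by positivity)]
    have : (jumpWidth b ⁻¹' {k} ∩ Set.Ico (0 : ℝ) 1)
        = Set.Ico (1 - (1 - b) ^ k) (1 - (1 - b) ^ (k + 1)) := by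
      ext u
      simp only [Set.mem_inter_iff, Set.mem_preimage, Set.mem_singleton_iff, Set.mem_Ico, jumpWidth,
        h1.ne, if_false]
      constructor
      · rintro ⟨h, hu0, hu1⟩
        have hnn : 0 ≤ Real.log (1 - u) / Real.log (1 - b) :=
          div_nonneg_of_nonpos (Real.log_nonpos (by linarith) (by linarith)) hlog.le
        rw [Nat.floor_eq_iff hnn] at h
        have h2 := (key u k hu1).1 h.1
        have h3 := mt (key u (k + 1) hu1).2 (by push_cast; exact not_le.2 h.2)
        push Not at h3
        exact ⟨by linarith, by linarith⟩
      · rintro ⟨h2, h3⟩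
        have hu0 : 0 ≤ u := by linarith
        have hu1 : u < 1 := by linarith
        have hnn : 0 ≤ Real.log (1 - u) / Real.log (1 - b) :=
          div_nonneg_of_nonpos (Real.log_nonpos (by linarith) (by linarith)) hlog.le
        refine ⟨(Nat.floor_eq_iff hnn).2 ⟨(key u k hu1).2 (by linarith), ?_⟩, hu0, hu1⟩
        have := mt (key u (k + 1) hu1).1 (by linarith)
        push_cast at this
        exact not_le.1 this
    rw [this, Real.volume_Ico]
    congr 1
    rw [pow_succ]; ring

theorem accept_true {a : ℝ} (h1 : a ≤ 1) : accept a true = ENNReal.ofReal a := by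
  rw [accept, Measure.toPMF_apply, Measure.map_apply (measurable_acceptTest a) (measurableSet_singleton _),
    randLaw, Measure.restrict_apply (measurable_acceptTest a (measurableSet_singleton _))]
  have : acceptTest a ⁻¹' {true} ∩ Set.Ico (0 : ℝ) 1 = Set.Ioo (1 - a) 1 := by
    ext u
    simp only [Set.mem_inter_iff, Set.mem_preimage, Set.mem_singleton_iff, acceptTest,
      decide_eq_true_eq, Set.mem_Ico, Set.mem_Ioo]
    constructor
    · rintro ⟨h, _, h'⟩; exact ⟨by linarith, h'⟩
    · rintro ⟨h, h'⟩; exact ⟨by linarith, by linarith, h'⟩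
  rw [this, Real.volume_Ioo]; congr 1; ring

theorem accept_false {a : ℝ} (h0 : 0 ≤ a) (h1 : a ≤ 1) :
    accept a false = ENNReal.ofReal (1 - a) := by
  have h := (accept a).tsum_coe
  rw [tsum_bool, accept_true h1] at h
  rw [ENNReal.ofReal_sub _ h0, ENNReal.ofReal_one, ← h,
    ENNReal.add_sub_cancel_right ENNReal.ofReal_ne_top]

/-! ### Expectations -/

/-- The expectation of `w` under a discrete distribution. -/
def expect {α : Type*} (p : PMF α) (w : α → ℝ≥0∞) : ℝ≥0∞ := ∑' x, p x * w x

theorem expect_pure {α : Type*} (x : α) (w : α → ℝ≥0∞) : expect (PMF.pure x) w = w x := by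
  rw [expect, tsum_eq_single x]
  · simp
  · intro y hy; simp [hy]

theorem expect_bind {α β : Type*} (p : PMF α) (g : α → PMF β) (w : β → ℝ≥0∞) :
    expect (p.bind g) w = expect p fun x => expect (g x) w := by
  simp only [expect, PMF.bind_apply, ← ENNReal.tsum_mul_right, ← ENNReal.tsum_mul_left]
  rw [ENNReal.tsum_comm]
  simp only [mul_assoc]

theorem expect_map {α β : Type*} (p : PMF α) (g : α → β) (w : β → ℝ≥0∞) :
    expect (p.map g) w = expect p (w ∘ g) := by
  rw [PMF.map, expect_bind]
  simp [expect_pure, Function.comp_def]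

theorem expect_const {α : Type*} (p : PMF α) (x : ℝ≥0∞) : expect p (fun _ => x) = x := by
  rw [expect, ENNReal.tsum_mul_right, p.tsum_coe, one_mul]

theorem expect_mul_left {α : Type*} (p : PMF α) (x : ℝ≥0∞) (w : α → ℝ≥0∞) :
    expect p (fun y => x * w y) = x * expect p w := by
  simp only [expect, ← ENNReal.tsum_mul_left]
  exact tsum_congr fun y => by ring

theorem expect_mul_right {α : Type*} (p : PMF α) (x : ℝ≥0∞) (w : α → ℝ≥0∞) :
    expect p (fun y => w y * x) = expect p w * x := by
  simp only [mul_comm _ x, expect_mul_left]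

/-- Markov's inequality. -/
theorem toOuterMeasure_le_expect {α : Type*} (p : PMF α) (w : α → ℝ≥0∞) {s : Set α}
    (h : ∀ x ∈ s, 1 ≤ w x) : p.toOuterMeasure s ≤ expect p w := by
  rw [PMF.toOuterMeasure_apply, expect]
  refine ENNReal.tsum_le_tsum fun x => ?_
  by_cases hx : x ∈ s
  · simpa [hx] using mul_le_mul_right (h x hx) (p x)
  · simp [hx]

/-! ### Shape of a quadtree -/

variable {n : ℕ}

/-- The points of a quadtree, in the order in which they are numbered. -/
def QuadTree.points : QuadTree n → List (Fin n)
  | .leaf _ l => l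
  | .node _ _ ch => (ch 0).points ++ (ch 1).points ++ (ch 2).points ++ (ch 3).points

variable (G : Geometry) (Q : Query) (pos : Fin n → PolarPoint)

/-- The probability with which a point is a neighbor. -/
def Query.prob (p : PolarPoint) : ℝ := Q.f (G.dist Q.q p)

/-- The upper bound of the probabilities with which points of a cell are neighbors. -/
def Query.bound (c : Cell) : ℝ := Q.f (cellDist G Q.q c)

/-- Quadtrees of depth at most `d` that record the correct numbers of points, and in which the
bound of each cell applies to the points of its subtree. -/
inductive Valid : ℕ → QuadTree n → Prop
  | leaf (d : ℕ) (c : Cell) (l : List (Fin n))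
      (h1 : Q.bound G c ∈ Set.Icc (0 : ℝ) 1)
      (hb : ∀ p ∈ l, Q.prob G (pos p) ∈ Set.Icc 0 (Q.bound G c)) :
      Valid d (.leaf c l)
  | node (d : ℕ) (c : Cell) (s : ℕ) (ch : Fin 4 → QuadTree n) (hch : ∀ k, Valid d (ch k))
      (hs : s = (ch 0).size + (ch 1).size + (ch 2).size + (ch 3).size)
      (h1 : Q.bound G c ∈ Set.Icc (0 : ℝ) 1)
      (hb : ∀ p ∈ (QuadTree.node c s ch).points, Q.prob G (pos p) ∈ Set.Icc 0 (Q.bound G c)) :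
      Valid (d + 1) (.node c s ch)

variable {G Q pos}

theorem Valid.bound_mem {d : ℕ} {T : QuadTree n} (h : Valid G Q pos d T) :
    Q.bound G T.cell ∈ Set.Icc (0 : ℝ) 1 := by
  cases h <;> assumption

theorem Valid.prob_mem {d : ℕ} {T : QuadTree n} (h : Valid G Q pos d T) {p : Fin n}
    (hp : p ∈ T.points) : Q.prob G (pos p) ∈ Set.Icc 0 (Q.bound G T.cell) := by
  cases h with
  | leaf _ _ _ _ hb => exact hb p hp
  | node _ _ _ _ _ _ _ hb => exact hb p hp

theorem Valid.size_eq {d : ℕ} {T : QuadTree n} (h : Valid G Q pos d T) :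
    T.size = T.points.length := by
  induction h with
  | leaf => rfl
  | node d c s ch hch hs h1 hb ih =>
    simp only [QuadTree.points, List.length_append, ← ih, ← hs]
    rfl

/-- The descent to the `k`-th point of a subtree. -/
theorem Valid.maybeGetKthElement_eq {d : ℕ} {T : QuadTree n} (h : Valid G Q pos d T) (b : ℝ)
    {k : ℕ} {p : Fin n} (hp : T.points[k]? = some p) :
    ∃ s ≤ 5 * d + 1, maybeGetKthElement G Q pos b T k =
      (accept (Q.prob G (pos p) / b)).map fun a => (some p, if a then some p else none, s) := by
  induction h generalizing k with
  | leaf d c l =>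
    refine ⟨1, by omega, ?_⟩
    simp only [QuadTree.points] at hp
    simp [maybeGetKthElement, hp, Query.prob]
  | node d c s ch hch hs h1 hb ih =>
    have hsz := fun i => (hch i).size_eq
    simp only [QuadTree.points, List.getElem?_append, List.length_append] at hp
    simp only [maybeGetKthElement, hsz]
    -- One call and at most four inspected children per level account for the factor `5`.
    have fin : ∀ (i : Fin 4) (off ins : ℕ), ins ≤ 4 → (ch i).points[k - off]? = some p →
        ∃ s ≤ 5 * (d + 1) + 1, (maybeGetKthElement G Q pos b (ch i) (k - off)).map
          (fun r => (r.1, r.2.1, 1 + ins + r.2.2)) =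
          (accept (Q.prob G (pos p) / b)).map fun a => (some p, if a then some p else none, s) := by
      intro i off ins hins hi
      obtain ⟨s, hs, e⟩ := ih i hi
      refine ⟨1 + ins + s, by omega, ?_⟩
      rw [e, PMF.map_comp]
      rfl
    split_ifs at hp ⊢ <;> first | omega | skip
    · exact fin 0 0 1 (by omega) hp
    · exact fin 1 _ 2 (by omega) hp
    · exact fin 2 _ 3 (by omega) hp
    · exact fin 3 _ 4 (by omega) hp

end PNQ
end

noncomputable section
namespace PNQ

variable {n : ℕ}

/-! ### Generating functions of the numbers of candidates and neighbors -/

/-- The monomial that counts candidates and neighbors of an outcome. -/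
def weight (α γ : ℝ≥0∞) (o : Outcome n) : ℝ≥0∞ :=
  α ^ o.candidates.length * γ ^ o.neighbors.length

theorem weight_merge (α γ : ℝ≥0∞) (o o' : Outcome n) :
    weight α γ (o.merge o') = weight α γ o * weight α γ o' := by
  simp only [weight, Outcome.merge, List.length_append, pow_add]; ring

theorem expect_accept {a : ℝ} (h0 : 0 ≤ a) (h1 : a ≤ 1) (w : Bool → ℝ≥0∞) :
    expect (accept a) w = ENNReal.ofReal (1 - a) * w false + ENNReal.ofReal a * w true := by
  rw [expect, tsum_bool, accept_true h1, accept_false h0 h1]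

/-- `κ b f` is the logarithm of an upper bound of the generating function of a point that is
a candidate with probability `b` and a neighbor with probability `f`. -/
def LogBound (α γ : ℝ≥0∞) (κ : ℝ → ℝ → ℝ) : Prop :=
  ∀ b f, 0 ≤ f → f ≤ b → b ≤ 1 →
    ENNReal.ofReal (1 - b) + ENNReal.ofReal (b - f) * α + ENNReal.ofReal f * (α * γ)
      ≤ ENNReal.ofReal (Real.exp (κ b f))

theorem LogBound.zero_le {α γ : ℝ≥0∞} {κ : ℝ → ℝ → ℝ} (h : LogBound α γ κ) : 0 ≤ κ 0 0 := by
  have := h 0 0 le_rfl le_rfl zero_le_one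
  simpa using this

variable {G : Geometry} {Q : Query} {pos : Fin n → PolarPoint}

/-- By memorylessness of the jump, the loop treats the points one after the other with independent
coins: with `E i` the expectation from index `i` on, `E i = (b * v i + (1 - b)) * E (i + 1)`. Each
factor is bounded by `LogBound`. -/
theorem Valid.expect_candidateLoop_le {d : ℕ} {T : QuadTree n} (hT : Valid G Q pos d T) {b : ℝ}
    (hb0 : 0 ≤ b) (hb1 : b ≤ 1) (hp : ∀ p ∈ T.points, Q.prob G (pos p) ∈ Set.Icc 0 b)
    {α γ : ℝ≥0∞} {κ : ℝ → ℝ → ℝ} (hκ : LogBound α γ κ) (i : ℕ) :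
    expect (candidateLoop G Q pos b T i) (weight α γ) ≤ ENNReal.ofReal (Real.exp
      ((T.points.drop i).map fun p => κ b (Q.prob G (pos p))).sum) := by
  rcases hb0.eq_or_lt with rfl | hb0
  · have h0 : 0 ≤ ((T.points.drop i).map fun p => κ 0 (Q.prob G (pos p))).sum := by
      refine List.sum_nonneg fun x hx => ?_
      obtain ⟨p, hpm, rfl⟩ := List.mem_map.1 hx
      have := hp p (List.mem_of_mem_drop hpm)
      rw [le_antisymm this.2 this.1]
      exact hκ.zero_le
    have h1 : expect (candidateLoop G Q pos 0 T i) (weight α γ) = 1 := by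
      rw [candidateLoop]
      split_ifs with _ h
      · simp [expect_pure, weight]
      · simp [expect_pure, weight]
      · exact absurd rfl h
    rw [h1, ← ENNReal.ofReal_one]
    exact ENNReal.ofReal_le_ofReal (Real.one_le_exp h0)
  set E : ℕ → ℝ≥0∞ := fun i => expect (candidateLoop G Q pos b T i) (weight α γ) with hE
  set v : ℕ → ℝ≥0∞ := fun j => expect (maybeGetKthElement G Q pos b T j)
    (fun r => α ^ r.1.toList.length * γ ^ r.2.1.toList.length) with hv
  -- `F j` is the expected weight once a jump has landed on index `j`; beyond the end nothing more
  -- is counted.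
  set F : ℕ → ℝ≥0∞ := fun j => if T.size ≤ j then 1 else v j * E (j + 1) with hF
  have hw1 : ∀ t, weight α γ (⟨[], [], 0, t⟩ : Outcome n) = 1 := fun t => by simp [weight]
  have hEF : ∀ i, E i = expect (jump b) fun δ => F (i + δ) := by
    intro i
    by_cases hi : T.size ≤ i
    · have : (fun δ => F (i + δ)) = fun _ => 1 := by
        funext δ; simp [hF, hi.trans (Nat.le_add_right i δ)]
      rw [this, expect_const, hE]
      simp only
      rw [candidateLoop, if_pos hi, expect_pure, hw1]
    · simp only [hE]
      rw [candidateLoop, if_neg hi, if_neg hb0.ne', expect_bind]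
      congr 1
      funext δ
      by_cases hδ : T.size ≤ i + δ
      · simp only [hδ, dif_pos, expect_pure, hw1, hF, if_true]
      · simp only [hδ, dif_neg, not_false_eq_true, expect_bind, expect_map, hF, if_false, hv,
          ← expect_mul_right]
        congr 1
        funext r
        rw [hE, ← expect_mul_left]
        congr 1
        funext o
        simp only [Function.comp_apply, weight, List.length_append, pow_add]
        ring
  -- The jump of width `0` is split off; given a positive width, the remaining jump has the original
  -- law, started at `i + 1`.
  have hrec : ∀ i, E i = ENNReal.ofReal b * F i + ENNReal.ofReal (1 - b) * E (i + 1) := by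
    intro i
    rw [hEF i, hEF (i + 1), expect, expect, tsum_eq_zero_add' ENNReal.summable,
      ← ENNReal.tsum_mul_left, jump_apply hb0 hb1]
    congr 1
    · simp
    · refine tsum_congr fun δ => ?_
      rw [jump_apply hb0 hb1, jump_apply hb0 hb1, pow_succ, add_right_comm i 1 δ, ← add_assoc]
      ring
  have hsz := hT.size_eq
  have base : ∀ i, T.size ≤ i → E i = 1 := by
    intro i hi
    simp only [hE]
    rw [candidateLoop, if_pos hi, expect_pure, hw1]
  show E i ≤ _
  induction hm : T.size - i generalizing i with
  | zero =>
    rw [base i (by omega), List.drop_eq_nil_of_le (by omega)]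
    simp
  | succ m ih =>
    have hi : i < T.points.length := by omega
    have hi' : ¬ T.size ≤ i := by omega
    obtain ⟨hf0, hfb⟩ := hp T.points[i] (List.getElem_mem hi)
    set f := Q.prob G (pos T.points[i]) with hf
    have hv' : v i = ENNReal.ofReal (1 - f / b) * α + ENNReal.ofReal (f / b) * (α * γ) := by
      obtain ⟨s, -, e⟩ := hT.maybeGetKthElement_eq b (List.getElem?_eq_getElem hi)
      simp only [hv]
      rw [e, expect_map, expect_accept (div_nonneg hf0 hb0.le) ((div_le_one hb0).2 hfb)]
      simp [hf]
    -- Accepting with probability `f / b` turns the candidate probability `b` into the neighbor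
    -- probability `f`.
    have hstep : ENNReal.ofReal b * v i + ENNReal.ofReal (1 - b)
        ≤ ENNReal.ofReal (Real.exp (κ b f)) := by
      refine le_trans (le_of_eq ?_) (hκ b f hf0 hfb hb1)
      have e1 : ENNReal.ofReal b * ENNReal.ofReal (1 - f / b) = ENNReal.ofReal (b - f) := by
        rw [← ENNReal.ofReal_mul hb0.le]; congr 1; field_simp
      have e2 : ENNReal.ofReal b * ENNReal.ofReal (f / b) = ENNReal.ofReal f := by
        rw [← ENNReal.ofReal_mul hb0.le]; congr 1; field_simp
      rw [hv', mul_add, ← mul_assoc, ← mul_assoc, e1, e2]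
      ring
    rw [List.drop_eq_getElem_cons hi, List.map_cons, List.sum_cons, Real.exp_add,
      ENNReal.ofReal_mul (Real.exp_nonneg _)]
    calc E i = (ENNReal.ofReal b * v i + ENNReal.ofReal (1 - b)) * E (i + 1) := by
          rw [hrec i, hF]; simp only [hi', if_false]; ring
      _ ≤ _ := mul_le_mul' hstep (ih (i + 1) (by omega))

variable (G Q pos) in
/-- The sum of `κ b f` over the points of a quadtree, where `b` is the bound of the leaf or virtual
leaf of the query that contains the point. -/
def QuadTree.cost (κ : ℝ → ℝ → ℝ) : QuadTree n → ℝ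
  | .leaf c l => (l.map fun p => κ (Q.bound G c) (Q.prob G (pos p))).sum
  | .node c s ch =>
      if 1 ≤ (s : ℝ) * Q.bound G c then
        (ch 0).cost κ + (ch 1).cost κ + (ch 2).cost κ + (ch 3).cost κ
      else ((QuadTree.node c s ch).points.map fun p => κ (Q.bound G c) (Q.prob G (pos p))).sum

/-- The four recursive calls use independent randomness and `weight` is multiplicative under
merging, so expectations multiply and the exponents add up to `cost`. -/
theorem Valid.expect_runQuery_le {d : ℕ} {T : QuadTree n} (hT : Valid G Q pos d T) {α γ : ℝ≥0∞}
    {κ : ℝ → ℝ → ℝ} (hκ : LogBound α γ κ) :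
    expect (runQuery G Q pos T) (weight α γ) ≤ ENNReal.ofReal (Real.exp (T.cost G Q pos κ)) := by
  have hw : ∀ {d : ℕ} {T : QuadTree n} {c : Cell} (_ : Valid G Q pos d T) (_ : T.cell = c),
      expect ((candidateLoop G Q pos (Q.f (cellDist G Q.q c)) T 0).map
        fun o => (⟨o.neighbors, o.candidates, o.cells + 1, o.time + 1⟩ : Outcome n)) (weight α γ)
      ≤ ENNReal.ofReal (Real.exp
        (T.points.map fun p => κ (Q.bound G c) (Q.prob G (pos p))).sum) := by
    rintro d T _ hT rfl
    rw [expect_map]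
    exact hT.expect_candidateLoop_le hT.bound_mem.1 hT.bound_mem.2 (fun p => hT.prob_mem) hκ 0
  induction hT with
  | leaf d c l h1 hb =>
    rw [QuadTree.cost, runQuery]
    exact hw (Valid.leaf d c l h1 hb) rfl
  | node d c s ch hch hs h1 hb ih =>
    rw [QuadTree.cost, runQuery]
    by_cases hc : 1 ≤ (s : ℝ) * Q.bound G c
    · have hc' := hc
      rw [Query.bound] at hc'
      rw [if_pos hc', if_pos hc, Real.exp_add, Real.exp_add, Real.exp_add,
        ENNReal.ofReal_mul (by positivity), ENNReal.ofReal_mul (by positivity),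
        ENNReal.ofReal_mul (by positivity)]
      simp only [expect_bind, expect_map, Function.comp_def, weight_merge, expect_mul_left,
        expect_mul_right]
      have h1 : weight α γ (⟨[], [], 1, 1⟩ : Outcome n) = 1 := by simp [weight]
      rw [h1, one_mul]
      exact mul_le_mul' (mul_le_mul' (mul_le_mul' (ih 0) (ih 1)) (ih 2)) (ih 3)
    · have hc' := hc
      rw [Query.bound] at hc'
      rw [if_neg hc', if_neg hc]
      exact hw (Valid.node d c s ch hch hs h1 hb) rfl

/-! ### Deterministic relations between the components of an outcome -/

/-- A candidate costs at most `5 * d + 1` steps of descent and one iteration; the extra `1` is the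
last iteration, whose jump leaves the subtree. -/
theorem Valid.support_candidateLoop {d : ℕ} {T : QuadTree n} (hT : Valid G Q pos d T) {b : ℝ}
    {i : ℕ} {o : Outcome n} (ho : o ∈ (candidateLoop G Q pos b T i).support) :
    o.cells = 0 ∧ o.neighbors.length ≤ o.candidates.length ∧
      o.time ≤ 1 + (5 * d + 2) * o.candidates.length := by
  induction hm : T.size - i using Nat.strong_induction_on generalizing i o with
  | _ m ih =>
    rw [candidateLoop] at ho
    split_ifs at ho with h1 h2
    · rw [PMF.mem_support_pure_iff] at ho; subst ho; simp
    · rw [PMF.mem_support_pure_iff] at ho; subst ho; simp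
    · rw [PMF.mem_support_bind_iff] at ho
      obtain ⟨δ, -, ho⟩ := ho
      split_ifs at ho with h3
      · rw [PMF.mem_support_pure_iff] at ho; subst ho; simp
      · have hlt : i + δ < T.points.length := by rw [← hT.size_eq]; omega
        obtain ⟨s, hs, e⟩ := hT.maybeGetKthElement_eq b (List.getElem?_eq_getElem hlt)
        rw [e, PMF.mem_support_bind_iff] at ho
        obtain ⟨r, hr, ho⟩ := ho
        rw [PMF.mem_support_map_iff] at hr ho
        obtain ⟨a, -, rfl⟩ := hr
        obtain ⟨o', ho', rfl⟩ := ho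
        obtain ⟨c1, c2, c3⟩ := ih _ (by omega) ho' rfl
        refine ⟨c1, ?_, ?_⟩
        · cases a <;> simp <;> omega
        · simp only [Option.toList_some, List.length_append, List.length_cons, List.length_nil]
          rw [mul_add]; omega

variable (G Q) in
/-- The number of calls of the query on a quadtree. -/
def QuadTree.calls : QuadTree n → ℕ
  | .leaf _ _ => 1
  | .node c s ch =>
      if 1 ≤ (s : ℝ) * Q.bound G c then
        1 + (ch 0).calls + (ch 1).calls + (ch 2).calls + (ch 3).calls
      else 1

/-- Each call pays for itself, for the merging of its result and for one fruitless iteration; the `+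
1` on the left is the merge that the root does not need. Compared with the loop, a candidate costs
one more per level, since as a neighbor it is merged once on every level. -/
theorem Valid.support_runQuery {d : ℕ} {T : QuadTree n} (hT : Valid G Q pos d T)
    {o : Outcome n} (ho : o ∈ (runQuery G Q pos T).support) :
    o.cells = T.calls G Q ∧ o.neighbors.length ≤ o.candidates.length ∧
      o.time + 1 ≤ 3 * o.cells + (6 * d + 2) * o.candidates.length := by
  have hw : ∀ {d : ℕ} {T : QuadTree n} {c : Cell} (_ : Valid G Q pos d T) (_ : T.cell = c)
      {o : Outcome n} (_ : o ∈ ((candidateLoop G Q pos (Q.f (cellDist G Q.q c)) T 0).map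
        fun o => (⟨o.neighbors, o.candidates, o.cells + 1, o.time + 1⟩ : Outcome n)).support),
      o.cells = 1 ∧ o.neighbors.length ≤ o.candidates.length ∧
      o.time + 1 ≤ 3 * o.cells + (6 * d + 2) * o.candidates.length := by
    rintro d T _ hT rfl o ho
    rw [PMF.mem_support_map_iff] at ho
    obtain ⟨o', ho', rfl⟩ := ho
    obtain ⟨h1, h2, h3⟩ := hT.support_candidateLoop ho'
    have h4 : (5 * d + 2) * o'.candidates.length ≤ (6 * d + 2) * o'.candidates.length :=
      Nat.mul_le_mul_right _ (by omega)
    exact ⟨by simp [h1], h2, by simp only; omega⟩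
  induction hT generalizing o with
  | leaf d c l h1 hb =>
    rw [runQuery] at ho
    exact hw (Valid.leaf d c l h1 hb) rfl ho
  | node d c s ch hch hs h1 hb ih =>
    rw [runQuery] at ho
    rw [QuadTree.calls]
    by_cases hc : 1 ≤ (s : ℝ) * Q.bound G c
    · have hc' := hc
      rw [Query.bound] at hc'
      rw [if_pos hc'] at ho
      rw [if_pos hc]
      simp only [PMF.mem_support_bind_iff, PMF.mem_support_map_iff] at ho
      obtain ⟨o₀, h0, o₁, h1, o₂, h2, o₃, h3, rfl⟩ := ho
      obtain ⟨a0, b0, c0⟩ := ih 0 h0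
      obtain ⟨a1, b1, c1⟩ := ih 1 h1
      obtain ⟨a2, b2, c2⟩ := ih 2 h2
      obtain ⟨a3, b3, c3⟩ := ih 3 h3
      simp only [Outcome.merge, List.length_append, List.length_nil, zero_add]
      refine ⟨by omega, by omega, ?_⟩
      simp only [mul_add, add_mul] at c0 c1 c2 c3 ⊢
      omega
    · have hc' := hc
      rw [Query.bound] at hc'
      rw [if_neg hc'] at ho
      rw [if_neg hc]
      exact hw (Valid.node d c s ch hch hs h1 hb) rfl ho

end PNQ
end

/-! ### The quadtree inside the grid, and recursion over its levels. -/

noncomputable section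
namespace PNQ

variable {n : ℕ} {R : ℝ} (D : PolarDensity R) {cap : ℕ} {G : Geometry} {Q : Query}
  {pos : Fin n → PolarPoint}

/-! ### Termination of the construction -/

theorem resolved_of_length_le {l : List (Fin n)} (h : l.length ≤ cap) (d : ℕ) (c : Cell) :
    Resolved D cap pos d c l := by
  cases d with
  | zero => exact h
  | succ d => exact Or.inl h

theorem Resolved.child {d : ℕ} {c : Cell} {l : List (Fin n)}
    (h : Resolved D cap pos (d + 1) c l) (k : Fin 4) :
    Resolved D cap pos d (D.child c k) (pointsIn pos (D.child c k) l) := by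
  rcases h with h | h
  · exact resolved_of_length_le D ((List.length_filter_le _ _).trans h) _ _
  · exact h k

theorem Resolved.build_eq {d : ℕ} {c : Cell} {l : List (Fin n)} (h : Resolved D cap pos d c l)
    {d' : ℕ} (hd : d ≤ d') : build D cap pos d' c l = build D cap pos d c l := by
  induction d generalizing d' c l with
  | zero =>
    have h' : l.length ≤ cap := h
    cases d' with
    | zero => rfl
    | succ d' => rw [build, build, if_pos h']
  | succ d ih =>
    obtain ⟨d', rfl⟩ : ∃ e, d' = e + 1 := ⟨d' - 1, by omega⟩
    rw [build, build]
    split_ifs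
    · rfl
    · congr 1
      funext k
      exact ih (h.child D k) (by omega)

/-- `quadtree` uses the least depth that resolves all cells; levels beyond it change nothing, so any
resolving depth may be used. -/
theorem Resolved.quadtree_eq {d : ℕ} (h : Resolved D cap pos d (rootCell R) (List.finRange n)) :
    quadtree D cap pos = build D cap pos d (rootCell R) (List.finRange n) := by
  have hmem := Nat.sInf_mem (s := {d | Resolved D cap pos d (rootCell R) (List.finRange n)}) ⟨d, h⟩
  exact (Resolved.build_eq D hmem (Nat.sInf_le h)).symm

theorem length_le_one {α : Type*} {l : List α} (hl : l.Nodup) (h : ∀ x ∈ l, ∀ y ∈ l, x = y) :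
    l.length ≤ 1 := by
  match l with
  | [] => simp
  | [_] => simp
  | x :: y :: _ =>
    obtain rfl := h x (by simp) y (by simp)
    simp at hl

/-- The construction ends within `L` levels if no two points lie in a common cell of level `L`. -/
theorem resolved_of_separated (hcap : 1 ≤ cap) {L : ℕ}
    (hsep : ∀ x y, ∀ a < 2 ^ L, ∀ b < 2 ^ L, pos x ∈ (D.gridCell L a b).region → pos y ∈ (D.gridCell L a b).region →
      x = y) {d i a b : ℕ} (hd : i + d = L) (ha : a < 2 ^ i) (hb : b < 2 ^ i) {l : List (Fin n)} (hl : l.Nodup)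
    (hmem : ∀ p ∈ l, pos p ∈ (D.gridCell i a b).region) :
    Resolved D cap pos d (D.gridCell i a b) l := by
  induction d generalizing i a b l with
  | zero =>
    obtain rfl : i = L := by omega
    exact (length_le_one hl fun x hx y hy => hsep x y a ha b hb (hmem x hx) (hmem y hy)).trans hcap
  | succ d ih =>
    refine Or.inr fun k => ?_
    have hlist : ∀ p ∈ pointsIn pos (D.child (D.gridCell i a b) k) l,
        pos p ∈ (D.child (D.gridCell i a b) k).region := fun p hp => by
      simpa using (List.mem_filter.1 hp).2
    rw [D.child_gridCell a hb] at hlist ⊢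
    exact ih (by omega) (by rw [pow_succ]; omega) (by rw [pow_succ]; omega) (hl.filter _) hlist

/-! ### Points of the subtrees -/

open Classical in
theorem sum_pointsIn {M : Type*} [AddCommMonoid M] (c : Cell) (l : List (Fin n)) (g : Fin n → M) :
    ((pointsIn pos c l).map g).sum = (l.map fun p => if pos p ∈ c.region then g p else 0).sum := by
  induction l with
  | nil => simp [pointsIn]
  | cons x l ih =>
    rw [pointsIn] at ih ⊢
    by_cases h : pos x ∈ c.region <;> simp [h, ih]

theorem sum_children {M : Type*} [AddCommMonoid M] {i a b : ℕ} {l : List (Fin n)}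
    (hl : ∀ p ∈ l, pos p ∈ (D.gridCell i a b).region) (g : Fin n → M) :
    ∑ k, ((pointsIn pos (D.child (D.gridCell i a b) k) l).map g).sum = (l.map g).sum := by
  simp only [sum_pointsIn]
  induction l with
  | nil => simp
  | cons x l ih =>
    simp only [List.map_cons, List.sum_cons, Finset.sum_add_distrib]
    rw [ih fun p hp => hl p (List.mem_cons_of_mem x hp), D.sum_child (hl x List.mem_cons_self)]

theorem mem_pointsIn {c : Cell} {l : List (Fin n)} {p : Fin n} :
    p ∈ pointsIn pos c l ↔ p ∈ l ∧ pos p ∈ c.region := by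
  simp [pointsIn]

theorem length_children {i a b : ℕ} {l : List (Fin n)}
    (hl : ∀ p ∈ l, pos p ∈ (D.gridCell i a b).region) :
    ∑ k, (pointsIn pos (D.child (D.gridCell i a b) k) l).length = l.length := by
  simpa [List.map_const', List.sum_replicate] using sum_children D hl fun _ => (1 : ℕ)

theorem build_size (d : ℕ) (c : Cell) (l : List (Fin n)) :
    (build D cap pos d c l).size = l.length := by
  cases d with
  | zero => rfl
  | succ d => rw [build]; split_ifs <;> rfl

theorem mem_of_mem_points {d : ℕ} {c : Cell} {l : List (Fin n)} {p : Fin n}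
    (hp : p ∈ (build D cap pos d c l).points) : p ∈ l := by
  induction d generalizing c l with
  | zero => exact hp
  | succ d ih =>
    rw [build] at hp
    split_ifs at hp
    · exact hp
    · simp only [QuadTree.points, List.mem_append] at hp
      rcases hp with ((hp | hp) | hp) | hp <;> exact (mem_pointsIn.1 (ih hp)).1

/-- The tree only rearranges the points. Sums are the form in which this is needed. -/
theorem sum_points_build {M : Type*} [AddCommMonoid M] (g : Fin n → M) {d i a b : ℕ}
    (hb : b < 2 ^ i) {l : List (Fin n)} (hl : ∀ p ∈ l, pos p ∈ (D.gridCell i a b).region) :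
    ((build D cap pos d (D.gridCell i a b) l).points.map g).sum = (l.map g).sum := by
  induction d generalizing i a b l with
  | zero => rfl
  | succ d ih =>
    rw [build]
    split_ifs
    · rfl
    · have key : ∀ k, ((build D cap pos d (D.child (D.gridCell i a b) k)
          (pointsIn pos (D.child (D.gridCell i a b) k) l)).points.map g).sum
          = ((pointsIn pos (D.child (D.gridCell i a b) k) l).map g).sum := by
        intro k
        have hlist : ∀ p ∈ pointsIn pos (D.child (D.gridCell i a b) k) l,
            pos p ∈ (D.child (D.gridCell i a b) k).region := fun p hp => (mem_pointsIn.1 hp).2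
        rw [D.child_gridCell a hb] at hlist ⊢
        exact ih (by rw [pow_succ]; omega) hlist
      rw [← sum_children D hl g, Fin.sum_univ_four]
      simp only [QuadTree.points, List.map_append, List.sum_append, key]

/-! ### Bounds on cells -/

theorem bound_mem (i a b : ℕ) : Q.bound G (D.gridCell i a b) ∈ Set.Icc (0 : ℝ) 1 :=
  Q.f_mem _ (D.cellDist_nonneg G Q.radius_nonneg i a b)

theorem prob_mem {i a b : ℕ} {p : PolarPoint} (hp : p ∈ (D.gridCell i a b).region) :
    Q.prob G p ∈ Set.Icc 0 (Q.bound G (D.gridCell i a b)) := by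
  have hd := G.dist_nonneg Q.radius_nonneg (D.radius_nonneg_of_mem hp)
  exact ⟨(Q.f_mem _ hd).1, Q.f_antitone (D.cellDist_nonneg G Q.radius_nonneg i a b) hd
    (D.cellDist_le G Q.radius_nonneg hp)⟩

theorem bound_child_le {i a b : ℕ} (hb : b < 2 ^ i) (k : Fin 4) :
    Q.bound G (D.child (D.gridCell i a b) k) ≤ Q.bound G (D.gridCell i a b) := by
  have h := D.cellDist_le_child G Q.radius_nonneg hb (a := a) k
  have h0 := D.cellDist_nonneg G Q.radius_nonneg i a b
  exact Q.f_antitone h0 (h0.trans h) h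

theorem valid_build {d i a b : ℕ} (hb : b < 2 ^ i) {l : List (Fin n)}
    (hl : ∀ p ∈ l, pos p ∈ (D.gridCell i a b).region) :
    Valid G Q pos d (build D cap pos d (D.gridCell i a b) l) := by
  have hprob : ∀ p ∈ l, Q.prob G (pos p) ∈ Set.Icc 0 (Q.bound G (D.gridCell i a b)) :=
    fun p hp => prob_mem D (hl p hp)
  induction d generalizing i a b l with
  | zero => exact Valid.leaf _ _ _ (bound_mem D i a b) hprob
  | succ d ih =>
    have hmem := fun p => mem_of_mem_points D (cap := cap) (pos := pos) (d := d + 1)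
      (c := D.gridCell i a b) (l := l) (p := p)
    rw [build] at hmem ⊢
    split_ifs at hmem ⊢
    · exact Valid.leaf _ _ _ (bound_mem D i a b) hprob
    · refine Valid.node _ _ _ _ (fun k => ?_) ?_ (bound_mem D i a b)
        fun p hp => hprob p (hmem p hp)
      · have hlist : ∀ p ∈ pointsIn pos (D.child (D.gridCell i a b) k) l,
            pos p ∈ (D.child (D.gridCell i a b) k).region := fun p hp => (mem_pointsIn.1 hp).2
        rw [D.child_gridCell a hb] at hlist ⊢
        exact ih (by rw [pow_succ]; omega) hlist fun p hp => prob_mem D (hlist p hp)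
      · simp only [build_size]
        rw [← length_children D hl, Fin.sum_univ_four]

/-! ### Costs of subtrees -/

/-- If `κ` ignores the bound, it does not matter where the query stops. This applies to the count of
neighbors. -/
theorem cost_of_indep (g : ℝ → ℝ) (T : QuadTree n) :
    T.cost G Q pos (fun _ f => g f) = (T.points.map fun p => g (Q.prob G (pos p))).sum := by
  induction T with
  | leaf c l => rfl
  | node c s ch ih =>
    rw [QuadTree.cost]
    split_ifs
    · simp only [ih, QuadTree.points, List.map_append, List.sum_append]
    · rfl

theorem Valid.cost_nonneg {κ : ℝ → ℝ → ℝ} (hκ : ∀ b f, 0 ≤ f → f ≤ b → 0 ≤ κ b f) {d : ℕ}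
    {T : QuadTree n} (hT : Valid G Q pos d T) : 0 ≤ T.cost G Q pos κ := by
  induction hT with
  | leaf d c l h1 hb =>
    refine List.sum_nonneg fun x hx => ?_
    obtain ⟨p, hp, rfl⟩ := List.mem_map.1 hx
    exact hκ _ _ (hb p hp).1 (hb p hp).2
  | node d c s ch hch hs h1 hb ih =>
    rw [QuadTree.cost]
    split_ifs
    · linarith [ih 0, ih 1, ih 2, ih 3]
    · refine List.sum_nonneg fun x hx => ?_
      obtain ⟨p, hp, rfl⟩ := List.mem_map.1 hx
      exact hκ _ _ (hb p hp).1 (hb p hp).2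

theorem one_le_calls (T : QuadTree n) : 1 ≤ T.calls G Q := by
  cases T with
  | leaf => rfl
  | node c s ch => rw [QuadTree.calls]; split_ifs <;> omega

theorem sum_map_le_sum_map {l : List (Fin n)} {g g' : Fin n → ℝ} (h : ∀ p ∈ l, g p ≤ g' p) :
    (l.map g).sum ≤ (l.map g').sum := List.sum_le_sum h

/-- If `κ` increases with the bound, the cost of a subtree is at most its cost as virtual leaf. -/
theorem cost_build_le {κ : ℝ → ℝ → ℝ} (hκ : ∀ b b' f, b ≤ b' → κ b f ≤ κ b' f) {d i a b : ℕ}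
    (hb : b < 2 ^ i) {l : List (Fin n)} (hl : ∀ p ∈ l, pos p ∈ (D.gridCell i a b).region) :
    (build D cap pos d (D.gridCell i a b) l).cost G Q pos κ
      ≤ (l.map fun p => κ (Q.bound G (D.gridCell i a b)) (Q.prob G (pos p))).sum := by
  induction d generalizing i a b l with
  | zero => exact le_rfl
  | succ d ih =>
    have hpts := sum_points_build D (cap := cap) (d := d + 1)
      (fun p => κ (Q.bound G (D.gridCell i a b)) (Q.prob G (pos p))) hb hl
    rw [build] at hpts ⊢
    split_ifs at hpts ⊢
    · exact le_rfl
    · rw [QuadTree.cost]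
      split_ifs
      · have key : ∀ k, (build D cap pos d (D.child (D.gridCell i a b) k)
            (pointsIn pos (D.child (D.gridCell i a b) k) l)).cost G Q pos κ
            ≤ ((pointsIn pos (D.child (D.gridCell i a b) k) l).map
              fun p => κ (Q.bound G (D.gridCell i a b)) (Q.prob G (pos p))).sum := by
          intro k
          have hlist : ∀ p ∈ pointsIn pos (D.child (D.gridCell i a b) k) l,
              pos p ∈ (D.child (D.gridCell i a b) k).region := fun p hp => (mem_pointsIn.1 hp).2
          refine le_trans ?_ (sum_map_le_sum_map fun p _ => hκ _ _ _ (bound_child_le D hb k))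
          rw [D.child_gridCell a hb] at hlist ⊢
          exact ih (by rw [pow_succ]; omega) hlist
        have := sum_children D hl fun p => κ (Q.bound G (D.gridCell i a b)) (Q.prob G (pos p))
        rw [Fin.sum_univ_four] at this
        linarith [key 0, key 1, key 2, key 3]
      · exact hpts.le

/-- A node that is descended has `l.length * bound ≥ 1`, which pays for its four calls. Bounds
decrease towards the children and the points are distributed among them, so every level pays at most
four times the product at the top. -/
theorem calls_build_le {d i a b : ℕ} (hb : b < 2 ^ i) {l : List (Fin n)}
    (hl : ∀ p ∈ l, pos p ∈ (D.gridCell i a b).region) :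
    ((build D cap pos d (D.gridCell i a b) l).calls G Q : ℝ)
      ≤ 1 + 4 * d * (l.length * Q.bound G (D.gridCell i a b)) := by
  have hB := (bound_mem D (Q := Q) (G := G) i a b).1
  induction d generalizing i a b l with
  | zero => simp [build, QuadTree.calls]
  | succ d ih =>
    have hnn : 0 ≤ 4 * ((d + 1 : ℕ) : ℝ) * (l.length * Q.bound G (D.gridCell i a b)) := by
      positivity
    rw [build]
    split_ifs
    · simp only [QuadTree.calls]; push_cast at hnn ⊢; linarith
    · rw [QuadTree.calls]
      split_ifs with hc
      · have key : ∀ k, ((build D cap pos d (D.child (D.gridCell i a b) k)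
            (pointsIn pos (D.child (D.gridCell i a b) k) l)).calls G Q : ℝ)
            ≤ 1 + 4 * d * ((pointsIn pos (D.child (D.gridCell i a b) k) l).length *
              Q.bound G (D.gridCell i a b)) := by
          intro k
          have hlist : ∀ p ∈ pointsIn pos (D.child (D.gridCell i a b) k) l,
              pos p ∈ (D.child (D.gridCell i a b) k).region := fun p hp => (mem_pointsIn.1 hp).2
          have hle := bound_child_le D hb (a := a) (Q := Q) (G := G) k
          refine le_trans ?_ (add_le_add_right (mul_le_mul_of_nonneg_left
            (mul_le_mul_of_nonneg_left hle (Nat.cast_nonneg _)) (by positivity)) 1)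
          rw [D.child_gridCell a hb] at hlist ⊢
          exact ih (by rw [pow_succ]; omega) hlist (bound_mem D _ _ _).1
        have hlen : (((pointsIn pos (D.child (D.gridCell i a b) 0) l).length : ℝ)
            + (pointsIn pos (D.child (D.gridCell i a b) 1) l).length
            + (pointsIn pos (D.child (D.gridCell i a b) 2) l).length
            + (pointsIn pos (D.child (D.gridCell i a b) 3) l).length) = l.length := by
          rw [← length_children D hl, Fin.sum_univ_four]; push_cast; ring
        have k0 := key 0
        have k1 := key 1
        have k2 := key 2
        have k3 := key 3
        push_cast
        rw [← hlen] at hc ⊢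
        nlinarith
      · push_cast at hnn ⊢; linarith

/-! ### Summation over the levels of the quadtree -/

theorem sum_range_double (m : ℕ) (g : ℕ → ℝ) :
    ∑ a ∈ Finset.range (2 * m), g a = ∑ a ∈ Finset.range m, (g (2 * a) + g (2 * a + 1)) := by
  induction m with
  | zero => simp
  | succ m ih =>
    rw [mul_add, mul_one, Finset.sum_range_succ, Finset.sum_range_succ, ih, Finset.sum_range_succ]
    ring

/-- The sum over all cells of level `i`. -/
def gridSum (i : ℕ) (g : ℕ → ℕ → ℝ) : ℝ :=
  ∑ a ∈ Finset.range (2 ^ i), ∑ b ∈ Finset.range (2 ^ i), g a b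

theorem gridSum_mono {i : ℕ} {g g' : ℕ → ℕ → ℝ}
    (h : ∀ a < 2 ^ i, ∀ b < 2 ^ i, g a b ≤ g' a b) : gridSum i g ≤ gridSum i g' :=
  Finset.sum_le_sum fun a ha => Finset.sum_le_sum fun b hb =>
    h a (Finset.mem_range.1 ha) b (Finset.mem_range.1 hb)

theorem gridSum_add (i : ℕ) (g g' : ℕ → ℕ → ℝ) :
    gridSum i (fun a b => g a b + g' a b) = gridSum i g + gridSum i g' := by
  simp only [gridSum, Finset.sum_add_distrib]

theorem gridSum_mul_left (i : ℕ) (x : ℝ) (g : ℕ → ℕ → ℝ) :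
    gridSum i (fun a b => x * g a b) = x * gridSum i g := by
  simp only [gridSum, Finset.mul_sum]

theorem gridSum_succ (i : ℕ) (g : ℕ → ℕ → ℝ) :
    gridSum (i + 1) g
      = gridSum i fun a b => ∑ k : Fin 4, g (2 * a + k.val % 2) (2 * b + k.val / 2) := by
  simp only [gridSum, pow_succ, mul_comm _ 2, sum_range_double, Fin.sum_univ_four,
    ← Finset.sum_add_distrib]
  refine Finset.sum_congr rfl fun a _ => Finset.sum_congr rfl fun b _ => ?_
  simp
  ring

/-- Unrolls a recursive inequality: the local terms are collected level by level, and what remains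
sits on level `m`. -/
theorem le_gridSum_levels {V w : ℕ → ℕ → ℕ → ℝ} {m : ℕ}
    (h : ∀ i < m, ∀ a < 2 ^ i, ∀ b < 2 ^ i, V i a b
      ≤ w i a b + ∑ k : Fin 4, V (i + 1) (2 * a + k.val % 2) (2 * b + k.val / 2)) :
    V 0 0 0 ≤ ∑ i ∈ Finset.range m, gridSum i (w i) + gridSum m (V m) := by
  induction m with
  | zero => simp [gridSum]
  | succ m ih =>
    have h1 := ih fun i hi => h i (by omega)
    have h2 := gridSum_mono (h m (Nat.lt_succ_self m))
    rw [gridSum_add, ← gridSum_succ] at h2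
    rw [Finset.sum_range_succ]
    linarith

variable (pos) in
/-- The points in a cell of the grid. -/
def gridPoints (i a b : ℕ) : List (Fin n) := pointsIn pos (D.gridCell i a b) (List.finRange n)

theorem mem_gridPoints {i a b : ℕ} {p : Fin n} :
    p ∈ gridPoints D pos i a b ↔ pos p ∈ (D.gridCell i a b).region := by
  simp [gridPoints, mem_pointsIn]

theorem pointsIn_gridPoints {i a b : ℕ} (hb : b < 2 ^ i) (k : Fin 4) :
    pointsIn pos (D.child (D.gridCell i a b) k) (gridPoints D pos i a b)
      = gridPoints D pos (i + 1) (2 * a + k.val % 2) (2 * b + k.val / 2) := by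
  rw [gridPoints, gridPoints, ← D.child_gridCell a hb, pointsIn, pointsIn, pointsIn,
    List.filter_filter]
  refine List.filter_congr fun p _ => ?_
  have hsub := D.child_subset (a := a) hb k
  by_cases h : pos p ∈ (D.child (D.gridCell i a b) k).region
  · simp [h, hsub h]
  · simp [h]

variable (cap pos) in
/-- The quadtree below a cell of the grid, cut off below level `L`. -/
def gridTree (L i a b : ℕ) : QuadTree n :=
  build D cap pos (L - i) (D.gridCell i a b) (gridPoints D pos i a b)

theorem gridTree_eq {L i a b : ℕ} (hi : i < L) (hb : b < 2 ^ i) :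
    gridTree D cap pos L i a b = if (gridPoints D pos i a b).length ≤ cap then
      .leaf (D.gridCell i a b) (gridPoints D pos i a b)
      else .node (D.gridCell i a b) (gridPoints D pos i a b).length fun k =>
        gridTree D cap pos L (i + 1) (2 * a + k.val % 2) (2 * b + k.val / 2) := by
  obtain ⟨e, he⟩ : ∃ e, L - i = e + 1 := ⟨L - i - 1, by omega⟩
  have he' : L - (i + 1) = e := by omega
  simp only [gridTree, he, he', build, ← pointsIn_gridPoints D hb, D.child_gridCell a hb]

theorem valid_gridTree (L : ℕ) {i a b : ℕ} (hb : b < 2 ^ i) :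
    Valid G Q pos (L - i) (gridTree D cap pos L i a b) :=
  valid_build D hb fun _ hp => (mem_gridPoints D).1 hp

theorem two_mul_add_lt {i b k : ℕ} (hb : b < 2 ^ i) (hk : k < 4) : 2 * b + k / 2 < 2 ^ (i + 1) := by
  rw [pow_succ]; omega

/-- Where the query stops, `|c| * b ≤ cap`: a leaf has at most `cap` points and `b ≤ 1`, a virtual
leaf has `|c| * b < 1`. This condition depends on the cell alone, not on the history of the query,
and nonnegativity of `κ` allows both terms to be kept. -/
theorem cost_gridTree_le (hcap : 1 ≤ cap) {κ : ℝ → ℝ → ℝ}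
    (hκ : ∀ b f, 0 ≤ f → f ≤ b → 0 ≤ κ b f) {L i a b : ℕ} (hi : i < L) (hb : b < 2 ^ i) :
    (gridTree D cap pos L i a b).cost G Q pos κ ≤
      (if (gridPoints D pos i a b).length * Q.bound G (D.gridCell i a b) ≤ cap then
        ((gridPoints D pos i a b).map fun p =>
          κ (Q.bound G (D.gridCell i a b)) (Q.prob G (pos p))).sum else 0)
      + ∑ k : Fin 4, (gridTree D cap pos L (i + 1) (2 * a + k.val % 2)
          (2 * b + k.val / 2)).cost G Q pos κ := by
  have hch : 0 ≤ ∑ k : Fin 4, (gridTree D cap pos L (i + 1) (2 * a + k.val % 2)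
          (2 * b + k.val / 2)).cost G Q pos κ :=
    Finset.sum_nonneg fun k _ => (valid_gridTree D L (two_mul_add_lt hb k.2)).cost_nonneg hκ
  have hpts := sum_points_build D (cap := cap) (d := L - i)
    (fun p => κ (Q.bound G (D.gridCell i a b)) (Q.prob G (pos p))) hb
    (l := gridPoints D pos i a b) fun _ hp => (mem_gridPoints D).1 hp
  change ((gridTree D cap pos L i a b).points.map _).sum = _ at hpts
  have hnn : 0 ≤ ((gridPoints D pos i a b).map fun p =>
      κ (Q.bound G (D.gridCell i a b)) (Q.prob G (pos p))).sum := by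
    refine List.sum_nonneg fun x hx => ?_
    obtain ⟨p, hp, rfl⟩ := List.mem_map.1 hx
    have := prob_mem D (Q := Q) (G := G) ((mem_gridPoints D).1 hp)
    exact hκ _ _ this.1 this.2
  have hcap' : (1 : ℝ) ≤ cap := by exact_mod_cast hcap
  rw [gridTree_eq D hi hb] at hpts ⊢
  split_ifs at hpts ⊢ with h1 h2 h2
  · exact le_add_of_nonneg_right hch
  · refine absurd ?_ h2
    have h1' : ((gridPoints D pos i a b).length : ℝ) ≤ cap := by exact_mod_cast h1
    obtain ⟨hB0, hB1⟩ := bound_mem D (Q := Q) (G := G) i a b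
    nlinarith
  · rw [QuadTree.cost]
    split_ifs
    · rw [Fin.sum_univ_four] at *; linarith
    · rw [hpts]; exact le_add_of_nonneg_right hch
  · rw [QuadTree.cost]
    split_ifs with h3
    · rw [Fin.sum_univ_four] at *; linarith
    · exact absurd (by linarith) h2

/-- Subtracting `1` makes a node where the query stops count `0`, and a descended node contribute
exactly `4`. -/
theorem calls_gridTree_le {L i a b : ℕ} (hi : i < L) (hb : b < 2 ^ i) :
    ((gridTree D cap pos L i a b).calls G Q : ℝ) - 1 ≤
      (if 1 ≤ (gridPoints D pos i a b).length * Q.bound G (D.gridCell i a b) then 4 else 0)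
      + ∑ k : Fin 4, (((gridTree D cap pos L (i + 1) (2 * a + k.val % 2)
          (2 * b + k.val / 2)).calls G Q : ℝ) - 1) := by
  have hch : 0 ≤ ∑ k : Fin 4, (((gridTree D cap pos L (i + 1) (2 * a + k.val % 2)
          (2 * b + k.val / 2)).calls G Q : ℝ) - 1) :=
    Finset.sum_nonneg fun k _ => sub_nonneg.2 (by exact_mod_cast one_le_calls _)
  have hif : (0 : ℝ) ≤ (if 1 ≤ (gridPoints D pos i a b).length * Q.bound G (D.gridCell i a b)
      then 4 else 0) := by split_ifs <;> norm_num
  rw [gridTree_eq D hi hb]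
  split_ifs with h1 h2 h2
  · simp only [QuadTree.calls]; push_cast; linarith
  · simp only [QuadTree.calls]; push_cast; linarith
  · rw [QuadTree.calls, if_pos h2, Fin.sum_univ_four]
    push_cast
    exact le_of_eq (by ring)
  · rw [QuadTree.calls, if_neg h2]; push_cast; linarith

end PNQ
end

/-! ### Truncation at `τ`: bounds per cell, per level and in total. -/

noncomputable section
namespace PNQ

variable {n : ℕ} {R : ℝ} (D : PolarDensity R) {cap : ℕ} (G : Geometry) (Q : Query)
  (pos : Fin n → PolarPoint)

/-! ### Grid cells and points -/

/-- The probability with which a point is a neighbor, made a total function. -/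
def Query.clipped (p : PolarPoint) : ℝ := Q.f (max (G.dist Q.q p) 0)

/-- The lower bound of the probabilities with which points of a cell are neighbors. -/
def Query.lower (c : Cell) : ℝ := Q.f (cellFar G Q.q c)

variable {G Q pos}

theorem Query.clipped_mem (p : PolarPoint) : Q.clipped G p ∈ Set.Icc (0 : ℝ) 1 :=
  Q.f_mem _ (le_max_right _ _)

theorem Query.clipped_eq {p : PolarPoint} (hp : 0 ≤ p.2) : Q.clipped G p = Q.prob G p := by
  rw [Query.clipped, Query.prob, max_eq_left (G.dist_nonneg Q.radius_nonneg hp)]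

theorem clipped_le_bound {i a b : ℕ} {p : PolarPoint} (hp : p ∈ (D.gridCell i a b).region) :
    Q.clipped G p ≤ Q.bound G (D.gridCell i a b) := by
  rw [Query.clipped_eq (D.radius_nonneg_of_mem hp)]
  exact (prob_mem D hp).2

theorem lower_le_clipped {i a b : ℕ} {p : PolarPoint} (hp : p ∈ (D.gridCell i a b).region) :
    Q.lower G (D.gridCell i a b) ≤ Q.clipped G p := by
  rw [Query.clipped_eq (D.radius_nonneg_of_mem hp)]
  have h := D.le_cellFar G Q.radius_nonneg hp
  have h0 := G.dist_nonneg Q.radius_nonneg (D.radius_nonneg_of_mem hp)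
  exact Q.f_antitone h0 (h0.trans h) h

theorem lower_mem (i a b : ℕ) : Q.lower G (D.gridCell i a b) ∈ Set.Icc (0 : ℝ) 1 :=
  Q.f_mem _ (D.cellFar_nonneg G Q.radius_nonneg i a b)

-- A point lies in at most one cell of a level, so at most one term survives.
open Classical in
theorem gridSum_ite_le {i : ℕ} {p : PolarPoint} {g : ℕ → ℕ → ℝ} {M : ℝ} (hM : 0 ≤ M)
    (h : ∀ a b, p ∈ (D.gridCell i a b).region → g a b ≤ M) :
    gridSum i (fun a b => if p ∈ (D.gridCell i a b).region then g a b else 0) ≤ M := by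
  by_cases hp : ∃ a₀ b₀, p ∈ (D.gridCell i a₀ b₀).region
  · obtain ⟨a₀, b₀, hp⟩ := hp
    calc _ ≤ gridSum i (fun a b => if a = a₀ then (if b = b₀ then M else 0) else 0) := by
          refine gridSum_mono fun a _ b _ => ?_
          by_cases hab : p ∈ (D.gridCell i a b).region
          · obtain ⟨rfl, rfl⟩ := D.gridCell_unique hab hp
            simpa [hab] using h a b hab
          · rw [if_neg hab]; split_ifs <;> simp [hM]
      _ ≤ M := by
          rw [gridSum, Finset.sum_comm]
          simp only [Finset.sum_ite_eq']
          split_ifs <;> (simp [Finset.sum_ite_eq', hM]; try (split_ifs <;> simp [hM]))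
  · have : ∀ a b, p ∉ (D.gridCell i a b).region := fun a b hab => hp ⟨a, b, hab⟩
    simpa [this, gridSum] using hM

open Classical in
theorem gridSum_gridPoints (i : ℕ) (g : ℕ → ℕ → PolarPoint → ℝ) :
    gridSum i (fun a b => ((gridPoints D pos i a b).map fun p => g a b (pos p)).sum)
      = ∑ p, gridSum i fun a b =>
        if pos p ∈ (D.gridCell i a b).region then g a b (pos p) else 0 := by
  have h : ∀ a b, ((gridPoints D pos i a b).map fun p => g a b (pos p)).sum
      = ∑ p, if pos p ∈ (D.gridCell i a b).region then g a b (pos p) else 0 := by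
    intro a b
    rw [gridPoints, sum_pointsIn, ← Fin.sum_univ_def]
  simp only [h, gridSum]
  exact (Finset.sum_congr rfl fun a _ => Finset.sum_comm).trans Finset.sum_comm

open Classical in
variable (G Q) in
/-- The amount by which the bound of the cell of level `i` around a point exceeds the probability
with which the point is a neighbor, where both are truncated at `τ`. -/
def excess (τ : ℝ) (i : ℕ) (p : PolarPoint) : ℝ :=
  gridSum i fun a b => if p ∈ (D.gridCell i a b).region then
    min (Q.bound G (D.gridCell i a b)) τ - min (Q.clipped G p) τ else 0

theorem excess_nonneg (τ : ℝ) (i : ℕ) (p : PolarPoint) : 0 ≤ excess D G Q τ i p := by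
  rw [excess, gridSum]
  refine Finset.sum_nonneg fun a _ => Finset.sum_nonneg fun b _ => ?_
  split_ifs with h
  · exact sub_nonneg.2 (min_le_min_right _ (clipped_le_bound D h))
  · exact le_rfl

theorem excess_le {τ : ℝ} (hτ : 0 ≤ τ) (i : ℕ) (p : PolarPoint) : excess D G Q τ i p ≤ τ := by
  refine gridSum_ite_le D hτ fun a b _ => ?_
  have := le_min (Query.clipped_mem (Q := Q) (G := G) p).1 hτ
  linarith [min_le_right (Q.bound G (D.gridCell i a b)) τ]

theorem gridSum_excess (τ : ℝ) (i : ℕ) :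
    gridSum i (fun a b => ((gridPoints D pos i a b).map fun p =>
      (min (Q.bound G (D.gridCell i a b)) τ - min (Q.clipped G (pos p)) τ)).sum)
      = ∑ p, excess D G Q τ i (pos p) :=
  gridSum_gridPoints D i fun a b p => min (Q.bound G (D.gridCell i a b)) τ - min (Q.clipped G p) τ

/-- Each point contributes its truncated bound, which is its excess plus its truncated probability.
-/
theorem gridSum_min_bound_le (τ : ℝ) (i : ℕ) :
    gridSum i (fun a b => (gridPoints D pos i a b).length *
      min (Q.bound G (D.gridCell i a b)) τ)
      ≤ ∑ p, excess D G Q τ i (pos p) + ∑ p, Q.clipped G (pos p) := by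
  have h1 : gridSum i (fun a b => ((gridPoints D pos i a b).map fun p =>
      min (Q.clipped G (pos p)) τ).sum) ≤ ∑ p, Q.clipped G (pos p) := by
    rw [gridSum_gridPoints D i fun _ _ p => min (Q.clipped G p) τ]
    exact Finset.sum_le_sum fun p _ => gridSum_ite_le D (Query.clipped_mem _).1
      fun _ _ _ => min_le_left _ _
  refine le_trans (le_of_eq ?_) (add_le_add_right h1 _)
  rw [← gridSum_excess, ← gridSum_add]
  congr 1
  funext a b
  rw [← List.sum_map_add]
  simp

/-! ### Bounds for a single cell -/

theorem lower_le_bound {i b : ℕ} (a : ℕ) (hb : b < 2 ^ i) :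
    Q.lower G (D.gridCell i a b) ≤ Q.bound G (D.gridCell i a b) := by
  obtain ⟨p, hp⟩ := D.gridCell_nonempty a hb
  exact (lower_le_clipped D hp).trans (clipped_le_bound D hp)

/-- Since `x = min x τ + max x τ - τ`, the difference `b - f` splits at `τ`. The lower parts form
the excess. The upper parts matter only if `B > τ`; then `|c| * (B - max F τ) = |c| * B * (1 - max F
τ / B)`, where `|c| * B ≤ cap` and `1 - 1 / x ≤ log x`. -/
theorem local_cost_le {τ : ℝ} (hτ : 0 < τ) {i b : ℕ} (a : ℕ) (hb : b < 2 ^ i) :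
    (if (gridPoints D pos i a b).length * Q.bound G (D.gridCell i a b) ≤ cap then
        ((gridPoints D pos i a b).map fun p =>
          2 * (Q.bound G (D.gridCell i a b) - Q.prob G (pos p))).sum else 0)
      ≤ 2 * ((gridPoints D pos i a b).map fun p =>
          (min (Q.bound G (D.gridCell i a b)) τ - min (Q.clipped G (pos p)) τ)).sum
        + 2 * cap * (Real.log (max (Q.bound G (D.gridCell i a b)) τ)
          - Real.log (max (Q.lower G (D.gridCell i a b)) τ)) := by
  have hFB := lower_le_bound D (Q := Q) (G := G) a hb
  have hprob : ∀ p ∈ gridPoints D pos i a b, Q.prob G (pos p) = Q.clipped G (pos p) ∧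
      Q.lower G (D.gridCell i a b) ≤ Q.clipped G (pos p) ∧
      Q.clipped G (pos p) ≤ Q.bound G (D.gridCell i a b) := fun p hp =>
    have hp := (mem_gridPoints D).1 hp
    ⟨(Query.clipped_eq (D.radius_nonneg_of_mem hp)).symm, lower_le_clipped D hp,
      clipped_le_bound D hp⟩
  set l := gridPoints D pos i a b
  set B := Q.bound G (D.gridCell i a b)
  set F := Q.lower G (D.gridCell i a b)
  have hM : 0 < max F τ := lt_max_of_lt_right hτ
  have hlog : Real.log (max F τ) ≤ Real.log (max B τ) :=
    Real.log_le_log hM (max_le_max_right τ hFB)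
  have hmin : 0 ≤ (l.map fun p => (min B τ - min (Q.clipped G (pos p)) τ)).sum := by
    refine List.sum_nonneg fun x hx => ?_
    obtain ⟨p, hp, rfl⟩ := List.mem_map.1 hx
    exact sub_nonneg.2 (min_le_min_right _ (hprob p hp).2.2)
  split_ifs with hcap
  · have h1 : (l.map fun p => 2 * (B - Q.prob G (pos p))).sum
        ≤ (l.map fun p => 2 * (min B τ - min (Q.clipped G (pos p)) τ)
          + 2 * (max B τ - max F τ)).sum := by
      refine sum_map_le_sum_map fun p hp => ?_
      obtain ⟨e, h2, h3⟩ := hprob p hp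
      rw [e]
      have e1 := min_add_max B τ
      have e2 := min_add_max (Q.clipped G (pos p)) τ
      have e3 := max_le_max_right τ h2
      linarith
    have h2 : l.length * (max B τ - max F τ)
        ≤ cap * (Real.log (max B τ) - Real.log (max F τ)) := by
      rcases le_total B τ with hB | hB
      · rw [max_eq_right hB, max_eq_right (hFB.trans hB)]; simp
      · have hBpos : 0 < B := hτ.trans_le hB
        rw [max_eq_left hB, ← Real.log_div hBpos.ne' hM.ne']
        have h4 := Real.one_sub_inv_le_log_of_pos (div_pos hBpos hM)
        rw [inv_div] at h4
        have hFB' : max F τ ≤ B := max_le hFB hB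
        have h5 : (0 : ℝ) ≤ 1 - max F τ / B := sub_nonneg.2 ((div_le_one hBpos).2 hFB')
        calc l.length * (B - max F τ) = (l.length * B) * (1 - max F τ / B) := by field_simp
          _ ≤ cap * (1 - max F τ / B) := mul_le_mul_of_nonneg_right hcap h5
          _ ≤ _ := mul_le_mul_of_nonneg_left h4 (Nat.cast_nonneg _)
    simp only [List.sum_map_add, List.sum_map_mul_left, List.map_const', List.sum_replicate,
      nsmul_eq_mul] at h1 ⊢
    linarith
  · have : (0 : ℝ) ≤ cap := Nat.cast_nonneg _
    have := mul_nonneg (mul_nonneg zero_le_two this) (sub_nonneg.2 hlog)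
    linarith

/-- If the bound is below `τ`, truncation does not change it, and `|c| * b ≥ 1` pays for the four
calls. -/
theorem local_calls_le {τ : ℝ} (hτ : 0 ≤ τ) (i a b : ℕ) :
    (if 1 ≤ (gridPoints D pos i a b).length * Q.bound G (D.gridCell i a b) then (4 : ℝ) else 0)
      ≤ 4 * (if τ ≤ Q.bound G (D.gridCell i a b) then 1 else 0)
        + 4 * ((gridPoints D pos i a b).length * min (Q.bound G (D.gridCell i a b)) τ) := by
  have hB := (bound_mem D (Q := Q) (G := G) i a b).1
  have hnn : 0 ≤ 4 * ((gridPoints D pos i a b).length * min (Q.bound G (D.gridCell i a b)) τ) := by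
    positivity
  split_ifs with h1 h2 h2
  · linarith
  · rw [min_eq_left (not_le.1 h2).le]; linarith
  · linarith
  · linarith

/-! ### Bounds for a level -/

/-- The oscillation bound for `log (max f τ) - log τ`, whose range has length `-log τ`, linear in `m
- i` for the `τ` used later. -/
theorem gridSum_log_le {τ : ℝ} (hτ : 0 < τ) (hτ1 : τ ≤ 1) (i : ℕ) :
    gridSum i (fun a b => Real.log (max (Q.bound G (D.gridCell i a b)) τ)
          - Real.log (max (Q.lower G (D.gridCell i a b)) τ)) ≤ 7 * (2 ^ i * -Real.log τ) := by
  have hpos : ∀ x : ℝ, 0 < max x τ := fun x => lt_max_of_lt_right hτ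
  have h := D.sum_cell_oscillation_le G Q.radius_nonneg (H := -Real.log τ)
    (h := fun d => Real.log (max (Q.f d) τ) - Real.log τ)
    (fun x hx y hy hxy => sub_le_sub_right (Real.log_le_log (hpos _)
      (max_le_max_right τ (Q.f_antitone hx hy hxy))) _)
    (fun d _ => sub_nonneg.2 (Real.log_le_log hτ (le_max_right _ _)))
    (fun d hd => by
      have : Real.log (max (Q.f d) τ) ≤ 0 :=
        Real.log_nonpos (hpos _).le (max_le (Q.f_mem d hd).2 hτ1)
      linarith) i
  simp only [sub_sub_sub_cancel_right] at h
  exact h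

theorem gridSum_min_sub_le {τ : ℝ} (hτ : 0 ≤ τ) (i : ℕ) :
    gridSum i (fun a b => min (Q.bound G (D.gridCell i a b)) τ
          - min (Q.lower G (D.gridCell i a b)) τ) ≤ 7 * (2 ^ i * τ) :=
  D.sum_cell_oscillation_le G Q.radius_nonneg (h := fun d => min (Q.f d) τ)
    (fun _ hx _ hy hxy => min_le_min_right τ (Q.f_antitone hx hy hxy))
    (fun d hd => le_min (Q.f_mem d hd).1 hτ) (fun _ _ => min_le_right _ _) i

/-- The indicator of `τ ≤ f` is decreasing in the distance, so few cells meet the threshold with the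
upper bound but not with the lower one. Cells whose lower bound reaches `τ` are counted by Markov.
-/
theorem gridSum_indicator_le {τ : ℝ} (hτ : 0 < τ) (i : ℕ) :
    gridSum i (fun a b => if τ ≤ Q.bound G (D.gridCell i a b) then 1 else 0)
      ≤ 7 * 2 ^ i + τ⁻¹ * gridSum i fun a b => Q.lower G (D.gridCell i a b) := by
  have h := D.sum_cell_oscillation_le G Q.radius_nonneg (H := 1)
    (h := fun d => if τ ≤ Q.f d then 1 else 0)
    (fun x hx y hy hxy => by
      have := Q.f_antitone hx hy hxy
      by_cases h1 : τ ≤ Q.f y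
      · simp [h1, h1.trans this]
      · simp only [h1, if_false]; split_ifs <;> norm_num)
    (fun d _ => by split_ifs <;> norm_num)
    (fun d _ => by split_ifs <;> norm_num) i
  rw [mul_one] at h
  refine le_trans ?_ (add_le_add_left h _)
  rw [← gridSum_mul_left]
  change _ ≤ gridSum i _ + _
  rw [← gridSum_add]
  refine gridSum_mono fun a _ b _ => ?_
  have hF := (lower_mem D (Q := Q) (G := G) i a b).1
  change _ ≤ (if τ ≤ Q.bound G (D.gridCell i a b) then (1 : ℝ) else 0)
    - (if τ ≤ Q.lower G (D.gridCell i a b) then 1 else 0) + _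
  have : (if τ ≤ Q.lower G (D.gridCell i a b) then (1 : ℝ) else 0)
      ≤ τ⁻¹ * Q.lower G (D.gridCell i a b) := by
    split_ifs with h
    · rw [inv_mul_eq_div, one_le_div hτ]; exact h
    · positivity
  linarith

/-! ### Totals -/

theorem sum_two_pow_mul_le (m : ℕ) :
    ∑ i ∈ Finset.range m, (2 : ℝ) ^ i * ((m - i : ℕ) : ℝ) ≤ 2 * 2 ^ m := by
  -- The exact value `2 * 2 ^ m - m - 2` makes the induction go through.
  have h : ∑ i ∈ Finset.range m, (2 : ℝ) ^ i * ((m - i : ℕ) : ℝ) + m + 2 = 2 * 2 ^ m := by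
    induction m with
    | zero => norm_num
    | succ m ih =>
      have e : ∀ i ∈ Finset.range m, (2 : ℝ) ^ i * ((m + 1 - i : ℕ) : ℝ)
          = 2 ^ i * ((m - i : ℕ) : ℝ) + 2 ^ i := by
        intro i hi
        rw [Nat.succ_sub (Finset.mem_range.1 hi).le]
        push_cast; ring
      have g := geom_sum_eq (by norm_num : (2 : ℝ) ≠ 1) m
      rw [Finset.sum_range_succ, Finset.sum_congr rfl e, Finset.sum_add_distrib, g]
      simp only [Nat.add_sub_cancel_left]
      push_cast
      rw [pow_succ]
      linarith
  have : (0 : ℝ) ≤ m := Nat.cast_nonneg m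
  linarith

variable (G Q) in
/-- The excess of a point summed over the first `m` levels, truncated at the inverse of the expected
number of points in a cell. -/
def totalExcess (m : ℕ) (p : PolarPoint) : ℝ :=
  ∑ i ∈ Finset.range (m + 1), excess D G Q ((1 / 4) ^ (m - i)) i p

theorem sum_totalExcess (m : ℕ) :
    ∑ p, totalExcess D G Q m (pos p) = ∑ i ∈ Finset.range m,
      ∑ p, excess D G Q ((1 / 4) ^ (m - i)) i (pos p) + ∑ p, excess D G Q 1 m (pos p) := by
  simp only [totalExcess]
  rw [Finset.sum_comm, Finset.sum_range_succ]
  simp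

/-- Above level `m` the local bounds are summed with `τ = (1 / 4) ^ (m - i)`. On level `m` every
subtree is treated as one virtual leaf, which costs no less; this is the excess with `τ = 1`. -/
theorem cost_root_le (hcap : 1 ≤ cap) {L m : ℕ} (hm : m ≤ L) :
    (gridTree D cap pos L 0 0 0).cost G Q pos (fun b f => 2 * (b - f))
      ≤ 2 * ∑ p, totalExcess D G Q m (pos p) + 84 * cap * 2 ^ m := by
  have main := le_gridSum_levels (m := m)
    (V := fun i a b => (gridTree D cap pos L i a b).cost G Q pos fun b f => 2 * (b - f))
    fun i hi a _ b hb => cost_gridTree_le D (cap := cap) (pos := pos) (G := G) (Q := Q) hcap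
      (κ := fun b f => 2 * (b - f)) (fun b f _ h => by linarith) (hi.trans_le hm) (a := a) hb
  refine main.trans ?_
  have hlev : ∀ i ∈ Finset.range m, gridSum i (fun a b =>
      if (gridPoints D pos i a b).length * Q.bound G (D.gridCell i a b) ≤ cap then
        ((gridPoints D pos i a b).map fun p =>
          2 * (Q.bound G (D.gridCell i a b) - Q.prob G (pos p))).sum else 0)
      ≤ 2 * ∑ p, excess D G Q ((1 / 4) ^ (m - i)) i (pos p)
        + 42 * cap * (2 ^ i * ((m - i : ℕ) : ℝ)) := by
    intro i _
    have hτ : (0 : ℝ) < (1 / 4) ^ (m - i) := by positivity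
    have hτ1 : ((1 : ℝ) / 4) ^ (m - i) ≤ 1 := pow_le_one₀ (by norm_num) (by norm_num)
    have h1 := gridSum_mono (i := i) fun a _ b hb =>
      local_cost_le D (cap := cap) (pos := pos) (G := G) (Q := Q) hτ a hb
    rw [gridSum_add, gridSum_mul_left, gridSum_mul_left, gridSum_excess] at h1
    have h2 := gridSum_log_le D (G := G) (Q := Q) hτ hτ1 i
    -- Uses `log 4 ≤ 3`; then `2 * cap * 7 * 3 = 42 * cap`, doubled by the sum over the levels.
    have h3 : -Real.log ((1 / 4 : ℝ) ^ (m - i)) ≤ 3 * ((m - i : ℕ) : ℝ) := by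
      rw [Real.log_pow, one_div, Real.log_inv]
      have := Real.log_le_sub_one_of_pos (by norm_num : (0 : ℝ) < 4)
      have h0 : (0 : ℝ) ≤ ((m - i : ℕ) : ℝ) := Nat.cast_nonneg _
      nlinarith
    have h4 : (0 : ℝ) ≤ 2 * cap := by positivity
    have h5 : (0 : ℝ) ≤ 2 ^ i := by positivity
    have h6 := mul_le_mul_of_nonneg_left (h2.trans (mul_le_mul_of_nonneg_left
      (mul_le_mul_of_nonneg_left h3 h5) (by norm_num))) h4
    refine h1.trans ?_
    linarith
  have hlast : gridSum m (fun a b => (gridTree D cap pos L m a b).cost G Q pos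
      fun b f => 2 * (b - f)) ≤ 2 * ∑ p, excess D G Q 1 m (pos p) := by
    rw [← gridSum_excess, ← gridSum_mul_left]
    refine gridSum_mono fun a _ b hb => ?_
    refine (cost_build_le D (fun b b' f h => by linarith) hb
      fun _ hp => (mem_gridPoints D).1 hp).trans ?_
    rw [← List.sum_map_mul_left]
    refine sum_map_le_sum_map fun p hp => ?_
    have hp := (mem_gridPoints D).1 hp
    rw [min_eq_left (bound_mem D m a b).2, min_eq_left (Query.clipped_mem _).2,
      Query.clipped_eq (D.radius_nonneg_of_mem hp)]
  have hsum := Finset.sum_le_sum hlev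
  rw [Finset.sum_add_distrib, ← Finset.mul_sum, ← Finset.mul_sum] at hsum
  have h2m := mul_le_mul_of_nonneg_left (sum_two_pow_mul_le m) (by positivity : (0 : ℝ) ≤ 42 * cap)
  rw [sum_totalExcess]
  linarith

/-- `μ` stands for the mean neighbor probability. Above level `m` each level is charged by
`local_calls_le`; the remaining `L - m` levels are charged by `calls_build_le`. -/
theorem calls_root_le {L m : ℕ} (hm : m ≤ L) {μ : ℝ}
    (hμ : ∀ i, gridSum i (fun a b => Q.lower G (D.gridCell i a b)) ≤ 4 ^ i * μ) :
    ((gridTree D cap pos L 0 0 0).calls G Q : ℝ) ≤ 1 + 28 * 2 ^ m + 4 * m * (4 ^ m * μ)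
      + 4 * L * (∑ p, totalExcess D G Q m (pos p) + ∑ p, Q.clipped G (pos p)) := by
  have main := le_gridSum_levels (m := m)
    (V := fun i a b => ((gridTree D cap pos L i a b).calls G Q : ℝ) - 1) fun i hi a _ b hb =>
    calls_gridTree_le D (cap := cap) (pos := pos) (G := G) (Q := Q) (hi.trans_le hm) (a := a) hb
  set S := ∑ p, totalExcess D G Q m (pos p) with hS
  set M := ∑ p, Q.clipped G (pos p)
  have hex : ∀ i ≤ m, ∑ p, excess D G Q ((1 / 4) ^ (m - i)) i (pos p) ≤ S := by
    intro i hi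
    refine Finset.sum_le_sum fun p _ => ?_
    exact Finset.single_le_sum (f := fun i => excess D G Q ((1 / 4) ^ (m - i)) i (pos p))
      (fun i _ => excess_nonneg D _ i _) (Finset.mem_range.2 (Nat.lt_succ_of_le hi))
  have hlev : ∀ i ∈ Finset.range m, gridSum i (fun a b =>
      if 1 ≤ (gridPoints D pos i a b).length * Q.bound G (D.gridCell i a b) then (4 : ℝ) else 0)
      ≤ 28 * 2 ^ i + (4 * (4 ^ m * μ) + 4 * (S + M)) := by
    intro i hi
    have hi := (Finset.mem_range.1 hi).le
    have hτ : (0 : ℝ) < (1 / 4) ^ (m - i) := by positivity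
    have h1 := gridSum_mono (i := i) fun a _ b _ =>
      local_calls_le D (pos := pos) (G := G) (Q := Q) hτ.le i a b
    rw [gridSum_add, gridSum_mul_left, gridSum_mul_left] at h1
    have h2 := gridSum_indicator_le D (G := G) (Q := Q) hτ i
    have h3 := gridSum_min_bound_le D (pos := pos) (G := G) (Q := Q) ((1 / 4) ^ (m - i)) i
    have h4 := mul_le_mul_of_nonneg_left (hμ i) (inv_pos.2 hτ).le
    -- With this choice of `τ`, Markov's bound is the same on every level.
    have h5 : ((1 / 4 : ℝ) ^ (m - i))⁻¹ * (4 ^ i * μ) = 4 ^ m * μ := by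
      rw [one_div, inv_pow, inv_inv, ← mul_assoc, ← pow_add, Nat.sub_add_cancel hi]
    have h6 := hex i hi
    linarith
  have hlast : gridSum m (fun a b => ((gridTree D cap pos L m a b).calls G Q : ℝ) - 1)
      ≤ 4 * (L - m : ℕ) * (S + M) := by
    have h3 := gridSum_min_bound_le D (pos := pos) (G := G) (Q := Q) 1 m
    have h6 := hex m le_rfl
    rw [Nat.sub_self, pow_zero] at h6
    refine le_trans ?_ (mul_le_mul_of_nonneg_left (h3.trans (by linarith))
      (by positivity : (0 : ℝ) ≤ 4 * (L - m : ℕ)))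
    rw [← gridSum_mul_left]
    refine gridSum_mono fun a _ b hb => ?_
    rw [min_eq_left (bound_mem D m a b).2]
    have := calls_build_le D (cap := cap) (G := G) (Q := Q) (d := L - m) (a := a) hb
      (l := gridPoints D pos m a b) fun _ hp => (mem_gridPoints D).1 hp
    rw [gridTree]
    linarith
  have hsum := Finset.sum_le_sum hlev
  rw [Finset.sum_add_distrib, ← Finset.mul_sum, geom_sum_eq (by norm_num : (2 : ℝ) ≠ 1),
    Finset.sum_const, Finset.card_range, nsmul_eq_mul] at hsum
  rw [Nat.cast_sub hm] at hlast
  linarith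

end PNQ
end

/-! ### Averages and concentration over the random points. -/

noncomputable section
namespace PNQ

variable {n : ℕ} {R : ℝ} (D : PolarDensity R) {G : Geometry} {Q : Query}

/-! ### Measurability -/

theorem Geometry.measurable_dist (G : Geometry) (q : PolarPoint) : Measurable (G.dist q) := by
  cases G
  · change Measurable fun p : PolarPoint => Real.sqrt (q.2 ^ 2 + p.2 ^ 2
      - 2 * q.2 * p.2 * Real.cos (q.1 - p.1))
    fun_prop
  · change Measurable fun p : PolarPoint => Real.arcosh (Real.cosh q.2 * Real.cosh p.2
      - Real.sinh q.2 * Real.sinh p.2 * Real.cos (q.1 - p.1))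
    simp only [Real.arcosh]
    fun_prop

/-- `f` may be discontinuous; clipping the argument makes it antitone on all of `ℝ`, hence
measurable. -/
theorem Query.measurable_clipped : Measurable (Q.clipped G) := by
  have h : Antitone fun d => Q.f (max d 0) := fun x y hxy =>
    Q.f_antitone (Set.mem_Ici.2 (le_max_right _ _)) (Set.mem_Ici.2 (le_max_right _ _)) (max_le_max_right 0 hxy)
  exact h.measurable.comp (G.measurable_dist Q.q)

theorem measurable_excess (τ : ℝ) (i : ℕ) : Measurable (excess D G Q τ i) := by
  unfold excess gridSum
  refine Finset.measurable_fun_sum _ fun a _ => Finset.measurable_fun_sum _ fun b _ => ?_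
  exact Measurable.ite (measurableSet_region _)
    (measurable_const.sub (Query.measurable_clipped.min measurable_const)) measurable_const

theorem measurable_totalExcess (m : ℕ) : Measurable (totalExcess D G Q m) :=
  Finset.measurable_fun_sum _ fun i _ => measurable_excess D _ i

/-! ### Expectations of the excess -/

theorem sum_pow_sub_le {x : ℝ} (hx : 0 ≤ x) (hx2 : x ≤ 1 / 2) (m : ℕ) :
    ∑ i ∈ Finset.range (m + 1), x ^ (m - i) ≤ 2 := by
  rw [← Finset.sum_range_reflect]
  have e : ∀ i ∈ Finset.range (m + 1), x ^ (m - (m + 1 - 1 - i)) = x ^ i := by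
    intro i hi
    have := Finset.mem_range.1 hi
    congr 1; omega
  rw [Finset.sum_congr rfl e]
  calc ∑ i ∈ Finset.range (m + 1), x ^ i ≤ ∑ i ∈ Finset.range (m + 1), (1 / 2 : ℝ) ^ i :=
        Finset.sum_le_sum fun i _ => pow_le_pow_left₀ hx hx2 i
    _ ≤ 2 := sum_geometric_two_le _

theorem totalExcess_nonneg (m : ℕ) (p : PolarPoint) : 0 ≤ totalExcess D G Q m p :=
  Finset.sum_nonneg fun i _ => excess_nonneg D _ i p

/-- The truncations decay geometrically upwards from level `m`. Being bounded by a constant, the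
total excess has exponential moments that depend only on its mean. -/
theorem totalExcess_le (m : ℕ) (p : PolarPoint) : totalExcess D G Q m p ≤ 2 :=
  (Finset.sum_le_sum fun i _ => excess_le D (by positivity) i p).trans
    (sum_pow_sub_le (by norm_num) (by norm_num) m)

theorem integrable_of_bounded {X : PolarPoint → ℝ} (hX : Measurable X) {C : ℝ}
    (h0 : ∀ p, 0 ≤ X p) (hC : ∀ p, X p ≤ C) : Integrable X D.law :=
  Integrable.of_bound hX.aestronglyMeasurable C (Filter.Eventually.of_forall fun p => by
    rw [Real.norm_eq_abs, abs_of_nonneg (h0 p)]; exact hC p)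

open Classical in
theorem integral_gridSum (i : ℕ) (g : ℕ → ℕ → ℝ) :
    Integrable (fun p => gridSum i fun a b =>
      if p ∈ (D.gridCell i a b).region then g a b else 0) D.law ∧
    ∫ p, gridSum i (fun a b => if p ∈ (D.gridCell i a b).region then g a b else 0) ∂D.law
      = (1 / 4) ^ i * gridSum i g := by
  have hind : ∀ a b, (fun p => if p ∈ (D.gridCell i a b).region then g a b else 0)
      = (D.gridCell i a b).region.indicator fun _ => g a b := fun a b => by
    funext p; simp [Set.indicator_apply]
  have hint : ∀ a b, Integrable (fun p => if p ∈ (D.gridCell i a b).region then g a b else 0)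
      D.law := fun a b => by
    rw [hind]; exact (integrable_const _).indicator (measurableSet_region _)
  have hint' : ∀ a, Integrable (fun p => ∑ b ∈ Finset.range (2 ^ i),
      if p ∈ (D.gridCell i a b).region then g a b else 0) D.law := fun a =>
    integrable_finsetSum _ fun b _ => hint a b
  refine ⟨integrable_finsetSum _ fun a _ => hint' a, ?_⟩
  simp only [gridSum]
  rw [integral_finsetSum _ fun a _ => hint' a, Finset.mul_sum]
  refine Finset.sum_congr rfl fun a ha => ?_
  rw [integral_finsetSum _ fun b _ => hint a b, Finset.mul_sum]
  refine Finset.sum_congr rfl fun b hb => ?_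
  rw [hind, integral_indicator_const _ (measurableSet_region _), Measure.real,
    D.law_gridCell (Finset.mem_range.1 ha) (Finset.mem_range.1 hb),
    ENNReal.toReal_ofReal (by positivity), smul_eq_mul]

/-- Replacing the probability of the point by the lower bound of its cell leaves the oscillation
sum, at most `7 * 2 ^ i * τ`, times the mass `4 ^ (-i)` of a cell. -/
theorem integral_excess_le {τ : ℝ} (hτ : 0 ≤ τ) (i : ℕ) :
    ∫ p, excess D G Q τ i p ∂D.law ≤ 7 * ((1 / 2) ^ i * τ) := by
  classical
  obtain ⟨h1, h2⟩ := integral_gridSum D i fun a b =>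
    min (Q.bound G (D.gridCell i a b)) τ - min (Q.lower G (D.gridCell i a b)) τ
  have h3 := integral_mono (integrable_of_bounded D (measurable_excess D τ i)
    (excess_nonneg D (G := G) (Q := Q) τ i) (excess_le D hτ i)) h1 fun p => by
      refine gridSum_mono fun a _ b _ => ?_
      split_ifs with hp
      · exact sub_le_sub_left (min_le_min_right _ (lower_le_clipped D hp)) _
      · exact le_rfl
  rw [h2] at h3
  refine h3.trans ((mul_le_mul_of_nonneg_left (gridSum_min_sub_le D hτ i) (by positivity)).trans
    (le_of_eq ?_))
  have e : (1 / 4 : ℝ) ^ i * 2 ^ i = (1 / 2) ^ i := by rw [← mul_pow]; norm_num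
  rw [← e]; ring

theorem integral_totalExcess_le (m : ℕ) :
    ∫ p, totalExcess D G Q m p ∂D.law ≤ 14 * (1 / 2) ^ m := by
  simp only [totalExcess]
  rw [integral_finsetSum _ fun i _ => integrable_of_bounded D (measurable_excess D _ i)
    (excess_nonneg D (G := G) (Q := Q) _ i) (excess_le D (by positivity) i)]
  -- `2 ^ (-i) * 4 ^ (-(m - i)) = 2 ^ (-m) * 2 ^ (-(m - i))`: a geometric series dominated by level
  -- `m`.
  have h : ∀ i ∈ Finset.range (m + 1), ∫ p, excess D G Q ((1 / 4) ^ (m - i)) i p ∂D.law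
      ≤ 7 * (1 / 2) ^ m * (1 / 2) ^ (m - i) := by
    intro i hi
    refine (integral_excess_le D (by positivity) i).trans (le_of_eq ?_)
    have e1 : (1 / 4 : ℝ) ^ (m - i) = (1 / 2) ^ (m - i) * (1 / 2) ^ (m - i) := by
      rw [← mul_pow]; norm_num
    have e2 : (1 / 2 : ℝ) ^ m = (1 / 2) ^ i * (1 / 2) ^ (m - i) := by
      rw [← pow_add, Nat.add_sub_cancel' (Nat.lt_succ_iff.1 (Finset.mem_range.1 hi))]
    rw [e1, e2]; ring
  refine (Finset.sum_le_sum h).trans ?_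
  rw [← Finset.mul_sum]
  have := mul_le_mul_of_nonneg_left (sum_pow_sub_le (by norm_num : (0 : ℝ) ≤ 1 / 2) le_rfl m)
    (by positivity : (0 : ℝ) ≤ 7 * (1 / 2) ^ m)
  linarith

theorem gridSum_lower_le (i : ℕ) : gridSum i (fun a b => Q.lower G (D.gridCell i a b))
    ≤ 4 ^ i * ∫ p, Q.clipped G p ∂D.law := by
  classical
  obtain ⟨h1, h2⟩ := integral_gridSum D i fun a b => Q.lower G (D.gridCell i a b)
  have h3 := integral_mono h1 (integrable_of_bounded D (Query.measurable_clipped (G := G) (Q := Q))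
    (fun p => (Query.clipped_mem p).1) (fun p => (Query.clipped_mem p).2)) fun p =>
      gridSum_ite_le D (Query.clipped_mem p).1 fun a b hp => lower_le_clipped D hp
  rw [h2] at h3
  have e : (4 : ℝ) ^ i * (1 / 4) ^ i = 1 := by rw [← mul_pow]; norm_num
  have := mul_le_mul_of_nonneg_left h3 (by positivity : (0 : ℝ) ≤ 4 ^ i)
  rwa [← mul_assoc, e, one_mul] at this

/-! ### Exponential moments -/

theorem exp_le_one_add_two_mul {x : ℝ} (h0 : 0 ≤ x) (h1 : x ≤ 1) : Real.exp x ≤ 1 + 2 * x := by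
  have h := convexOn_exp.2 (Set.mem_univ 1) (Set.mem_univ 0) h0 (sub_nonneg.2 h1) (by ring)
  simp only [smul_eq_mul, mul_one, mul_zero, add_zero, Real.exp_zero] at h
  nlinarith [Real.exp_one_lt_d9]

theorem exp_neg_one_le_half : Real.exp (-1) ≤ 1 / 2 := by
  rw [Real.exp_neg, one_div]
  exact inv_anti₀ two_pos (by linarith [Real.add_one_le_exp 1])

theorem exp_neg_le_one_sub_half {x : ℝ} (h0 : 0 ≤ x) (h1 : x ≤ 1) :
    Real.exp (-x) ≤ 1 - x / 2 := by
  have h := convexOn_exp.2 (Set.mem_univ (-1)) (Set.mem_univ 0) h0 (sub_nonneg.2 h1) (by ring)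
  simp only [smul_eq_mul, mul_neg, mul_one, mul_zero, add_zero, Real.exp_zero] at h
  nlinarith [exp_neg_one_le_half]

/-- A linear bound on the exponential reduces the moment to the mean. Positive `k` serves upper
tails, negative `k` lower tails. -/
theorem lintegral_exp_le {X Z : PolarPoint → ℝ} {k : ℝ} (hX : Measurable X) (h0 : ∀ p, 0 ≤ X p)
    (h1 : ∀ p, X p ≤ 1) (hZ : ∀ p, Real.exp (Z p) ≤ 1 + k * X p) :
    ∫⁻ p, ENNReal.ofReal (Real.exp (Z p)) ∂D.law
      ≤ ENNReal.ofReal (Real.exp (k * ∫ p, X p ∂D.law)) := by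
  have hint := integrable_of_bounded D hX h0 h1
  have hint' : Integrable (fun p => 1 + k * X p) D.law :=
    (integrable_const 1).add (hint.const_mul k)
  calc ∫⁻ p, ENNReal.ofReal (Real.exp (Z p)) ∂D.law
      ≤ ∫⁻ p, ENNReal.ofReal (1 + k * X p) ∂D.law :=
        lintegral_mono fun p => ENNReal.ofReal_le_ofReal (hZ p)
    _ = ENNReal.ofReal (1 + k * ∫ p, X p ∂D.law) := by
        rw [← ofReal_integral_eq_lintegral_ofReal hint'
          (Filter.Eventually.of_forall fun p => (Real.exp_nonneg _).trans (hZ p)),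
          integral_add (integrable_const 1) (hint.const_mul k), integral_const_mul]
        simp
    _ ≤ _ := ENNReal.ofReal_le_ofReal (by rw [add_comm]; exact Real.add_one_le_exp _)

/-- The Chernoff bound for a function of independent points. -/
theorem measure_le_sum_le {Z : PolarPoint → ℝ} (hZ : Measurable Z) {c : ℝ}
    (hc : ∫⁻ p, ENNReal.ofReal (Real.exp (Z p)) ∂D.law ≤ ENNReal.ofReal (Real.exp c)) (s : ℝ) :
    Measure.pi (fun _ : Fin n => D.law) {pos | n * c + s ≤ ∑ p, Z (pos p)}
      ≤ ENNReal.ofReal (Real.exp (-s)) := by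
  have hm : Measurable fun p => ENNReal.ofReal (Real.exp (Z p)) := hZ.exp.ennreal_ofReal
  have hind := ProbabilityTheory.iIndepFun_pi (μ := fun _ : Fin n => D.law)
    (X := fun _ p => ENNReal.ofReal (Real.exp (Z p))) fun _ => hm.aemeasurable
  have hprod : ∫⁻ pos, ∏ p, ENNReal.ofReal (Real.exp (Z (pos p)))
      ∂(Measure.pi fun _ : Fin n => D.law) ≤ ENNReal.ofReal (Real.exp (n * c)) := by
    rw [ProbabilityTheory.lintegral_prod_eq_prod_lintegral_of_indepFun Finset.univ
      (fun (p : Fin n) (pos : Fin n → PolarPoint) => ENNReal.ofReal (Real.exp (Z (pos p)))) hind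
      fun p => hm.comp (measurable_pi_apply p)]
    have e : ∀ p : Fin n, ∫⁻ pos, ENNReal.ofReal (Real.exp (Z (pos p)))
        ∂(Measure.pi fun _ : Fin n => D.law) = ∫⁻ p, ENNReal.ofReal (Real.exp (Z p)) ∂D.law :=
      fun p => (measurePreserving_eval (fun _ : Fin n => D.law) p).lintegral_comp hm
    simp only [e, Finset.prod_const, Finset.card_univ, Fintype.card_fin]
    rw [Real.exp_nat_mul, ENNReal.ofReal_pow (Real.exp_nonneg _)]
    exact pow_le_pow_left' hc n
  have hmarkov := mul_meas_ge_le_lintegral (μ := Measure.pi fun _ : Fin n => D.law)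
    (f := fun pos => ∏ p, ENNReal.ofReal (Real.exp (Z (pos p))))
    (Finset.measurable_fun_prod _ fun p _ => hm.comp (measurable_pi_apply p))
    (ENNReal.ofReal (Real.exp (n * c + s)))
  have hset : {pos : Fin n → PolarPoint | n * c + s ≤ ∑ p, Z (pos p)}
      ⊆ {pos | ENNReal.ofReal (Real.exp (n * c + s))
        ≤ ∏ p, ENNReal.ofReal (Real.exp (Z (pos p)))} := by
    intro pos hpos
    rw [Set.mem_ofPred_eq, ← ENNReal.ofReal_prod_of_nonneg fun _ _ => Real.exp_nonneg _,
      ← Real.exp_sum]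
    exact ENNReal.ofReal_le_ofReal (Real.exp_le_exp.2 hpos)
  have hpos : ENNReal.ofReal (Real.exp (n * c + s)) ≠ 0 := by
    simpa using Real.exp_pos (n * c + s)
  refine (measure_mono hset).trans ?_
  have h := hmarkov.trans hprod
  rw [mul_comm, ← ENNReal.le_div_iff_mul_le (Or.inl hpos) (Or.inl ENNReal.ofReal_ne_top),
    ← ENNReal.ofReal_div_of_pos (Real.exp_pos _), ← Real.exp_sub] at h
  refine h.trans (le_of_eq ?_)
  congr 2; ring

/-- The total excess is halved to lie in `[0, 1]`; the factor `2` outside undoes this. -/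
theorem measure_totalExcess_le (m : ℕ) (s : ℝ) :
    Measure.pi (fun _ : Fin n => D.law)
      {pos | 2 * (n * (14 * (1 / 2) ^ m) + s) ≤ ∑ p, totalExcess D G Q m (pos p)}
      ≤ ENNReal.ofReal (Real.exp (-s)) := by
  have h0 := totalExcess_nonneg D (G := G) (Q := Q) m
  have h2 := totalExcess_le D (G := G) (Q := Q) m
  have hm : Measurable fun p => totalExcess D G Q m p / 2 :=
    (measurable_totalExcess D m).div_const 2
  refine (measure_mono fun pos hpos => ?_).trans (measure_le_sum_le D hm
    (lintegral_exp_le D (k := 2) hm (fun p => by linarith [h0 p]) (fun p => by linarith [h2 p])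
      fun p => exp_le_one_add_two_mul (by linarith [h0 p]) (by linarith [h2 p])) s)
  have hi := integral_totalExcess_le D (G := G) (Q := Q) m
  have hn : (0 : ℝ) ≤ n := Nat.cast_nonneg n
  have := mul_le_mul_of_nonneg_left hi hn
  rw [Set.mem_ofPred_eq] at hpos ⊢
  rw [integral_div, ← Finset.sum_div]
  linarith

theorem measure_clipped_le (s : ℝ) :
    Measure.pi (fun _ : Fin n => D.law)
      {pos | ∑ p, Q.clipped G (pos p) ≤ n * (∫ p, Q.clipped G p ∂D.law) / 2 - s}
      ≤ ENNReal.ofReal (Real.exp (-s)) := by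
  have h0 := fun p => (Query.clipped_mem (Q := Q) (G := G) p).1
  have h1 := fun p => (Query.clipped_mem (Q := Q) (G := G) p).2
  refine (measure_mono fun pos hpos => ?_).trans (measure_le_sum_le D
    (Query.measurable_clipped (G := G) (Q := Q)).neg
    (lintegral_exp_le D (k := -1 / 2) Query.measurable_clipped h0 h1
      fun p => (exp_neg_le_one_sub_half (h0 p) (h1 p)).trans (by linarith)) s)
  rw [Set.mem_ofPred_eq] at hpos ⊢
  simp only [Pi.neg_apply, Finset.sum_neg_distrib]
  linarith

/-! ### Positions of the points -/

theorem measure_outside_root :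
    Measure.pi (fun _ : Fin n => D.law) {pos | ∃ p, pos p ∉ (rootCell R).region} = 0 := by
  rw [Set.ofPred_exists, measure_iUnion_null_iff]
  intro p
  have := (measurePreserving_eval (fun _ : Fin n => D.law) p).measure_preimage
    (measurableSet_region (rootCell R)).compl.nullMeasurableSet
  rw [D.law_compl_root] at this
  exact this

/-- The probability that two points lie in a common cell of level `L`. -/
theorem measure_not_separated_le (L : ℕ) :
    Measure.pi (fun _ : Fin n => D.law) {pos | ∃ x y, x ≠ y ∧ ∃ a < 2 ^ L, ∃ b < 2 ^ L,
      pos x ∈ (D.gridCell L a b).region ∧ pos y ∈ (D.gridCell L a b).region}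
      ≤ ENNReal.ofReal (n ^ 2 * (1 / 4) ^ L) := by
  classical
  have hpair : ∀ (x y : Fin n) (a b : ℕ), x ≠ y → a < 2 ^ L → b < 2 ^ L →
      Measure.pi (fun _ : Fin n => D.law) {pos | pos x ∈ (D.gridCell L a b).region ∧
        pos y ∈ (D.gridCell L a b).region} ≤ ENNReal.ofReal ((1 / 4) ^ L * (1 / 4) ^ L) := by
    intro x y a b hxy ha hb
    have h := Measure.pi_pi_finset (μ := fun _ : Fin n => D.law)
      (fun _ => (D.gridCell L a b).region) {x, y}
    rw [Finset.prod_pair hxy, D.law_gridCell ha hb, ← ENNReal.ofReal_mul (by positivity)] at h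
    rw [← h]
    exact measure_mono fun pos hpos => by simpa [Set.mem_pi] using hpos
  have hsub : {pos : Fin n → PolarPoint | ∃ x y, x ≠ y ∧ ∃ a < 2 ^ L, ∃ b < 2 ^ L,
      pos x ∈ (D.gridCell L a b).region ∧ pos y ∈ (D.gridCell L a b).region}
      ⊆ ⋃ z ∈ (Finset.univ ×ˢ Finset.univ).filter (fun z : Fin n × Fin n => z.1 ≠ z.2),
        ⋃ c ∈ Finset.range (2 ^ L) ×ˢ Finset.range (2 ^ L),
        {pos | pos z.1 ∈ (D.gridCell L c.1 c.2).region ∧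
          pos z.2 ∈ (D.gridCell L c.1 c.2).region} := by
    rintro pos ⟨x, y, hxy, a, ha, b, hb, h⟩
    simp only [Set.mem_iUnion]
    exact ⟨(x, y), by simp [hxy], (a, b), by simp [ha, hb], h⟩
  refine (measure_mono hsub).trans ((measure_biUnion_finset_le _ _).trans ?_)
  have hz : ∀ z ∈ (Finset.univ ×ˢ Finset.univ).filter (fun z : Fin n × Fin n => z.1 ≠ z.2),
      Measure.pi (fun _ : Fin n => D.law) (⋃ c ∈ Finset.range (2 ^ L) ×ˢ Finset.range (2 ^ L),
        {pos | pos z.1 ∈ (D.gridCell L c.1 c.2).region ∧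
          pos z.2 ∈ (D.gridCell L c.1 c.2).region}) ≤ ENNReal.ofReal ((1 / 4) ^ L) := by
    intro z hz
    refine (measure_biUnion_finset_le _ _).trans ((Finset.sum_le_card_nsmul _ _ _ fun c hc => by
      rw [Finset.mem_product, Finset.mem_range, Finset.mem_range] at hc
      exact hpair z.1 z.2 c.1 c.2 (Finset.mem_filter.1 hz).2 hc.1 hc.2).trans (le_of_eq ?_))
    rw [Finset.card_product, Finset.card_range, nsmul_eq_mul, ← ENNReal.ofReal_natCast,
      ← ENNReal.ofReal_mul (by positivity)]
    congr 1
    push_cast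
    rw [← mul_assoc, ← mul_pow, ← mul_pow]
    norm_num
  refine (Finset.sum_le_card_nsmul _ _ _ hz).trans ?_
  rw [nsmul_eq_mul, ← ENNReal.ofReal_natCast, ← ENNReal.ofReal_mul (by positivity)]
  refine ENNReal.ofReal_le_ofReal (mul_le_mul_of_nonneg_right ?_ (by positivity))
  have h := Finset.card_filter_le (Finset.univ ×ˢ Finset.univ) fun z : Fin n × Fin n => z.1 ≠ z.2
  rw [Finset.card_product, Finset.card_univ, Fintype.card_fin] at h
  rw [sq]
  exact_mod_cast h

end PNQ
end

/-! ### Tail bounds for the query, and the union of the exceptional events. -/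

noncomputable section
namespace PNQ

variable {n : ℕ} {R : ℝ} (D : PolarDensity R) {cap : ℕ} {G : Geometry} {Q : Query}

/-! ### The query on a fixed set of points -/

/-- With these weights a rejected candidate counts `e` and a neighbor `1`, so the generating
function is `1 + (e - 1) * (b - f)`, and `e - 1 ≤ 2`. -/
theorem logBound_rejected :
    LogBound (ENNReal.ofReal (Real.exp 1)) (ENNReal.ofReal (Real.exp (-1)))
      fun b f => 2 * (b - f) := by
  intro b f hf hfb hb
  rw [← ENNReal.ofReal_mul (Real.exp_nonneg _), ← Real.exp_add,
    ← ENNReal.ofReal_mul (by linarith), ← ENNReal.ofReal_mul hf,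
    ← ENNReal.ofReal_add (by linarith) (mul_nonneg (by linarith) (Real.exp_nonneg _)),
    ← ENNReal.ofReal_add (add_nonneg (by linarith) (mul_nonneg (by linarith) (Real.exp_nonneg _)))
      (mul_nonneg hf (Real.exp_nonneg _))]
  refine ENNReal.ofReal_le_ofReal (le_trans ?_ (Real.add_one_le_exp _))
  rw [add_neg_cancel, Real.exp_zero]
  nlinarith [Real.exp_one_lt_d9]

theorem logBound_neighbors :
    LogBound 1 (ENNReal.ofReal (Real.exp (-1))) fun _ f => -1 / 2 * f := by
  intro b f hf hfb hb
  rw [one_mul, mul_one, ← ENNReal.ofReal_mul hf, ← ENNReal.ofReal_add (by linarith) (by linarith),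
    ← ENNReal.ofReal_add (by linarith) (mul_nonneg hf (Real.exp_nonneg _))]
  refine ENNReal.ofReal_le_ofReal (le_trans ?_ (Real.add_one_le_exp _))
  nlinarith [exp_neg_one_le_half]

variable {pos : Fin n → PolarPoint}

/-- The number of rejected candidates is hardly larger than the cost of the tree. -/
theorem Valid.rejected_tail {d : ℕ} {T : QuadTree n} (hT : Valid G Q pos d T) {K : ℝ}
    (hK : T.cost G Q pos (fun b f => 2 * (b - f)) ≤ K) (s : ℝ) :
    (runQuery G Q pos T).toOuterMeasure
      {o | o.neighbors.length + (K + s) ≤ (o.candidates.length : ℝ)}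
      ≤ ENNReal.ofReal (Real.exp (-s)) := by
  have hw : ∀ o : Outcome n, weight (ENNReal.ofReal (Real.exp 1)) (ENNReal.ofReal (Real.exp (-1))) o
      = ENNReal.ofReal (Real.exp (o.candidates.length - o.neighbors.length)) := by
    intro o
    rw [weight, ← ENNReal.ofReal_pow (Real.exp_nonneg _), ← ENNReal.ofReal_pow (Real.exp_nonneg _),
      ← ENNReal.ofReal_mul (by positivity), ← Real.exp_nat_mul, ← Real.exp_nat_mul, ← Real.exp_add]
    congr 2; ring
  refine (toOuterMeasure_le_expect _ (fun o => ENNReal.ofReal (Real.exp (-(K + s)))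
    * weight (ENNReal.ofReal (Real.exp 1)) (ENNReal.ofReal (Real.exp (-1))) o)
    fun o ho => ?_).trans ?_
  · have ho : o.neighbors.length + (K + s) ≤ (o.candidates.length : ℝ) := ho
    rw [hw, ← ENNReal.ofReal_mul (Real.exp_nonneg _), ← Real.exp_add, ENNReal.one_le_ofReal]
    exact Real.one_le_exp (by linarith)
  · rw [expect_mul_left]
    refine (mul_le_mul' le_rfl (hT.expect_runQuery_le logBound_rejected)).trans ?_
    rw [← ENNReal.ofReal_mul (Real.exp_nonneg _), ← Real.exp_add]
    exact ENNReal.ofReal_le_ofReal (Real.exp_le_exp.2 (by linarith))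

/-- The number of neighbors is hardly smaller than a multiple of its expectation. -/
theorem Valid.neighbors_tail {d : ℕ} {T : QuadTree n} (hT : Valid G Q pos d T) (s : ℝ) :
    (runQuery G Q pos T).toOuterMeasure
      {o | (o.neighbors.length : ℝ) ≤ (T.points.map fun p => Q.prob G (pos p)).sum / 2 - s}
      ≤ ENNReal.ofReal (Real.exp (-s)) := by
  set M := (T.points.map fun p => Q.prob G (pos p)).sum with hM
  have hw : ∀ o : Outcome n, weight 1 (ENNReal.ofReal (Real.exp (-1))) o
      = ENNReal.ofReal (Real.exp (-o.neighbors.length)) := by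
    intro o
    rw [weight, one_pow, one_mul, ← ENNReal.ofReal_pow (Real.exp_nonneg _), ← Real.exp_nat_mul]
    congr 2; ring
  have hcost : T.cost G Q pos (fun _ f => -1 / 2 * f) = -1 / 2 * M := by
    rw [cost_of_indep (fun f => -1 / 2 * f), hM, List.sum_map_mul_left]
  refine (toOuterMeasure_le_expect _ (fun o => ENNReal.ofReal (Real.exp (M / 2 - s))
    * weight 1 (ENNReal.ofReal (Real.exp (-1))) o) fun o ho => ?_).trans ?_
  · have ho : (o.neighbors.length : ℝ) ≤ M / 2 - s := ho
    rw [hw, ← ENNReal.ofReal_mul (Real.exp_nonneg _), ← Real.exp_add, ENNReal.one_le_ofReal]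
    exact Real.one_le_exp (by linarith)
  · rw [expect_mul_left]
    refine (mul_le_mul' le_rfl (hT.expect_runQuery_le logBound_neighbors)).trans ?_
    rw [← ENNReal.ofReal_mul (Real.exp_nonneg _), ← Real.exp_add, hcost]
    exact ENNReal.ofReal_le_ofReal (Real.exp_le_exp.2 (by linarith))

/-- The complexity of the query on points in typical position. -/
theorem query_tail (hcap : 1 ≤ cap) {m : ℕ} (hm : (4 : ℝ) ^ m ≤ 4 * n)
    (hroot : ∀ p, pos p ∈ (rootCell R).region)
    (hsep : ∀ x y, ∀ a < 2 ^ (4 * m), ∀ b < 2 ^ (4 * m),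
      pos x ∈ (D.gridCell (4 * m) a b).region → pos y ∈ (D.gridCell (4 * m) a b).region → x = y)
    (hexcess : ∑ p, totalExcess D G Q m (pos p) ≤ 30 * Real.sqrt n)
    (hmean : n * ∫ p, Q.clipped G p ∂D.law ≤ 2 * ∑ p, Q.clipped G (pos p) + 2 * Real.sqrt n) :
    (runQuery G Q pos (quadtree D cap pos)).toOuterMeasure {o | ¬(
      (o.candidates.length : ℝ) ≤ o.neighbors.length + (61 + 168 * cap) * Real.sqrt n ∧
      (o.cells : ℝ) ≤ 1 + 56 * Real.sqrt n + m * (96 * o.neighbors.length + 608 * Real.sqrt n) ∧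
      (o.time : ℝ) ≤ 3 * o.cells + (24 * m + 2) * o.candidates.length)}
      ≤ ENNReal.ofReal (2 * Real.exp (-Real.sqrt n)) := by
  have hroot' : ∀ p, pos p ∈ (D.gridCell 0 0 0).region := by rwa [D.gridCell_zero]
  have hpts : gridPoints D pos 0 0 0 = List.finRange n := by
    rw [gridPoints, pointsIn, List.filter_eq_self]
    exact fun p _ => by simpa using hroot' p
  have hres := resolved_of_separated D hcap hsep (d := 4 * m) (i := 0) (a := 0) (b := 0) (by omega)
    (by norm_num) (by norm_num) (List.nodup_finRange n) fun p _ => hroot' p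
  rw [D.gridCell_zero] at hres
  have htree : quadtree D cap pos = gridTree D cap pos (4 * m) 0 0 0 := by
    rw [hres.quadtree_eq, gridTree, hpts, D.gridCell_zero, Nat.sub_zero]
  rw [htree]
  set T := gridTree D cap pos (4 * m) 0 0 0 with hTdef
  have hT : Valid G Q pos (4 * m) T := valid_gridTree D (4 * m) (i := 0) (a := 0) (b := 0) (by norm_num)
  set M := ∑ p, Q.clipped G (pos p) with hM
  have hsum : (T.points.map fun p => Q.prob G (pos p)).sum = M := by
    rw [hTdef, gridTree, sum_points_build D _ (by norm_num) fun p hp => (mem_gridPoints D).1 hp,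
      hpts, ← Fin.sum_univ_def, hM]
    exact Finset.sum_congr rfl fun p _ =>
      (Query.clipped_eq (D.radius_nonneg_of_mem (hroot' p))).symm
  have hsq : Real.sqrt n * Real.sqrt n = n := Real.mul_self_sqrt (Nat.cast_nonneg n)
  have hs0 : 0 ≤ Real.sqrt n := Real.sqrt_nonneg _
  have h2m : (2 : ℝ) ^ m ≤ 2 * Real.sqrt n := by
    refine abs_le_of_sq_le_sq' ?_ (by positivity) |>.2
    rw [← pow_mul, mul_comm m, pow_mul, mul_pow, sq (Real.sqrt n), hsq]
    norm_num; exact hm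
  have hcap0 : (0 : ℝ) ≤ cap := Nat.cast_nonneg _
  -- `2 * 30 = 60` from the excess, and `84 * cap * 2 ^ m ≤ 168 * cap * √n`.
  have hcost : T.cost G Q pos (fun b f => 2 * (b - f)) ≤ (60 + 168 * cap) * Real.sqrt n := by
    have h := cost_root_le D (cap := cap) (G := G) (Q := Q) (pos := pos) hcap (m := m) (L := 4 * m)
      (by omega)
    have h' := mul_le_mul_of_nonneg_left h2m (by positivity : (0 : ℝ) ≤ 84 * cap)
    linarith
  have hμ0 : 0 ≤ ∫ p, Q.clipped G p ∂D.law := integral_nonneg fun p => (Query.clipped_mem p).1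
  have hm0 : (0 : ℝ) ≤ m := Nat.cast_nonneg _
  have hcalls : (T.calls G Q : ℝ) ≤ 1 + 56 * Real.sqrt n + m * (48 * M + 512 * Real.sqrt n) := by
    have h := calls_root_le D (cap := cap) (G := G) (Q := Q) (pos := pos) (m := m) (L := 4 * m)
      (by omega) (gridSum_lower_le D)
    have h1 := mul_le_mul_of_nonneg_right hm hμ0
    -- Times `4 * m` this gives `m * (32 * M + 32 * √n)`; the levels down to `4 * m` add `16 * m *
    -- (30 * √n + M)`.
    have h2 : 4 ^ m * ∫ p, Q.clipped G p ∂D.law ≤ 8 * M + 8 * Real.sqrt n := by linarith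
    have h3 := mul_le_mul_of_nonneg_left h2 (by positivity : (0 : ℝ) ≤ 4 * m)
    have h4 := mul_le_mul_of_nonneg_left hexcess (by positivity : (0 : ℝ) ≤ 16 * m)
    push_cast at h
    refine h.trans ?_
    linarith
  have t1 := hT.rejected_tail hcost (Real.sqrt n)
  have t2 := hT.neighbors_tail (Real.sqrt n)
  rw [hsum] at t2
  rw [two_mul, ENNReal.ofReal_add (Real.exp_nonneg _) (Real.exp_nonneg _)]
  refine le_trans (PMF.toOuterMeasure_mono _ ?_) ((measure_union_le _ _).trans (add_le_add t1 t2))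
  rintro o ⟨ho, hsupp⟩
  obtain ⟨c1, -, c3⟩ := hT.support_runQuery hsupp
  by_contra hcon
  simp only [Set.mem_union, Set.mem_ofPred_eq, not_or, not_le] at hcon
  obtain ⟨b1, b2⟩ := hcon
  refine ho ⟨by linarith, ?_, ?_⟩
  · rw [c1]
    refine hcalls.trans ?_
    -- Here `M ≤ 2 * neighbors + 2 * √n`, by the tail bound for neighbors.
    have : m * (48 * M + 512 * Real.sqrt n)
        ≤ m * (96 * o.neighbors.length + 608 * Real.sqrt n) :=
      mul_le_mul_of_nonneg_left (by linarith) hm0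
    linarith
  · have c3' : (o.time : ℝ) + 1 ≤ 3 * o.cells + (6 * (4 * m) + 2) * o.candidates.length := by
      exact_mod_cast c3
    linarith

/-! ### Random points -/

/-- Neither `B` nor the integrand is known to be measurable, so `B` is replaced by its measurable
hull and the integrand is bounded below by an indicator. Then `1 - (δ + ε) ≤ (1 - ε) * (1 - δ)` in
truncated subtraction. -/
theorem le_queryProb {E : Outcome n → Prop} {B : Set (Fin n → PolarPoint)} {δ ε : ℝ≥0∞}
    (hB : Measure.pi (fun _ : Fin n => D.law) B ≤ δ)
    (h : ∀ pos, pos ∉ B →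
      (runQuery G Q pos (quadtree D cap pos)).toOuterMeasure {o | ¬E o} ≤ ε) :
    1 - (δ + ε) ≤ queryProb G D cap n Q E := by
  set μ := Measure.pi fun _ : Fin n => D.law with hμ
  have hmeas := (measurableSet_toMeasurable μ B).compl
  have h1 : ∀ pos, (toMeasurable μ B)ᶜ.indicator (fun _ => 1 - ε) pos
      ≤ (runQuery G Q pos (quadtree D cap pos)).toOuterMeasure {o | E o} := by
    intro pos
    by_cases hpos : pos ∈ (toMeasurable μ B)ᶜ
    · rw [Set.indicator_of_mem hpos, tsub_le_iff_right]
      have hb := h pos fun hp => hpos (subset_toMeasurable μ B hp)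
      have hu : (runQuery G Q pos (quadtree D cap pos)).toOuterMeasure Set.univ = 1 :=
        (PMF.toOuterMeasure_apply_eq_one_iff _ _).2 (Set.subset_univ _)
      have hunion : (Set.univ : Set (Outcome n)) = {o | E o} ∪ {o | ¬E o} := by
        ext o; simp [em]
      rw [← hu, hunion]
      exact (measure_union_le _ _).trans (add_le_add le_rfl hb)
    · rw [Set.indicator_of_notMem hpos]; exact zero_le
  refine le_trans ?_ (lintegral_mono h1)
  rw [lintegral_indicator hmeas, setLIntegral_const, measure_compl (measurableSet_toMeasurable μ B)
    (measure_ne_top μ _), measure_univ, measure_toMeasurable]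
  refine le_trans ?_ (mul_le_mul' le_rfl (tsub_le_tsub_left hB 1))
  rw [add_comm, ← tsub_tsub, tsub_le_iff_right]
  calc 1 - ε = (1 - ε) * 1 := (mul_one _).symm
    _ ≤ (1 - ε) * (1 - δ + δ) := mul_le_mul' le_rfl le_tsub_add
    _ = (1 - ε) * (1 - δ) + (1 - ε) * δ := mul_add _ _ _
    _ ≤ (1 - ε) * (1 - δ) + δ :=
      add_le_add le_rfl ((mul_le_mul' tsub_le_self le_rfl).trans (one_mul δ).le)

/-- With high probability the points are in typical position. -/
theorem exists_typical {m : ℕ} (hn : 0 < n) (hm : (n : ℝ) ≤ 4 ^ m) :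
    ∃ B : Set (Fin n → PolarPoint),
      Measure.pi (fun _ : Fin n => D.law) B
        ≤ ENNReal.ofReal (1 / n ^ 2 + 2 * Real.exp (-Real.sqrt n)) ∧
      ∀ pos ∉ B, (∀ p, pos p ∈ (rootCell R).region) ∧
        (∀ x y, ∀ a < 2 ^ (4 * m), ∀ b < 2 ^ (4 * m), pos x ∈ (D.gridCell (4 * m) a b).region →
          pos y ∈ (D.gridCell (4 * m) a b).region → x = y) ∧
        ∑ p, totalExcess D G Q m (pos p) ≤ 30 * Real.sqrt n ∧
        n * ∫ p, Q.clipped G p ∂D.law ≤ 2 * ∑ p, Q.clipped G (pos p) + 2 * Real.sqrt n := by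
  have hn' : (0 : ℝ) < n := by exact_mod_cast hn
  have hsq : Real.sqrt n * Real.sqrt n = n := Real.mul_self_sqrt hn'.le
  have hs0 : 0 < Real.sqrt n := Real.sqrt_pos.2 hn'
  refine ⟨{pos | ∃ p, pos p ∉ (rootCell R).region} ∪
    ({pos | ∃ x y, x ≠ y ∧ ∃ a < 2 ^ (4 * m), ∃ b < 2 ^ (4 * m),
      pos x ∈ (D.gridCell (4 * m) a b).region ∧ pos y ∈ (D.gridCell (4 * m) a b).region} ∪
    ({pos | 2 * (n * (14 * (1 / 2) ^ m) + Real.sqrt n) ≤ ∑ p, totalExcess D G Q m (pos p)} ∪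
    {pos | ∑ p, Q.clipped G (pos p) ≤ n * (∫ p, Q.clipped G p ∂D.law) / 2 - Real.sqrt n})),
    ?_, fun pos hpos => ?_⟩
  · refine (measure_union_le _ _).trans ?_
    rw [measure_outside_root, zero_add]
    refine (measure_union_le _ _).trans ((add_le_add (measure_not_separated_le D (4 * m))
      ((measure_union_le _ _).trans (add_le_add (measure_totalExcess_le D m (Real.sqrt n))
        (measure_clipped_le D (Real.sqrt n))))).trans ?_)
    rw [← ENNReal.ofReal_add (Real.exp_nonneg _) (Real.exp_nonneg _), ← two_mul,
      ← ENNReal.ofReal_add (by positivity) (by positivity)]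
    refine ENNReal.ofReal_le_ofReal (add_le_add ?_ le_rfl)
    -- The depth `4 * m` is chosen so that `n ^ 2 / 4 ^ (4 * m) ≤ 1 / n ^ 2`, because `n ≤ 4 ^ m`.
    rw [one_div_pow, mul_one_div, div_le_div_iff₀ (by positivity) (by positivity), one_mul,
      ← pow_add, mul_comm 4 m, pow_mul]
    exact pow_le_pow_left₀ hn'.le hm 4
  · simp only [Set.mem_union, Set.mem_ofPred_eq, not_or, not_exists, not_not, not_and, not_le,
      ne_eq] at hpos
    obtain ⟨h1, h2, h3, h4⟩ := hpos
    refine ⟨h1, fun x y a ha b hb hx hy => ?_, ?_, by linarith⟩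
    · by_contra hxy
      exact h2 x y hxy a ha b hb hx hy
    · have h2m : Real.sqrt n ≤ 2 ^ m := by
        refine Real.sqrt_le_iff.2 ⟨by positivity, hm.trans (le_of_eq ?_)⟩
        rw [← pow_mul, mul_comm m, pow_mul]; norm_num
      -- Hence the threshold `2 * (14 * n * 2 ^ (-m) + √n)` is at most `30 * √n`.
      have h5 : n * (1 / 2 : ℝ) ^ m ≤ Real.sqrt n := by
        rw [one_div_pow, mul_one_div, div_le_iff₀ (by positivity)]
        calc (n : ℝ) = Real.sqrt n * Real.sqrt n := hsq.symm
          _ ≤ _ := mul_le_mul_of_nonneg_left h2m hs0.le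
      linarith

/-- From `exp x ≥ x ^ 4 / 24` at `x = √n`, every exponential is at most `24 / n ^ 2`. The sum is at
most `97 / n ^ 2`, whence the threshold `100`. -/
theorem failure_le {n : ℕ} (hn : 100 ≤ n) :
    1 / (n : ℝ) ^ 2 + 2 * Real.exp (-Real.sqrt n) + 2 * Real.exp (-Real.sqrt n) ≤ 1 / n := by
  have hn' : (100 : ℝ) ≤ n := by exact_mod_cast hn
  have hpos : (0 : ℝ) < n := by linarith
  have h := Real.pow_div_factorial_le_exp (Real.sqrt n) (Real.sqrt_nonneg _) 4
  have e : Real.sqrt n ^ 4 = (n : ℝ) ^ 2 := by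
    rw [show 4 = 2 * 2 from rfl, pow_mul, Real.sq_sqrt hpos.le]
  rw [e] at h
  have h1 : Real.exp (-Real.sqrt n) ≤ 24 / (n : ℝ) ^ 2 := by
    rw [Real.exp_neg, ← one_div, div_le_div_iff₀ (Real.exp_pos _) (by positivity)]
    rw [div_le_iff₀ (by positivity)] at h
    norm_num [Nat.factorial] at h ⊢
    linarith
  have h2 : 97 / (n : ℝ) ^ 2 ≤ 1 / n := by
    rw [div_le_div_iff₀ (by positivity) hpos]; nlinarith
  have h3 : 97 / (n : ℝ) ^ 2 = 1 / (n : ℝ) ^ 2 + 96 / (n : ℝ) ^ 2 := by ring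
  have h4 : 96 / (n : ℝ) ^ 2 = 4 * (24 / (n : ℝ) ^ 2) := by ring
  linarith

end PNQ
end

theorem mainTheorem1 (cap : ℕ) (hcap : 1 ≤ cap) :
    ∃ (C : ℝ) (n₀ : ℕ), 0 < C ∧
      ∀ (G : PNQ.Geometry) (R : ℝ) (D : PNQ.PolarDensity R) (Q : PNQ.Query) (n : ℕ), n₀ ≤ n →
        1 - 1 / (n : ENNReal) ≤ PNQ.queryProb G D cap n Q (fun o =>
            (o.time : ℝ) ≤ C * ((o.neighbors.length + Real.sqrt n) * Real.log n)) ∧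
        1 - 1 / (n : ENNReal) ≤ PNQ.queryProb G D cap n Q (fun o =>
            (o.candidates.length : ℝ) ≤ C * (o.neighbors.length + Real.sqrt n)) ∧
        1 - 1 / (n : ENNReal) ≤ PNQ.queryProb G D cap n Q (fun o =>
            (o.cells : ℝ) ≤ C * ((o.neighbors.length + Real.sqrt n) * Real.log n)) := by
  have hcap0 : (0 : ℝ) ≤ cap := Nat.cast_nonneg cap
  -- For the time, `3 * 1300` from the cells and `50 * (61 + 168 * cap)` from the candidates add up
  -- to `6950 + 8400 * cap`.
  refine ⟨7000 + 8400 * cap, 100, by positivity, fun G R D Q n hn => ?_⟩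
  have hn' : (100 : ℝ) ≤ n := by exact_mod_cast hn
  have hpos : (0 : ℝ) < n := by linarith
  have hm : (n : ℝ) ≤ 4 ^ Nat.clog 4 n := by exact_mod_cast Nat.le_pow_clog (by norm_num) n
  have hclog : 0 < Nat.clog 4 n := Nat.clog_pos (by norm_num) (by omega)
  have hm' : (4 : ℝ) ^ Nat.clog 4 n ≤ 4 * n := by
    have h : 4 ^ (Nat.clog 4 n).pred < n := Nat.pow_pred_clog_lt_self (by norm_num) (by omega)
    have e : 4 ^ Nat.clog 4 n = 4 ^ (Nat.clog 4 n).pred * 4 := by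
      rw [← pow_succ, Nat.pred_eq_sub_one, Nat.sub_add_cancel hclog]
    have h' : 4 ^ Nat.clog 4 n ≤ 4 * n := by omega
    exact_mod_cast h'
  set m := Nat.clog 4 n
  have hm0 : (0 : ℝ) ≤ m := Nat.cast_nonneg m
  have hlog1 : 1 ≤ Real.log n := by
    rw [Real.le_log_iff_exp_le hpos]
    linarith [Real.exp_one_lt_d9]
  have hmlog : (m : ℝ) ≤ 2 * Real.log n := by
    have h := Real.log_le_log (by positivity) hm'
    rw [Real.log_pow, Real.log_mul (by norm_num) hpos.ne'] at h
    have h4 : 1 ≤ Real.log 4 := by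
      rw [Real.le_log_iff_exp_le (by norm_num)]
      linarith [Real.exp_one_lt_d9]
    have h5 : (m - 1 : ℝ) * Real.log 4 ≤ Real.log n := by linarith
    nlinarith
  have hsqrt : 1 ≤ Real.sqrt n := Real.one_le_sqrt.2 (by linarith)
  obtain ⟨B, hB, hgood⟩ := PNQ.exists_typical D (G := G) (Q := Q) (by omega) hm
  have hδ : ENNReal.ofReal (1 / n ^ 2 + 2 * Real.exp (-Real.sqrt n))
      + ENNReal.ofReal (2 * Real.exp (-Real.sqrt n)) ≤ 1 / (n : ENNReal) := by
    rw [← ENNReal.ofReal_add (by positivity) (by positivity)]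
    refine (ENNReal.ofReal_le_ofReal (PNQ.failure_le hn)).trans (le_of_eq ?_)
    rw [ENNReal.ofReal_div_of_pos hpos, ENNReal.ofReal_one, ENNReal.ofReal_natCast]
  -- All three claims hold on the same typical event.
  have key : ∀ E : PNQ.Outcome n → Prop, (∀ o,
      (o.candidates.length : ℝ) ≤ o.neighbors.length + (61 + 168 * cap) * Real.sqrt n →
      (o.cells : ℝ) ≤ 1 + 56 * Real.sqrt n
        + m * (96 * o.neighbors.length + 608 * Real.sqrt n) →
      (o.time : ℝ) ≤ 3 * o.cells + (24 * m + 2) * o.candidates.length → E o) →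
      1 - 1 / (n : ENNReal) ≤ PNQ.queryProb G D cap n Q E := by
    intro E hE
    refine (tsub_le_tsub_left hδ 1).trans (PNQ.le_queryProb D hB fun pos hpos => ?_)
    obtain ⟨h1, h2, h3, h4⟩ := hgood pos hpos
    refine le_trans (PMF.toOuterMeasure_mono _ fun o ho => ?_)
      (PNQ.query_tail D hcap hm' h1 h2 h3 h4)
    exact fun hcon => ho.1 (hE o hcon.1 hcon.2.1 hcon.2.2)
  have cand : ∀ o : PNQ.Outcome n,
      (o.candidates.length : ℝ) ≤ o.neighbors.length + (61 + 168 * cap) * Real.sqrt n →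
      (o.candidates.length : ℝ) ≤ (61 + 168 * cap) * (o.neighbors.length + Real.sqrt n) := by
    intro o h
    have hN : (0 : ℝ) ≤ o.neighbors.length := Nat.cast_nonneg _
    have := mul_nonneg (by positivity : (0 : ℝ) ≤ 60 + 168 * cap) hN
    linarith
  have cells : ∀ o : PNQ.Outcome n, (o.cells : ℝ) ≤ 1 + 56 * Real.sqrt n
        + m * (96 * o.neighbors.length + 608 * Real.sqrt n) →
      (o.cells : ℝ) ≤ 1300 * ((o.neighbors.length + Real.sqrt n) * Real.log n) := by
    intro o h
    have hN : (0 : ℝ) ≤ o.neighbors.length := Nat.cast_nonneg _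
    have h1 := mul_le_mul_of_nonneg_right hmlog
      (by positivity : 0 ≤ 96 * (o.neighbors.length : ℝ) + 608 * Real.sqrt n)
    have h2 := mul_le_mul_of_nonneg_left hlog1 (by positivity : (0 : ℝ) ≤ 57 * Real.sqrt n)
    have h3 : 0 ≤ (o.neighbors.length : ℝ) * Real.log n := mul_nonneg hN (by linarith)
    have h4 : 0 ≤ Real.sqrt n * Real.log n := mul_nonneg (by linarith) (by linarith)
    linarith
  refine ⟨key _ fun o h1 h2 h3 => ?_, key _ fun o h1 _ _ => ?_, key _ fun o _ h2 _ => ?_⟩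
  · have hN : (0 : ℝ) ≤ o.neighbors.length := Nat.cast_nonneg _
    have hK : (0 : ℝ) ≤ (61 + 168 * cap) * (o.neighbors.length + Real.sqrt n) := by positivity
    have h5 : 24 * (m : ℝ) + 2 ≤ 50 * Real.log n := by linarith
    have h6 := mul_le_mul_of_nonneg_left (cand o h1) (by positivity : (0 : ℝ) ≤ 24 * m + 2)
    have h7 := mul_le_mul_of_nonneg_right h5 hK
    have h8 := cells o h2
    have h9 : 0 ≤ (o.neighbors.length + Real.sqrt n) * Real.log n :=
      mul_nonneg (by positivity) (by linarith)
    linarith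
  · refine (cand o h1).trans (mul_le_mul_of_nonneg_right (by linarith) (by positivity))
  · refine (cells o h2).trans (mul_le_mul_of_nonneg_right (by linarith) ?_)
    exact mul_nonneg (by positivity) (by linarith)
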